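/- Let $P=\sqrt{-\Delta}$ in $\mathbb R^2$, and for functions on $\mathbb R^2$ put $$\|f\|_{L^r_{|x|}L^2_\theta}=\Big(\int_0^\infty\Big(\int_0^{2\pi}|f(\rho(\cos\theta,\sin\theta))|^2\,d\theta\Big)^{r/2}\rho\,d\rho\Big)^{1/r},$$ with the essential supremum over $\rho>0$ if $r=\infty$; let $\|u\|_{L^q_tL^r_{|x|}L^2_\theta}$ be the $L^q(\mathbb R)$ norm of $t\mapsto\|u(t,\cdot)\|_{L^r_{|x|}L^2_\theta}$. Let $\dot H^\gamma(\mathbb R^2)$ be the space of tempered distributions $g$ whose Fourier transform $\hat g$ is a function with $\|g\|_{\dot H^\gamma}^2=(2\pi)^{-2}\int_{\mathbb R^2}\big||\xi|^\gamma\hat g(\xi)\big|^2d\xi<\infty$, and let $e^{-itP}g$ be the tempered distribution whose Fourier transform is $e^{-it|\xi|}\hat g(\xi)$. Let $q,r\in[1,\infty]$ be such that either $q,r>2$, $\frac1q<\frac12-\frac1r$ and $(q,r)\ne(\infty,\infty)$, or $(q,r)=(\infty,2)$ (with $1/\infty=0$), and let $\gamma=2\left(\frac12-\frac1r\right)-\frac1q$.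 Then there is a finite constant $C_{q,r}$, depending only on $q$ and $r$, such that for every $g\in\dot H^\gamma(\mathbb R^2)$ the evolution $e^{-itP}g$ is given by a measurable function on $\mathbb R\times\mathbb R^2$ and $$\big\|e^{-itP}g\big\|_{L^q_tL^r_{|x|}L^2_\theta(\mathbb R\times\mathbb R^2)}\le C_{q,r}\,\|g\|_{\dot H^\gamma(\mathbb R^2)}.$$ -/

import Mathlib

open MeasureTheory FourierTransform
open scoped SchwartzMap ENNReal NNReal

noncomputable section

namespace AngularStrichartz

/-- The Euclidean plane `ℝ²`. -/
abbrev Plane : Type := EuclideanSpace ℝ (Fin 2)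

/-! ### Tempered distributions given by functions -/

/-- The tempered distribution `T` is the function `f`, acting on Schwartz functions `φ` by
`φ ↦ ∫ φ f` (an absolutely convergent integral). -/
def Represents (f : Plane → ℂ) (T : 𝓢'(Plane, ℂ)) : Prop :=
  ∀ φ : 𝓢(Plane, ℂ), Integrable (fun x => φ x * f x) ∧ T φ = ∫ x, φ x * f x

/-- A function is the density of at most one tempered distribution. -/
theorem Represents.unique {f : Plane → ℂ} {S T : 𝓢'(Plane, ℂ)}
    (hS : Represents f S) (hT : Represents f T) : S = T := by
  ext φ
  rw [(hS φ).2, (hT φ).2]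

/-- A density that pairs integrably with all Schwartz functions is locally integrable. -/
theorem Represents.locallyIntegrable {f : Plane → ℂ} {T : 𝓢'(Plane, ℂ)} (h : Represents f T) :
    LocallyIntegrable f := by
  intro x
  let b : ContDiffBump x := ⟨1, 2, one_pos, one_lt_two⟩
  have hs : HasCompactSupport (fun y => (b y : ℂ)) :=
    b.hasCompactSupport.comp_left (g := fun a : ℝ => (a : ℂ)) Complex.ofReal_zero
  have hc : ContDiff ℝ (⊤ : ℕ∞) (fun y => (b y : ℂ)) :=
    Complex.ofRealCLM.contDiff.comp b.contDiff
  have hi := (h (hs.toSchwartzMap hc)).1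
  refine ⟨Metric.closedBall x 1, Metric.closedBall_mem_nhds x one_pos, ?_⟩
  refine (hi.integrableOn (s := Metric.closedBall x 1)).congr_fun ?_
    Metric.isClosed_closedBall.measurableSet
  intro y hy
  have : b y = 1 := b.one_of_mem_closedBall hy
  simp [this]

/-- The density of a tempered distribution is unique almost everywhere. -/
theorem Represents.ae_eq {f g : Plane → ℂ} {T : 𝓢'(Plane, ℂ)}
    (hf : Represents f T) (hg : Represents g T) : f =ᵐ[volume] g := by
  refine ae_eq_of_integral_contDiff_smul_eq hf.locallyIntegrable hg.locallyIntegrable ?_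
  intro φ hφ hsupp
  have hs : HasCompactSupport (fun y => (φ y : ℂ)) :=
    hsupp.comp_left (g := fun a : ℝ => (a : ℂ)) Complex.ofReal_zero
  have hc : ContDiff ℝ (⊤ : ℕ∞) (fun y => (φ y : ℂ)) :=
    Complex.ofRealCLM.contDiff.comp hφ
  have h := ((hf (hs.toSchwartzMap hc)).2).symm.trans (hg (hs.toSchwartzMap hc)).2
  simpa using h

open scoped Classical in
/-- The tempered distribution with density `f` (zero if there is none). -/
def ofDensity (f : Plane → ℂ) : 𝓢'(Plane, ℂ) :=
  if h : ∃ T, Represents f T then h.choose else 0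

open scoped Classical in
/-- The density of the Fourier transform `𝓕 g` of a tempered distribution `g`, if `𝓕 g` is a
function (and zero if it is not). Mathlib's convention is
`𝓕 g ξ = ∫ exp (-2πi x·ξ) g x dx`, so that `𝓕 g ξ` is the value at `2πξ` of the Fourier transform
`ĝ` with kernel `exp (-i x·ξ)`. -/
def fourierDensity (g : 𝓢'(Plane, ℂ)) : Plane → ℂ :=
  if h : ∃ f, Represents f (𝓕 g) then h.choose else 0

/-! ### The operator `P = √(-Δ)`, homogeneous Sobolev spaces, the half-wave group -/

/-- The symbol `2π|ξ|` of `P = √(-Δ)` in Mathlib's normalization of the Fourier transform: `-Δ` is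
multiplication by `(2π|ξ|)²` on the Fourier side. -/
def symbolP (ξ : Plane) : ℝ := 2 * Real.pi * ‖ξ‖

/-- The half-wave operator `exp (-itP)`: multiplication of the Fourier transform by
`exp (-it·2π|ξ|)`. It is defined on those tempered distributions whose Fourier transform is a
function, since the multiplier is not smooth at the origin. -/
def halfWave (t : ℝ) (g : 𝓢'(Plane, ℂ)) : 𝓢'(Plane, ℂ) :=
  𝓕⁻ (ofDensity fun ξ =>
    Complex.exp (-(Complex.I * (t : ℂ) * (symbolP ξ : ℂ))) * fourierDensity g ξ)

open scoped Classical in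
/-- The norm of the homogeneous Sobolev space `Ḣ^γ(ℝ²)`. Substituting `ξ ↦ 2πξ`, one has
`(2π)⁻² ∫ | |ξ|^γ ĝ(ξ) |² dξ = ∫ | (2π|ξ|)^γ 𝓕 g ξ |² dξ`. The value is `∞` if the Fourier
transform of `g` is not a function. -/
def homSobolevNorm (γ : ℝ) (g : 𝓢'(Plane, ℂ)) : ℝ≥0∞ :=
  if ∃ f, Represents f (𝓕 g) then
    eLpNorm (fun ξ => ((symbolP ξ ^ γ : ℝ) : ℂ) * fourierDensity g ξ) 2 volume
  else ∞

/-- `g ∈ Ḣ^γ(ℝ²)`. -/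
def MemHomSobolev (γ : ℝ) (g : 𝓢'(Plane, ℂ)) : Prop := homSobolevNorm γ g < ∞

/-! ### Angular mixed norms -/

/-- The measure `ρ dρ` on `(0, ∞)`. -/
def radialMeasure : Measure ℝ :=
  (volume.restrict (Set.Ioi (0 : ℝ))).withDensity fun ρ => ENNReal.ofReal ρ

/-- `(∫₀^{2π} |f(ρ(cos θ, sin θ))|² dθ)^{1/2}`. -/
def angularNorm (f : Plane → ℂ) (ρ : ℝ) : ℝ≥0∞ :=
  eLpNorm (fun θ : ℝ => f !₂[ρ * Real.cos θ, ρ * Real.sin θ]) 2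
    (volume.restrict (Set.Ioo 0 (2 * Real.pi)))

/-- The norm of `L^r_{|x|} L²_θ(ℝ²)`; an essential supremum over `|x|` if `r = ∞`. -/
def radialAngularNorm (r : ℝ≥0∞) (f : Plane → ℂ) : ℝ≥0∞ :=
  eLpNorm (angularNorm f) r radialMeasure

/-- The norm of `L^q_t L^r_{|x|} L²_θ(ℝ × ℝ²)`; an essential supremum over `t` if `q = ∞`. -/
def mixedNorm (q r : ℝ≥0∞) (u : ℝ → Plane → ℂ) : ℝ≥0∞ :=
  eLpNorm (fun t => radialAngularNorm r (u t)) q volume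

/-- `γ = 2(1/2 - 1/r) - 1/q`, with `1/∞ = 0`. -/
def scalingExponent (q r : ℝ≥0∞) : ℝ := 2 * (1 / 2 - (r⁻¹).toReal) - (q⁻¹).toReal

end AngularStrichartz

end

open AngularStrichartz

/-! Let the frequencies lie in R ≤ |ξ| < 2R, write u for the half-wave, ‖f‖ for the L² norm of its
density, and F(t, ρ) for the integral of |u|² over the angle on the circle of radius ρ. A
one-dimensional Sobolev inequality along rays at scale 1/R bounds F by the integral in ds dθ of an
energy density e ≈ R|u|² + R⁻¹|∇u|² over the shell ρ < s < ρ + 1/R (`circleMass_le_energy`). Put X =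
ρ + 1/R and let Ψ(t) be the integral of e against |x|^(-1-δ). Then F ≤ X^δ Ψ(t)
(`circleMass_le_weightedEnergy`), while F·X ≤ C R ‖f‖² by the fixed-time L² bound
(`circleMass_mul_le`). The first bound times the δ-th power of the second no longer contains ρ:
F^(1+δ) ≤ Ψ(t) (C R ‖f‖²)^δ (`circleMass_rpow_le`).

Integrability of Ψ over all times is local energy decay (`lintegral_weightedEnergy_le`), valid for 0
< δ < 1. The weight is dominated by a superposition of Gaussians exp(-πτ²|x|²). For each of them the
T T* argument and Schur's test leave a kernel concentrated on |η| = |ξ|, |ξ - η| ≲ τ, and its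
marginals amount to measuring an arc of a circle (`lintegral_annulus_gaussHat_le`). No dispersive
estimate is used.

Thus the supremum over ρ of the angular norm is in L^(2(1+δ)) in time. Interpolation in ρ with the
L² bound gives, for one frequency block, a scale-invariant estimate in L^s in time for some s < q,
next to the uniform one (`exists_majorant_radialAngularNorm`). Two such bounds suffice to sum the
dyadic blocks in L^q with an ℓ² norm on the right, as in real interpolation (`eLpNorm_tsum_le_l2`);
no square function is needed. For q = ∞ the same summation lemma is applied in the radial variable
instead. The pair (∞, 2) is the L² bound at fixed time.

To reach tempered distributions, the block series is shown to converge absolutely against Schwartz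
functions and to represent the half-wave (`represents_halfWave`). Since densities are unique almost
everywhere, the estimate carries over to every representative. -/

namespace AngularStrichartz

/-! ### Countable sums of nonnegative functions in `L^p` -/

/-- Monotone convergence along finite subsets. For p = ∞ it matters that a countable type has only
countably many of them. -/
theorem eLpNorm_tsum_le_of_finset {α ι : Type*} [MeasurableSpace α] [Countable ι] {μ : Measure α}
    {p : ℝ≥0∞} (hp : 1 ≤ p) {f : ι → α → ℝ≥0∞} (hf : ∀ i, AEMeasurable (f i) μ) {B : ℝ≥0∞}
    (h : ∀ s : Finset ι, eLpNorm (fun x => ∑ i ∈ s, f i x) p μ ≤ B) :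
    eLpNorm (fun x => ∑' i, f i x) p μ ≤ B := by
  have hp0 : p ≠ 0 := (zero_lt_one.trans_le hp).ne'
  rcases eq_or_ne p ∞ with rfl | hpt
  · simp only [eLpNorm_exponent_top] at h ⊢
    have : ∀ᵐ x ∂μ, ∀ s : Finset ι, ‖∑ i ∈ s, f i x‖ₑ ≤ B := by
      rw [ae_all_iff]
      intro s
      filter_upwards [enorm_ae_le_eLpNormEssSup (fun x => ∑ i ∈ s, f i x) μ] with x hx
      exact hx.trans (h s)
    refine eLpNormEssSup_le_of_ae_enorm_bound ?_
    filter_upwards [this] with x hx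
    simp only [enorm_eq_self] at hx ⊢
    rw [ENNReal.tsum_eq_iSup_sum]
    exact iSup_le hx
  · have hpr : 0 < p.toReal := ENNReal.toReal_pos hp0 hpt
    simp only [eLpNorm_eq_lintegral_rpow_enorm_toReal hp0 hpt, enorm_eq_self, one_div] at h ⊢
    simp only [ENNReal.rpow_inv_le_iff hpr] at h ⊢
    have : ∀ x, (∑' i, f i x) ^ p.toReal = ⨆ s : Finset ι, (∑ i ∈ s, f i x) ^ p.toReal := by
      intro x
      rw [ENNReal.tsum_eq_iSup_sum]
      exact (ENNReal.orderIsoRpow _ hpr).map_iSup _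
    simp only [this]
    rw [lintegral_iSup_directed]
    · exact iSup_le h
    · intro s
      exact (Finset.aemeasurable_fun_sum _ fun i _ => hf i).pow_const _
    · classical
      intro s t
      refine ⟨s ∪ t, fun x => ?_, fun x => ?_⟩
      · exact ENNReal.rpow_le_rpow (Finset.sum_le_sum_of_subset Finset.subset_union_left) hpr.le
      · exact ENNReal.rpow_le_rpow (Finset.sum_le_sum_of_subset Finset.subset_union_right) hpr.le

theorem eLpNorm_tsum_le {α ι : Type*} [MeasurableSpace α] [Countable ι] {μ : Measure α}
    {p : ℝ≥0∞} (hp : 1 ≤ p) {f : ι → α → ℝ≥0∞} (hf : ∀ i, AEMeasurable (f i) μ) :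
    eLpNorm (fun x => ∑' i, f i x) p μ ≤ ∑' i, eLpNorm (f i) p μ := by
  refine eLpNorm_tsum_le_of_finset hp hf fun s => ?_
  have := eLpNorm_sum_le (s := s) (fun i _ => (hf i).aestronglyMeasurable) hp
  rw [Finset.sum_fn] at this
  exact this.trans (ENNReal.sum_le_tsum s)

/-! ### A summation lemma in the spirit of real interpolation -/

/-- Convexity: x ↦ x^q lies above its tangent at y + a. In the finite case this is Bernoulli's
inequality at -a/(y + a). -/
theorem add_rpow_le_rpow_add_mul {q : ℝ} (hq : 1 < q) (y a : ℝ≥0∞) :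
    (y + a) ^ q ≤ y ^ q + ENNReal.ofReal q * (a * (y + a) ^ (q - 1)) := by
  have hq0 : 0 < q := by linarith
  rcases eq_or_ne a ∞ with rfl | ha
  · have : ENNReal.ofReal q * (∞ * (y + ∞) ^ (q - 1)) = ∞ := by
      rw [add_top, ENNReal.top_rpow_of_pos (by linarith), ENNReal.top_mul_top,
        ENNReal.mul_top (by simpa using hq0)]
    rw [this]; simp
  rcases eq_or_ne y ∞ with rfl | hy
  · simp [ENNReal.top_rpow_of_pos hq0]
  lift a to ℝ≥0 using ha
  lift y to ℝ≥0 using hy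
  have key : ((y + a : ℝ≥0) : ℝ) ^ q ≤ (y : ℝ) ^ q + q * (a * ((y + a : ℝ≥0) : ℝ) ^ (q - 1)) := by
    rcases eq_or_lt_of_le (show (0 : ℝ) ≤ ((y + a : ℝ≥0) : ℝ) from NNReal.coe_nonneg _) with h0 | h0
    · rw [← h0, Real.zero_rpow hq0.ne']
      have : (0 : ℝ) ^ (q - 1) = 0 := Real.zero_rpow (by linarith)
      rw [this]
      have := Real.rpow_nonneg y.coe_nonneg q
      linarith
    · set z : ℝ := ((y + a : ℝ≥0) : ℝ) with hz
      have hzya : z = y + a := by simp [hz]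
      have hs : -1 ≤ -(a / z : ℝ) := by
        have : (a : ℝ) / z ≤ 1 := (div_le_one h0).2 (by rw [hzya]; linarith [y.coe_nonneg])
        linarith
      have h1 := one_add_mul_self_le_rpow_one_add hs hq.le
      have h2 : 1 + -(a / z : ℝ) = y / z := by field_simp; linarith
      rw [h2, Real.div_rpow y.coe_nonneg h0.le, le_div_iff₀ (Real.rpow_pos_of_pos h0 _)] at h1
      have h3 : z ^ q = z * z ^ (q - 1) := by
        rw [Real.rpow_sub_one h0.ne']; field_simp
      have h4 : (a / z : ℝ) * z ^ q = a * z ^ (q - 1) := by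
        rw [h3]; field_simp
      nlinarith
  have e1 : ((y : ℝ≥0∞) + a) = ((y + a : ℝ≥0) : ℝ≥0∞) := by push_cast; rfl
  rw [e1, ← ENNReal.ofReal_coe_nnreal, ← ENNReal.ofReal_coe_nnreal (p := y),
    ← ENNReal.ofReal_coe_nnreal (p := a),
    ENNReal.ofReal_rpow_of_nonneg (NNReal.coe_nonneg _) hq0.le,
    ENNReal.ofReal_rpow_of_nonneg (NNReal.coe_nonneg _) hq0.le,
    ENNReal.ofReal_rpow_of_nonneg (NNReal.coe_nonneg _) (by linarith),
    ← ENNReal.ofReal_mul (by positivity), ← ENNReal.ofReal_mul (by positivity),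
    ← ENNReal.ofReal_add (by positivity) (by positivity)]
  exact ENNReal.ofReal_le_ofReal key

/-- A discrete form of S^q = ∫ q S^(q-1) dS. The terms are added in increasing order of the index,
so a new term leaves the earlier partial sums unchanged. -/
theorem sum_rpow_le_sum_mul_partialSum {q : ℝ} (hq : 1 < q) (s : Finset ℤ) (a : ℤ → ℝ≥0∞) :
    (∑ i ∈ s, a i) ^ q ≤
      ENNReal.ofReal q * ∑ m ∈ s, a m * (∑ i ∈ s with i ≤ m, a i) ^ (q - 1) := by
  induction s using Finset.induction_on_max with
  | empty => simp [ENNReal.zero_rpow_of_pos (show 0 < q by linarith)]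
  | insert m s hm ih =>
    have hms : m ∉ s := fun h => lt_irrefl _ (hm m h)
    rw [Finset.sum_insert hms, Finset.sum_insert hms, add_comm (a m)]
    refine (add_rpow_le_rpow_add_mul hq _ _).trans ?_
    have e1 : (insert m s).filter (· ≤ m) = insert m s := by
      refine Finset.filter_true_of_mem fun i hi => ?_
      rcases Finset.mem_insert.1 hi with rfl | hi
      · exact le_rfl
      · exact (hm i hi).le
    have e2 : ∀ k ∈ s, (insert m s).filter (· ≤ k) = s.filter (· ≤ k) := by
      intro k hk
      rw [Finset.filter_insert, if_neg (not_le.2 (hm k hk))]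
    have e3 : ∑ k ∈ s, a k * (∑ i ∈ insert m s with i ≤ k, a i) ^ (q - 1)
        = ∑ k ∈ s, a k * (∑ i ∈ s with i ≤ k, a i) ^ (q - 1) :=
      Finset.sum_congr rfl fun k hk => by rw [e2 k hk]
    rw [e1, e3, Finset.sum_insert hms, mul_add, add_comm (a m)]
    rw [add_comm]
    gcongr

/-- The one-sided geometric kernel `Λ^{-nε}`, `n ≥ 0`, on the integers. -/
noncomputable def geomKernel (Λ : ℝ≥0∞) (ε : ℝ) (n : ℤ) : ℝ≥0∞ :=
  if 0 ≤ n then Λ ^ (-((n : ℝ) * ε)) else 0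

theorem tsum_geomKernel_lt_top {Λ : ℝ≥0∞} (hΛ : 1 < Λ) {ε : ℝ} (hε : 0 < ε) :
    ∑' n, geomKernel Λ ε n < ∞ := by
  have h1 : ∑' n, geomKernel Λ ε n = ∑' n : ℕ, geomKernel Λ ε n := by
    refine (Function.Injective.tsum_eq Nat.cast_injective ?_).symm
    intro n hn
    by_contra h
    have : ¬ 0 ≤ n := fun h' => h ⟨n.toNat, by simp [h']⟩
    simp [geomKernel, this] at hn
  have h2 : ∀ n : ℕ, geomKernel Λ ε n = (Λ ^ (-ε)) ^ n := by
    intro n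
    rw [geomKernel, if_pos (by positivity), ← ENNReal.rpow_natCast, ← ENNReal.rpow_mul]
    congr 1; push_cast; ring
  simp only [h1, h2]
  rw [ENNReal.tsum_geometric, ENNReal.inv_lt_top, tsub_pos_iff_lt]
  exact ENNReal.rpow_lt_one_of_one_lt_of_neg hΛ (by linarith)

theorem mul_le_sq_add_sq (x y : ℝ≥0∞) : x * y ≤ x ^ 2 + y ^ 2 := by
  rcases le_total x y with h | h
  · calc x * y ≤ y * y := by gcongr
      _ = y ^ 2 := (sq y).symm
      _ ≤ _ := le_add_self
  · calc x * y ≤ x * x := by gcongr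
      _ = x ^ 2 := (sq x).symm
      _ ≤ _ := le_self_add

theorem sum_kernel_sub_le (κ : ℤ → ℝ≥0∞) (s : Finset ℤ) (m : ℤ) :
    ∑ i ∈ s, κ (m - i) ≤ ∑' n, κ n ∧ ∑ i ∈ s, κ (i - m) ≤ ∑' n, κ n := by
  refine ⟨(ENNReal.sum_le_tsum s).trans (le_of_eq ((Equiv.subLeft m).tsum_eq κ)),
    (ENNReal.sum_le_tsum s).trans (le_of_eq ((Equiv.subRight m).tsum_eq κ))⟩

/-- Of the q factors, two are paired in ℓ² by Schur's test for the convolution kernel; the remaining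
q - 2 are bounded in ℓ^∞, which the ℓ² norm controls. -/
theorem sum_mul_conv_rpow_le {q : ℝ} (hq : 2 ≤ q) (κ b : ℤ → ℝ≥0∞) (s : Finset ℤ) :
    ∑ m ∈ s, b m * (∑ i ∈ s, κ (m - i) * b i) ^ (q - 1) ≤
      2 * (∑' n, κ n) ^ (q - 1) * (∑' k, b k ^ 2) ^ (q / 2) := by
  set G := ∑' n, κ n
  set S := ∑' k, b k ^ 2
  have hb : ∀ k, b k ≤ S ^ (1 / 2 : ℝ) := by
    intro k
    have : b k = (b k ^ 2) ^ (1 / 2 : ℝ) := by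
      rw [← ENNReal.rpow_natCast, ← ENNReal.rpow_mul]; norm_num
    rw [this]
    exact ENNReal.rpow_le_rpow (ENNReal.le_tsum k) (by norm_num)
  have hβ : ∀ m, ∑ i ∈ s, κ (m - i) * b i ≤ G * S ^ (1 / 2 : ℝ) := by
    intro m
    calc ∑ i ∈ s, κ (m - i) * b i ≤ ∑ i ∈ s, κ (m - i) * S ^ (1 / 2 : ℝ) := by
          gcongr with i; exact hb i
      _ = (∑ i ∈ s, κ (m - i)) * S ^ (1 / 2 : ℝ) := by rw [Finset.sum_mul]
      _ ≤ _ := by gcongr; exact (sum_kernel_sub_le κ s m).1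
  have hdbl : ∑ m ∈ s, b m * (∑ i ∈ s, κ (m - i) * b i) ≤ 2 * G * S := by
    calc ∑ m ∈ s, b m * (∑ i ∈ s, κ (m - i) * b i)
        ≤ ∑ m ∈ s, ∑ i ∈ s, (κ (m - i) * b m ^ 2 + κ (m - i) * b i ^ 2) := by
          gcongr with m hm
          rw [Finset.mul_sum]
          gcongr with i hi
          rw [← mul_add, mul_left_comm]
          gcongr
          exact mul_le_sq_add_sq _ _
      _ = ∑ m ∈ s, (∑ i ∈ s, κ (m - i)) * b m ^ 2 + ∑ i ∈ s, (∑ m ∈ s, κ (m - i)) * b i ^ 2 := by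
          simp only [Finset.sum_add_distrib, Finset.sum_mul]
          congr 1
          rw [Finset.sum_comm]
      _ ≤ ∑ m ∈ s, G * b m ^ 2 + ∑ i ∈ s, G * b i ^ 2 := by
          gcongr with m hm i hi
          · exact (sum_kernel_sub_le κ s m).1
          · exact (sum_kernel_sub_le κ s i).2
      _ ≤ G * S + G * S := by
          rw [← Finset.mul_sum]
          gcongr <;> exact ENNReal.sum_le_tsum s
      _ = 2 * G * S := by ring
  calc ∑ m ∈ s, b m * (∑ i ∈ s, κ (m - i) * b i) ^ (q - 1)
      ≤ ∑ m ∈ s, b m * (∑ i ∈ s, κ (m - i) * b i) * (G * S ^ (1 / 2 : ℝ)) ^ (q - 2) := by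
        refine Finset.sum_le_sum fun m _ => ?_
        rw [mul_assoc]
        gcongr
        rw [show q - 1 = 1 + (q - 2) by ring,
          ENNReal.rpow_add_of_nonneg _ _ (by norm_num) (by linarith), ENNReal.rpow_one]
        gcongr
        exact hβ m
    _ ≤ 2 * G * S * (G * S ^ (1 / 2 : ℝ)) ^ (q - 2) := by
        rw [← Finset.sum_mul]; gcongr
    _ = 2 * G ^ (q - 1) * S ^ (q / 2) := by
        rw [ENNReal.mul_rpow_of_nonneg _ _ (by linarith), ← ENNReal.rpow_mul,
          show q - 1 = 1 + (q - 2) by ring,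
          ENNReal.rpow_add_of_nonneg _ _ (by norm_num) (by linarith), ENNReal.rpow_one,
          show q / 2 = 1 + 1 / 2 * (q - 2) by ring,
          ENNReal.rpow_add_of_nonneg _ _ (by norm_num) (by linarith), ENNReal.rpow_one]
        ring

theorem ENNReal_rpow_mul_rpow_le_rpow {x y : ℝ≥0∞} (h : x ≤ y) {s t : ℝ} (hs : 0 ≤ s)
    (hst : s ≤ t) : x ^ t ≤ x ^ s * y ^ (t - s) := by
  calc x ^ t = x ^ s * x ^ (t - s) := by
        rw [← ENNReal.rpow_add_of_nonneg _ _ hs (by linarith)]; congr 1; ring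
    _ ≤ _ := by gcongr

/-- If `a_k ≤ Λ^{k/q} b_k` pointwise and `‖a_k‖_{L^s} ≤ Λ^{k(1/q - 1/s)} b_k` for one `s < q`, then
`‖∑ a_k‖_{L^q} ≤ C ‖b‖_{ℓ²}`. -/
theorem eLpNorm_tsum_le_l2 {q s : ℝ} (hs : 1 < s) (hsq : s < q) (hq : 2 ≤ q) {Λ : ℝ≥0∞}
    (hΛ : 1 < Λ) (hΛt : Λ ≠ ∞) :
    ∃ C : ℝ≥0, ∀ {α : Type} [MeasurableSpace α] (μ : Measure α) (a : ℤ → α → ℝ≥0∞)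
      (b : ℤ → ℝ≥0∞), (∀ k, AEMeasurable (a k) μ) →
      (∀ k x, a k x ≤ Λ ^ ((k : ℝ) * (1 / q)) * b k) →
      (∀ k, ∫⁻ x, a k x ^ s ∂μ ≤ Λ ^ ((k : ℝ) * (s / q - 1)) * b k ^ s) →
      eLpNorm (fun x => ∑' k, a k x) (ENNReal.ofReal q) μ ≤ C * (∑' k, b k ^ 2) ^ (1 / 2 : ℝ) := by
  have hΛ0 : Λ ≠ 0 := (zero_lt_one.trans hΛ).ne'
  have hq0 : 0 < q := by linarith
  have hs0 : 0 < s := by linarith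
  -- the second exponent `σ = (q - 1) s'`
  set s' : ℝ := s / (s - 1) with hs'
  have hs1 : 0 < s - 1 := by linarith
  have hs'0 : 0 < s' := by positivity
  have hconj : s.HolderConjugate s' := Real.HolderConjugate.conjExponent hs
  set σ : ℝ := (q - 1) * s' with hσ
  -- The inequality σ > q is equivalent to s < q. Hence ε > 0: the bounds for `a k` in L^σ grow
  -- geometrically with k, and a sum over i ≤ m is controlled by its top index.
  have hσq : q < σ := by
    rw [hσ, hs', mul_div_assoc', lt_div_iff₀ hs1]; nlinarith
  have hσ0 : 0 < σ := by linarith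
  set ε : ℝ := 1 / q - 1 / σ with hε
  have hε0 : 0 < ε := by
    rw [hε, sub_pos]; exact one_div_lt_one_div_of_lt hq0 hσq
  set G := ∑' n, geomKernel Λ ε n with hG
  have hGt : G ≠ ∞ := (tsum_geomKernel_lt_top hΛ hε0).ne
  set K : ℝ≥0∞ := (ENNReal.ofReal q * (2 * G ^ (q - 1))) ^ (1 / q) with hK
  have hKt : K ≠ ∞ := by
    refine ENNReal.rpow_ne_top_of_nonneg (by positivity) ?_
    exact ENNReal.mul_ne_top ENNReal.ofReal_ne_top (ENNReal.mul_ne_top ENNReal.ofNat_ne_top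
      (ENNReal.rpow_ne_top_of_nonneg (by linarith) hGt))
  refine ⟨K.toNNReal, ?_⟩
  intro α _ μ a b ham h1 h2
  rw [ENNReal.coe_toNNReal hKt]
  refine eLpNorm_tsum_le_of_finset (by rw [ENNReal.one_le_ofReal]; linarith) ham fun t => ?_
  rw [eLpNorm_eq_lintegral_rpow_enorm_toReal (by simpa using hq0) ENNReal.ofReal_ne_top,
    ENNReal.toReal_ofReal hq0.le, one_div q, ENNReal.rpow_inv_le_iff hq0]
  simp only [enorm_eq_self]
  have hΛadd : ∀ x y : ℝ, Λ ^ x * Λ ^ y = Λ ^ (x + y) := fun x y =>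
    (ENNReal.rpow_add x y hΛ0 hΛt).symm
  -- the norms in `L^σ`
  have hσnorm : ∀ k, eLpNorm (a k) (ENNReal.ofReal σ) μ ≤ Λ ^ ((k : ℝ) * ε) * b k := by
    intro k
    rw [eLpNorm_eq_lintegral_rpow_enorm_toReal (by simpa using hσ0) ENNReal.ofReal_ne_top,
      ENNReal.toReal_ofReal hσ0.le, one_div, ENNReal.rpow_inv_le_iff hσ0]
    simp only [enorm_eq_self]
    calc ∫⁻ x, a k x ^ σ ∂μ
        ≤ ∫⁻ x, a k x ^ s * (Λ ^ ((k : ℝ) * (1 / q)) * b k) ^ (σ - s) ∂μ :=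
          lintegral_mono fun x =>
            ENNReal_rpow_mul_rpow_le_rpow (h1 k x) hs0.le (by linarith)
      _ = (∫⁻ x, a k x ^ s ∂μ) * (Λ ^ ((k : ℝ) * (1 / q)) * b k) ^ (σ - s) :=
          lintegral_mul_const'' _ ((ham k).pow_const _)
      _ ≤ (Λ ^ ((k : ℝ) * (s / q - 1)) * b k ^ s) *
            (Λ ^ ((k : ℝ) * (1 / q)) * b k) ^ (σ - s) := by gcongr; exact h2 k
      _ = (Λ ^ ((k : ℝ) * ε) * b k) ^ σ := by
          rw [ENNReal.mul_rpow_of_nonneg _ _ (by linarith : 0 ≤ σ - s),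
            ENNReal.mul_rpow_of_nonneg _ _ hσ0.le, ← ENNReal.rpow_mul, ← ENNReal.rpow_mul,
            mul_mul_mul_comm, hΛadd, ← ENNReal.rpow_add_of_nonneg _ _ hs0.le (by linarith)]
          congr 2
          · rw [hε]; field_simp; ring
          · ring
  have hsnorm : ∀ k, (∫⁻ x, a k x ^ s ∂μ) ^ (1 / s) ≤ Λ ^ ((k : ℝ) * (1 / q - 1 / s)) * b k := by
    intro k
    rw [one_div, ENNReal.rpow_inv_le_iff hs0]
    refine (h2 k).trans (le_of_eq ?_)
    rw [ENNReal.mul_rpow_of_nonneg _ _ hs0.le, ← ENNReal.rpow_mul]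
    congr 2
    field_simp
  set β : ℤ → ℝ≥0∞ := fun m => ∑ i ∈ t, geomKernel Λ ε (m - i) * b i with hβ
  have hF : ∀ m, eLpNorm (fun x => ∑ i ∈ t with i ≤ m, a i x) (ENNReal.ofReal σ) μ ≤
      Λ ^ ((m : ℝ) * ε) * β m := by
    intro m
    have := eLpNorm_sum_le (s := t.filter (· ≤ m)) (fun i _ => (ham i).aestronglyMeasurable)
      (p := ENNReal.ofReal σ) (by rw [ENNReal.one_le_ofReal]; linarith)
    rw [Finset.sum_fn] at this
    refine this.trans ?_
    calc ∑ i ∈ t with i ≤ m, eLpNorm (a i) (ENNReal.ofReal σ) μ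
        ≤ ∑ i ∈ t with i ≤ m, Λ ^ ((m : ℝ) * ε) * (geomKernel Λ ε (m - i) * b i) := by
          refine Finset.sum_le_sum fun i hi => ?_
          have him : i ≤ m := (Finset.mem_filter.1 hi).2
          refine (hσnorm i).trans (le_of_eq ?_)
          rw [geomKernel, if_pos (by linarith), ← mul_assoc, hΛadd]
          congr 2; push_cast; ring
      _ ≤ ∑ i ∈ t, Λ ^ ((m : ℝ) * ε) * (geomKernel Λ ε (m - i) * b i) :=
          Finset.sum_le_sum_of_subset (Finset.filter_subset _ _)
      _ = _ := by rw [hβ, Finset.mul_sum]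
  have hterm : ∀ m, ∫⁻ x, a m x * (∑ i ∈ t with i ≤ m, a i x) ^ (q - 1) ∂μ ≤
      b m * β m ^ (q - 1) := by
    intro m
    have hFm : AEMeasurable (fun x => ∑ i ∈ t with i ≤ m, a i x) μ :=
      Finset.aemeasurable_fun_sum _ fun i _ => ham i
    -- Hölder with exponents s and s': the second factor is an L^σ norm to the power q - 1 because σ
    -- = (q - 1)s'.
    have hH := ENNReal.lintegral_mul_le_Lp_mul_Lq μ hconj (ham m) (hFm.pow_const (q - 1))
    simp only [Pi.mul_apply, ← ENNReal.rpow_mul] at hH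
    refine hH.trans ?_
    have hF' := hF m
    rw [eLpNorm_eq_lintegral_rpow_enorm_toReal (by simpa using hσ0) ENNReal.ofReal_ne_top,
      ENNReal.toReal_ofReal hσ0.le] at hF'
    simp only [enorm_eq_self] at hF'
    have hF2 : (∫⁻ x, (∑ i ∈ t with i ≤ m, a i x) ^ σ ∂μ) ^ (1 / s') ≤
        (Λ ^ ((m : ℝ) * ε) * β m) ^ (q - 1) := by
      have := ENNReal.rpow_le_rpow hF' (show 0 ≤ q - 1 by linarith)
      rw [← ENNReal.rpow_mul] at this
      refine le_trans (le_of_eq ?_) this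
      congr 1
      rw [hσ]
      have : q - 1 ≠ 0 := by linarith
      field_simp
    calc _ ≤ (Λ ^ ((m : ℝ) * (1 / q - 1 / s)) * b m) * (Λ ^ ((m : ℝ) * ε) * β m) ^ (q - 1) := by
          gcongr
          · exact hsnorm m
      _ = Λ ^ ((m : ℝ) * (1 / q - 1 / s) + (m : ℝ) * ε * (q - 1)) * (b m * β m ^ (q - 1)) := by
          rw [ENNReal.mul_rpow_of_nonneg _ _ (by linarith : 0 ≤ q - 1), ← ENNReal.rpow_mul,
            mul_mul_mul_comm, hΛadd]
      _ = b m * β m ^ (q - 1) := by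
          -- The decay in L^s cancels the growth in L^σ exactly, since (q - 1)/σ = 1 - 1/s.
          have : (m : ℝ) * (1 / q - 1 / s) + (m : ℝ) * ε * (q - 1) = 0 := by
            have : q - 1 ≠ 0 := by linarith
            rw [hε, hσ, hs']; field_simp; ring
          rw [this, ENNReal.rpow_zero, one_mul]
  calc ∫⁻ x, (∑ i ∈ t, a i x) ^ q ∂μ
      ≤ ∫⁻ x, ENNReal.ofReal q *
          ∑ m ∈ t, a m x * (∑ i ∈ t with i ≤ m, a i x) ^ (q - 1) ∂μ :=
        lintegral_mono fun x => sum_rpow_le_sum_mul_partialSum (by linarith) t fun i => a i x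
    _ = ENNReal.ofReal q *
          ∑ m ∈ t, ∫⁻ x, a m x * (∑ i ∈ t with i ≤ m, a i x) ^ (q - 1) ∂μ := by
        have hm : ∀ m ∈ t, AEMeasurable
            (fun x => a m x * (∑ i ∈ t with i ≤ m, a i x) ^ (q - 1)) μ := fun m _ =>
          (ham m).mul ((Finset.aemeasurable_fun_sum _ fun i _ => ham i).pow_const _)
        rw [lintegral_const_mul' _ _ ENNReal.ofReal_ne_top, lintegral_finsetSum' _ hm]
    _ ≤ ENNReal.ofReal q * ∑ m ∈ t, b m * β m ^ (q - 1) := by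
        gcongr with m; exact hterm m
    _ ≤ ENNReal.ofReal q * (2 * G ^ (q - 1) * (∑' k, b k ^ 2) ^ (q / 2)) := by
        gcongr; exact sum_mul_conv_rpow_le hq _ _ _
    _ = (K * (∑' k, b k ^ 2) ^ (1 / 2 : ℝ)) ^ q := by
        rw [ENNReal.mul_rpow_of_nonneg _ _ hq0.le, hK, ← ENNReal.rpow_mul, ← ENNReal.rpow_mul,
          one_div_mul_cancel hq0.ne', ENNReal.rpow_one, ← mul_assoc]
        congr 2; ring

/-! ### Oscillatory integrals in weighted `L²` by Schur's test -/

theorem norm_cexp_real_mul_I (x : ℝ) : ‖Complex.exp (x * Complex.I)‖ = 1 :=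
  Complex.norm_exp_ofReal_mul_I x

theorem integrable_cexp_mul {X : Type*} [MeasurableSpace X] {μ : Measure X} {f : X → ℂ}
    (hf : Integrable f μ) {Φ : X → ℝ} (hΦ : Measurable Φ) :
    Integrable (fun x => Complex.exp (Φ x * Complex.I) * f x) μ :=
  hf.bdd_mul (c := 1) (by fun_prop) (ae_of_all _ fun x => (norm_cexp_real_mul_I _).le)

/-- Schur's test for `T T^*`: an oscillatory integral operator is bounded into `L²(ν)` if its kernel
`∫ exp (i(Φ(y, ξ) - Φ(y, η))) dν(y)` is dominated by a symmetric kernel with bounded marginals. -/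
theorem lintegral_oscillatory_sq_le {X Y : Type*} [MeasurableSpace X] [MeasurableSpace Y]
    (μ : Measure X) [SFinite μ] (ν : Measure Y) [IsFiniteMeasure ν] {Φ : Y → X → ℝ}
    (hΦ : Measurable (Function.uncurry Φ)) {f : X → ℂ} (hf : Integrable f μ)
    {k : X → X → ℝ≥0∞} (hk : Measurable (Function.uncurry k)) (hsymm : ∀ ξ η, k ξ η = k η ξ)
    (hK : ∀ ξ η, ‖∫ y, Complex.exp (((Φ y ξ - Φ y η : ℝ) : ℂ) * Complex.I) ∂ν‖ₑ ≤ k ξ η)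
    {B : ℝ≥0∞} (hB : ∀ᵐ ξ ∂μ, ∫⁻ η, k ξ η ∂μ ≤ B) :
    ∫⁻ y, ‖∫ ξ, Complex.exp (Φ y ξ * Complex.I) * f ξ ∂μ‖ₑ ^ 2 ∂ν ≤
      2 * B * ∫⁻ ξ, ‖f ξ‖ₑ ^ 2 ∂μ := by
  have hΦy : ∀ y, Measurable (Φ y) := fun y => hΦ.comp measurable_prodMk_left
  set u : Y → ℂ := fun y => ∫ ξ, Complex.exp (Φ y ξ * Complex.I) * f ξ ∂μ with hu
  set H : Y → X × X → ℂ := fun y p =>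
    Complex.exp (((Φ y p.1 - Φ y p.2 : ℝ) : ℂ) * Complex.I) *
      (f p.1 * (starRingEnd ℂ) (f p.2)) with hH
  have hff : Integrable (fun p : X × X => f p.1 * (starRingEnd ℂ) (f p.2)) (μ.prod μ) :=
    hf.mul_prod (Complex.conjLIE.integrable_comp_iff.2 hf)
  have hmeas : Measurable (fun z : Y × (X × X) => Φ z.1 z.2.1 - Φ z.1 z.2.2) := by
    have h1 : Measurable fun z : Y × (X × X) => Φ z.1 z.2.1 :=
      hΦ.comp (measurable_fst.prodMk (measurable_fst.comp measurable_snd))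
    have h2 : Measurable fun z : Y × (X × X) => Φ z.1 z.2.2 :=
      hΦ.comp (measurable_fst.prodMk (measurable_snd.comp measurable_snd))
    exact h1.sub h2
  have hHint : Integrable (Function.uncurry H) (ν.prod (μ.prod μ)) :=
    integrable_cexp_mul (hff.comp_snd ν) hmeas
  -- The square is opened into a double integral in (ξ, η). Integrating in y first then leaves only
  -- the kernel of T T*.
  have huH : ∀ y, ((‖u y‖ ^ 2 : ℝ) : ℂ) = ∫ p, H y p ∂(μ.prod μ) := by
    intro y
    have e1 : ∀ p : X × X, H y p = (Complex.exp (Φ y p.1 * Complex.I) * f p.1) *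
        (starRingEnd ℂ) (Complex.exp (Φ y p.2 * Complex.I) * f p.2) := by
      intro p
      have : (starRingEnd ℂ) (Complex.exp (Φ y p.2 * Complex.I)) =
          Complex.exp (-(Φ y p.2 * Complex.I)) := by
        rw [← Complex.exp_conj]; simp
      rw [map_mul, this, hH]
      simp only
      rw [mul_mul_mul_comm, ← Complex.exp_add]
      congr 2
      push_cast; ring
    have e2 := integral_prod_mul (μ := μ) (ν := μ)
      (fun ξ => Complex.exp (Φ y ξ * Complex.I) * f ξ)
      (fun ξ => (starRingEnd ℂ) (Complex.exp (Φ y ξ * Complex.I) * f ξ))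
    rw [integral_congr_ae (ae_of_all _ e1), e2, integral_conj, Complex.mul_conj]
    rw [Complex.normSq_eq_norm_sq]
  have hu2 : Integrable (fun y => ‖u y‖ ^ 2) ν := by
    have h1 : Integrable (fun y => ∫ p, H y p ∂(μ.prod μ)) ν := hHint.integral_prod_left
    have h2 := h1.norm
    refine h2.congr (ae_of_all _ fun y => ?_)
    simp only
    rw [← huH y, Complex.norm_real, Real.norm_of_nonneg (by positivity)]
  have hmain : ((∫ y, ‖u y‖ ^ 2 ∂ν : ℝ) : ℂ) = ∫ p : X × X, (∫ y,
      Complex.exp (((Φ y p.1 - Φ y p.2 : ℝ) : ℂ) * Complex.I) ∂ν) *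
        (f p.1 * (starRingEnd ℂ) (f p.2)) ∂(μ.prod μ) := by
    calc ((∫ y, ‖u y‖ ^ 2 ∂ν : ℝ) : ℂ) = ∫ y, ((‖u y‖ ^ 2 : ℝ) : ℂ) ∂ν := integral_ofReal.symm
      _ = ∫ y, ∫ p, H y p ∂(μ.prod μ) ∂ν := by simp only [huH]
      _ = ∫ p, ∫ y, H y p ∂ν ∂(μ.prod μ) := integral_integral_swap hHint
      _ = _ := by simp only [hH, integral_mul_const]
  have hle : ∫⁻ y, ‖u y‖ₑ ^ 2 ∂ν = ‖((∫ y, ‖u y‖ ^ 2 ∂ν : ℝ) : ℂ)‖ₑ := by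
    have h0 : 0 ≤ ∫ y, ‖u y‖ ^ 2 ∂ν := integral_nonneg fun y => by positivity
    rw [← ofReal_norm, Complex.norm_real, Real.norm_of_nonneg h0,
      ofReal_integral_eq_lintegral_ofReal hu2 (ae_of_all _ fun y => by positivity)]
    refine lintegral_congr fun y => ?_
    rw [ENNReal.ofReal_pow (norm_nonneg _), ofReal_norm]
  have hfm : AEMeasurable (fun ξ => ‖f ξ‖ₑ ^ 2) μ := hf.1.enorm.pow_const 2
  have hkB : AEMeasurable (fun p : X × X => ‖f p.1‖ₑ ^ 2 * k p.1 p.2) (μ.prod μ) :=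
    (hfm.comp_quasiMeasurePreserving Measure.quasiMeasurePreserving_fst).mul hk.aemeasurable
  have hone : ∫⁻ p : X × X, ‖f p.1‖ₑ ^ 2 * k p.1 p.2 ∂(μ.prod μ) ≤
      B * ∫⁻ ξ, ‖f ξ‖ₑ ^ 2 ∂μ := by
    rw [lintegral_prod _ hkB, mul_comm, ← lintegral_mul_const'' _ hfm]
    refine lintegral_mono_ae ?_
    filter_upwards [hB] with ξ hξ
    rw [lintegral_const_mul _ (show Measurable (k ξ) from hk.comp measurable_prodMk_left)]
    gcongr
  have htwo : ∫⁻ p : X × X, ‖f p.2‖ₑ ^ 2 * k p.1 p.2 ∂(μ.prod μ) =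
      ∫⁻ p : X × X, ‖f p.1‖ₑ ^ 2 * k p.1 p.2 ∂(μ.prod μ) := by
    rw [← lintegral_prod_swap]
    refine lintegral_congr fun p => ?_
    simp [hsymm p.2 p.1]
  rw [hle, hmain]
  calc _ ≤ ∫⁻ p : X × X, (‖f p.1‖ₑ ^ 2 * k p.1 p.2 + ‖f p.2‖ₑ ^ 2 * k p.1 p.2) ∂(μ.prod μ) := by
        refine (enorm_integral_le_lintegral_enorm _).trans (lintegral_mono fun p => ?_)
        rw [enorm_mul, enorm_mul, ← add_mul, mul_comm]
        refine mul_le_mul' ?_ (hK _ _)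
        have : ‖(starRingEnd ℂ) (f p.2)‖ₑ = ‖f p.2‖ₑ := by
          rw [← ofReal_norm, RCLike.norm_conj, ofReal_norm]
        rw [this]
        exact mul_le_sq_add_sq _ _
    _ ≤ B * (∫⁻ ξ, ‖f ξ‖ₑ ^ 2 ∂μ) + B * ∫⁻ ξ, ‖f ξ‖ₑ ^ 2 ∂μ := by
        rw [lintegral_add_left' hkB, htwo]
        gcongr
    _ = 2 * B * ∫⁻ ξ, ‖f ξ‖ₑ ^ 2 ∂μ := by ring

/-! ### Gaussian weights -/

section Gauss

variable (V : Type*) [NormedAddCommGroup V] [InnerProductSpace ℝ V] [FiniteDimensional ℝ V]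
  [MeasurableSpace V] [BorelSpace V]

/-- The measure `exp (-π τ² |x|²) dx`. -/
noncomputable def gaussMeasure (τ : ℝ) : Measure V :=
  volume.withDensity fun x => ENNReal.ofReal (Real.exp (-(Real.pi * τ ^ 2) * ‖x‖ ^ 2))

/-- The Fourier transform `τ^{-d} exp (-π |w|² / τ²)` of `exp (-π τ² |x|²)`, as a function of
`r = |w|`. -/
noncomputable def gaussHat (d : ℕ) (τ r : ℝ) : ℝ :=
  τ⁻¹ ^ d * Real.exp (-(Real.pi / τ ^ 2) * r ^ 2)

variable {V}

theorem measurable_gaussDensity {V : Type*} [NormedAddCommGroup V] [MeasurableSpace V]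
    [BorelSpace V] (τ : ℝ) : Measurable fun x : V =>
      ENNReal.ofReal (Real.exp (-(Real.pi * τ ^ 2) * ‖x‖ ^ 2)) := by
  fun_prop

theorem integral_rexp_gauss {τ : ℝ} (hτ : 0 < τ) :
    ∫ x : V, Real.exp (-(Real.pi * τ ^ 2) * ‖x‖ ^ 2) = τ⁻¹ ^ Module.finrank ℝ V := by
  rw [GaussianFourier.integral_rexp_neg_mul_sq_norm (by positivity)]
  have : Real.pi / (Real.pi * τ ^ 2) = τ⁻¹ ^ (2 : ℝ) := by
    rw [Real.rpow_two]; field_simp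
  rw [this, ← Real.rpow_mul (by positivity), ← Real.rpow_natCast]
  congr 1; ring

theorem integrable_rexp_gauss {τ : ℝ} (hτ : 0 < τ) :
    Integrable fun x : V => Real.exp (-(Real.pi * τ ^ 2) * ‖x‖ ^ 2) := by
  have := integral_rexp_gauss (V := V) hτ
  -- A non-integrable function would have integral zero, whereas the value just computed is
  -- positive.
  by_contra h
  rw [integral_undef h] at this
  have h2 : 0 < τ⁻¹ ^ Module.finrank ℝ V := by positivity
  linarith

theorem lintegral_rexp_gauss {τ : ℝ} (hτ : 0 < τ) :
    ∫⁻ x : V, ENNReal.ofReal (Real.exp (-(Real.pi * τ ^ 2) * ‖x‖ ^ 2)) =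
      ENNReal.ofReal (τ⁻¹ ^ Module.finrank ℝ V) := by
  rw [← ofReal_integral_eq_lintegral_ofReal (integrable_rexp_gauss hτ)
    (ae_of_all _ fun x => by positivity), integral_rexp_gauss hτ]

theorem isFiniteMeasure_gaussMeasure {τ : ℝ} (hτ : 0 < τ) : IsFiniteMeasure (gaussMeasure V τ) :=
  isFiniteMeasure_withDensity (by rw [lintegral_rexp_gauss hτ]; exact ENNReal.ofReal_ne_top)

theorem enorm_integral_gaussMeasure_eq {τ : ℝ} (hτ : 0 < τ) (w : V) :
    ‖∫ x, Complex.exp (((2 * Real.pi * inner ℝ x w : ℝ) : ℂ) * Complex.I) ∂(gaussMeasure V τ)‖ₑ =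
      ENNReal.ofReal (gaussHat (Module.finrank ℝ V) τ ‖w‖) := by
  have hb : 0 < ((Real.pi * τ ^ 2 : ℝ) : ℂ).re := by
    rw [Complex.ofReal_re]; positivity
  have h := fourier_gaussian_innerProductSpace hb (-w)
  rw [Real.fourier_eq'] at h
  have e : ∫ x, Complex.exp (((2 * Real.pi * inner ℝ x w : ℝ) : ℂ) * Complex.I)
      ∂(gaussMeasure V τ) = ∫ v : V, Complex.exp (((-2 * Real.pi * inner ℝ v (-w) : ℝ) : ℂ) *
        Complex.I) • Complex.exp (-((Real.pi * τ ^ 2 : ℝ) : ℂ) * (‖v‖ : ℂ) ^ 2) := by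
    rw [gaussMeasure, integral_withDensity_eq_integral_toReal_smul (measurable_gaussDensity τ)
      (ae_of_all _ fun _ => ENNReal.ofReal_lt_top)]
    refine integral_congr_ae (ae_of_all _ fun v => ?_)
    simp only
    rw [ENNReal.toReal_ofReal (by positivity), inner_neg_right, Complex.real_smul,
      Complex.ofReal_exp, smul_eq_mul, mul_comm]
    congr 2
    · push_cast; ring
    · push_cast; ring
  rw [e, h, ← ofReal_norm, gaussHat]
  congr 1
  have e2 : (Real.pi : ℂ) / ((Real.pi * τ ^ 2 : ℝ) : ℂ) = ((τ⁻¹ ^ (2 : ℝ) : ℝ) : ℂ) := by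
    rw [← Complex.ofReal_div]
    congr 1
    rw [Real.rpow_two]; field_simp
  have e3 : -(Real.pi : ℂ) ^ 2 * (‖-w‖ : ℂ) ^ 2 / ((Real.pi * τ ^ 2 : ℝ) : ℂ) =
      ((-(Real.pi / τ ^ 2) * ‖w‖ ^ 2 : ℝ) : ℂ) := by
    rw [norm_neg]
    push_cast
    have : (Real.pi : ℂ) ≠ 0 := by exact_mod_cast Real.pi_ne_zero
    have : (τ : ℂ) ≠ 0 := by exact_mod_cast hτ.ne'
    field_simp
  rw [norm_mul, e2, e3, Complex.norm_cpow_eq_rpow_re_of_pos (by positivity), ← Complex.ofReal_exp,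
    Complex.norm_real, Real.norm_of_nonneg (Real.exp_pos _).le, ← Real.rpow_mul (by positivity)]
  congr 1
  have : (2 : ℝ) * ((Module.finrank ℝ V : ℂ) / 2).re = (Module.finrank ℝ V : ℝ) := by
    simp; ring
  rw [this, Real.rpow_natCast]

theorem lintegral_gaussMeasure {τ : ℝ} {g : V → ℝ≥0∞} (hg : Measurable g) :
    ∫⁻ x, g x ∂(gaussMeasure V τ) =
      ∫⁻ x, ENNReal.ofReal (Real.exp (-(Real.pi * τ ^ 2) * ‖x‖ ^ 2)) * g x := by
  rw [gaussMeasure, lintegral_withDensity_eq_lintegral_mul _ (measurable_gaussDensity τ) hg]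
  rfl

/-- Schur's test above needs a finite measure. Gaussian weights provide one, and bounds uniform in
the width pass to Lebesgue measure by monotone convergence. -/
theorem lintegral_le_of_gaussMeasure {g : V → ℝ≥0∞} (hg : Measurable g) {B : ℝ≥0∞}
    (h : ∀ ε : ℝ, 0 < ε → ∫⁻ x, g x ∂(gaussMeasure V ε) ≤ B) : ∫⁻ x, g x ≤ B := by
  set F : ℕ → V → ℝ≥0∞ := fun n x =>
    ENNReal.ofReal (Real.exp (-(Real.pi * (1 / ((n : ℝ) + 1)) ^ 2) * ‖x‖ ^ 2)) * g x with hF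
  have ht : Filter.Tendsto (fun n => ∫⁻ x, F n x) Filter.atTop (nhds (∫⁻ x, g x)) := by
    refine lintegral_tendsto_of_tendsto_of_monotone (fun n => ?_) ?_ ?_
    · exact ((measurable_gaussDensity _).mul hg).aemeasurable
    · refine ae_of_all _ fun x m n hmn => ?_
      simp only [hF]
      gcongr
    · refine ae_of_all _ fun x => ?_
      have h0 : Filter.Tendsto (fun n : ℕ =>
          Real.exp (-(Real.pi * (1 / ((n : ℝ) + 1)) ^ 2) * ‖x‖ ^ 2)) Filter.atTop (nhds 1) := by
        have h1 := tendsto_one_div_add_atTop_nhds_zero_nat (𝕜 := ℝ)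
        have h2 : Continuous fun s : ℝ => Real.exp (-(Real.pi * s ^ 2) * ‖x‖ ^ 2) := by fun_prop
        have h3 := (h2.tendsto 0).comp h1
        rw [show Real.exp (-(Real.pi * 0 ^ 2) * ‖x‖ ^ 2) = 1 by simp] at h3
        exact h3
      have h4 := (ENNReal.continuous_ofReal.tendsto _).comp h0
      rw [ENNReal.ofReal_one] at h4
      have h5 := ENNReal.Tendsto.mul_const (b := g x) h4 (Or.inl one_ne_zero)
      simpa [hF] using h5
  refine le_of_tendsto' ht fun n => ?_
  rw [← lintegral_gaussMeasure hg]
  exact h _ (by positivity)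

end Gauss

/-- Mass one at every scale, so estimates by this kernel are uniform as the Gaussian cutoff is
removed. -/
theorem lintegral_gaussHat {V : Type*} [NormedAddCommGroup V] [InnerProductSpace ℝ V]
    [FiniteDimensional ℝ V] [MeasurableSpace V] [BorelSpace V] {τ : ℝ} (hτ : 0 < τ) (v : V) :
    ∫⁻ w : V, ENNReal.ofReal (gaussHat (Module.finrank ℝ V) τ ‖v - w‖) = 1 := by
  rw [lintegral_sub_left_eq_self (fun w : V =>
    ENNReal.ofReal (gaussHat (Module.finrank ℝ V) τ ‖w‖)) v]
  have h := lintegral_rexp_gauss (V := V) (inv_pos.2 hτ)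
  have : ∀ w : V, ENNReal.ofReal (gaussHat (Module.finrank ℝ V) τ ‖w‖) =
      ENNReal.ofReal (τ⁻¹ ^ Module.finrank ℝ V) *
        ENNReal.ofReal (Real.exp (-(Real.pi * τ⁻¹ ^ 2) * ‖w‖ ^ 2)) := by
    intro w
    rw [← ENNReal.ofReal_mul (by positivity), gaussHat]
    congr 4
    rw [inv_pow, div_eq_mul_inv]
  simp only [this]
  rw [lintegral_const_mul _ (measurable_gaussDensity _), h, ← ENNReal.ofReal_mul (by positivity),
    ← mul_pow, inv_inv, inv_mul_cancel₀ hτ.ne', one_pow, ENNReal.ofReal_one]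

/-! ### Polar coordinates in the plane -/

/-- The point with polar coordinates `(ρ, θ)`. -/
noncomputable def polar (ρ θ : ℝ) : Plane := !₂[ρ * Real.cos θ, ρ * Real.sin θ]

theorem continuous_polar : Continuous fun p : ℝ × ℝ => polar p.1 p.2 := by
  unfold polar
  refine (PiLp.continuous_toLp 2 _).comp (continuous_pi fun i => ?_)
  fin_cases i <;> simp <;> fun_prop

theorem polar_add_two_pi_zsmul (ρ θ : ℝ) (n : ℤ) : polar ρ (n * (2 * Real.pi) + θ) = polar ρ θ := by
  have h1 : Real.cos (n * (2 * Real.pi) + θ) = Real.cos θ := by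
    rw [add_comm]; exact Real.cos_add_int_mul_two_pi θ n
  have h2 : Real.sin (n * (2 * Real.pi) + θ) = Real.sin θ := by
    rw [add_comm]; exact Real.sin_add_int_mul_two_pi θ n
  rw [polar, polar, h1, h2]

theorem norm_polar {ρ : ℝ} (hρ : 0 ≤ ρ) (θ : ℝ) : ‖polar ρ θ‖ = ρ := by
  rw [polar, EuclideanSpace.norm_eq, Real.sqrt_eq_iff_mul_self_eq (by positivity) hρ]
  simp [Fin.sum_univ_two, sq]
  nlinarith [Real.sin_sq_add_cos_sq θ]

theorem exists_polar_eq (ξ : Plane) : ∃ α : ℝ, ξ = polar ‖ξ‖ α := by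
  set z : ℂ := ⟨ξ 0, ξ 1⟩ with hz
  have hn : ‖ξ‖ = ‖z‖ := by
    rw [EuclideanSpace.norm_eq, Complex.norm_eq_sqrt_sq_add_sq]
    simp [Fin.sum_univ_two, hz]
  refine ⟨z.arg, ?_⟩
  ext i
  fin_cases i
  · simp [polar, hn, Complex.norm_mul_cos_arg, hz]
  · simp [polar, hn, Complex.norm_mul_sin_arg, hz]

theorem norm_polar_sub_polar_sq (r ρ α θ : ℝ) :
    ‖polar r α - polar ρ θ‖ ^ 2 = (r - ρ) ^ 2 + 2 * (r * ρ) * (1 - Real.cos (θ - α)) := by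
  rw [EuclideanSpace.real_norm_sq_eq]
  simp only [polar, Fin.sum_univ_two, PiLp.sub_apply, Real.cos_sub]
  simp
  have h1 := Real.sin_sq_add_cos_sq θ
  have h2 := Real.sin_sq_add_cos_sq α
  linear_combination r ^ 2 * h2 + ρ ^ 2 * h1

/-- Both intervals are fundamental domains of Tℤ. This allows the angular interval to be centred at
the angle of a given frequency. -/
theorem setLIntegral_period_eq {g : ℝ → ℝ≥0∞} {T : ℝ} (hT : 0 < T)
    (hg : ∀ (n : ℤ) θ, g (n * T + θ) = g θ) (a b : ℝ) :
    ∫⁻ θ in Set.Ioo a (a + T), g θ = ∫⁻ θ in Set.Ioo b (b + T), g θ := by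
  rw [setLIntegral_congr Ioo_ae_eq_Ioc, setLIntegral_congr Ioo_ae_eq_Ioc]
  refine (isAddFundamentalDomain_Ioc hT a volume).setLIntegral_eq
    (isAddFundamentalDomain_Ioc hT b volume) g ?_
  rintro ⟨_, n, rfl⟩ θ
  simpa [AddSubmonoid.vadd_def] using hg n θ

theorem lintegral_polar {g : Plane → ℝ≥0∞} (hg : Measurable g) :
    ∫⁻ x, g x = ∫⁻ ρ in Set.Ioi (0 : ℝ), ∫⁻ θ in Set.Ioo 0 (2 * Real.pi),
      ENNReal.ofReal ρ * g (polar ρ θ) := by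
  have hmp : MeasurePreserving (fun p : ℝ × ℝ => (!₂[p.1, p.2] : Plane)) := by
    have h1 := (volume_preserving_finTwoArrow ℝ).symm
    have h2 := (EuclideanSpace.volume_preserving_symm_measurableEquiv_toLp (Fin 2)).symm
    exact h2.comp h1
  have hcont : Measurable fun z : ℝ × ℝ => ENNReal.ofReal z.1 * g (polar z.1 z.2) :=
    (by fun_prop : Measurable fun z : ℝ × ℝ => ENNReal.ofReal z.1).mul
      (hg.comp continuous_polar.measurable)
  rw [← hmp.lintegral_comp hg, ← lintegral_comp_polarCoord_symm]
  have ht : polarCoord.target = Set.Ioi (0 : ℝ) ×ˢ Set.Ioo (-Real.pi) Real.pi := rfl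
  have e1 : ∀ p : ℝ × ℝ, ENNReal.ofReal p.1 •
      g !₂[(polarCoord.symm p).1, (polarCoord.symm p).2] =
        ENNReal.ofReal p.1 * g (polar p.1 p.2) := fun p => rfl
  simp only [e1]
  rw [ht, Measure.volume_eq_prod, ← Measure.prod_restrict, lintegral_prod _ hcont.aemeasurable]
  refine lintegral_congr fun ρ => ?_
  have := setLIntegral_period_eq (g := fun θ => ENNReal.ofReal ρ * g (polar ρ θ))
    Real.two_pi_pos (fun n θ => by rw [polar_add_two_pi_zsmul]) (-Real.pi) 0
  rw [zero_add, show -Real.pi + 2 * Real.pi = Real.pi by ring] at this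
  exact this

/-! ### Marginals of the space-time Gaussian kernel on an annulus -/

/-- The annulus `R ≤ |ξ| < 2R`. -/
def annulus (R : ℝ) : Set Plane := {ξ | R ≤ ‖ξ‖ ∧ ‖ξ‖ < 2 * R}

theorem measurableSet_annulus (R : ℝ) : MeasurableSet (annulus R) :=
  (measurableSet_le measurable_const measurable_norm).inter
    (measurableSet_lt measurable_norm measurable_const)

theorem measurable_gaussHat (d : ℕ) (τ : ℝ) : Measurable (gaussHat d τ) := by
  unfold gaussHat; fun_prop

theorem gaussHat_abs (d : ℕ) (τ r : ℝ) : gaussHat d τ |r| = gaussHat d τ r := by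
  rw [gaussHat, gaussHat, sq_abs]

/-- By the law of cosines and 1 - cos x ≥ 2x²/π² for |x| ≤ π, the kernel on a circle of radius at
least R is at most a Gaussian in the angle of width τ/R. -/
theorem lintegral_gaussHat_angle_le {R τ ρ : ℝ} (hR : 0 < R) (hτ : 0 < τ) (hρ : R ≤ ρ)
    {ξ : Plane} (hξ : R ≤ ‖ξ‖) :
    ∫⁻ θ in Set.Ioo 0 (2 * Real.pi), ENNReal.ofReal (gaussHat 2 τ ‖ξ - polar ρ θ‖) ≤
      ENNReal.ofReal (Real.pi / (2 * R * τ)) := by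
  obtain ⟨α, hα⟩ := exists_polar_eq ξ
  set c : ℝ := 4 * R ^ 2 / (Real.pi * τ ^ 2) with hc
  have hc0 : 0 < c := by positivity
  have hpt : ∀ θ ∈ Set.Ioo (α - Real.pi) (α - Real.pi + 2 * Real.pi),
      gaussHat 2 τ ‖ξ - polar ρ θ‖ ≤ τ⁻¹ ^ 2 * Real.exp (-c * (θ - α) ^ 2) := by
    intro θ hθ
    rw [gaussHat, hα, norm_polar_sub_polar_sq]
    refine mul_le_mul_of_nonneg_left (Real.exp_le_exp.2 ?_) (by positivity)
    have habs : |θ - α| ≤ Real.pi := by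
      rw [abs_le]; constructor <;> linarith [hθ.1, hθ.2]
    have hcos := Real.cos_le_one_sub_mul_cos_sq habs
    have h1 : 2 / Real.pi ^ 2 * (θ - α) ^ 2 ≤ 1 - Real.cos (θ - α) := by linarith
    have h2 : R ^ 2 ≤ ‖ξ‖ * ρ := by nlinarith
    have h3 : R ^ 2 * (2 / Real.pi ^ 2 * (θ - α) ^ 2) ≤ ‖ξ‖ * ρ * (1 - Real.cos (θ - α)) :=
      mul_le_mul h2 h1 (by positivity) (by nlinarith)
    have h4 : c * (θ - α) ^ 2 = Real.pi / τ ^ 2 * (2 * (R ^ 2 * (2 / Real.pi ^ 2 * (θ - α) ^ 2))) := by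
      rw [hc]; field_simp; ring
    rw [neg_mul, neg_mul, neg_le_neg_iff, h4]
    gcongr
    nlinarith [sq_nonneg (‖ξ‖ - ρ)]
  have hper := setLIntegral_period_eq
    (g := fun θ => ENNReal.ofReal (gaussHat 2 τ ‖ξ - polar ρ θ‖))
    Real.two_pi_pos (fun n θ => by rw [polar_add_two_pi_zsmul]) 0 (α - Real.pi)
  rw [zero_add] at hper
  rw [hper]
  calc _ ≤ ∫⁻ θ in Set.Ioo (α - Real.pi) (α - Real.pi + 2 * Real.pi),
        ENNReal.ofReal (τ⁻¹ ^ 2 * Real.exp (-c * (θ - α) ^ 2)) :=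
        setLIntegral_mono' measurableSet_Ioo fun θ hθ => ENNReal.ofReal_le_ofReal (hpt θ hθ)
    _ ≤ ∫⁻ θ, ENNReal.ofReal (τ⁻¹ ^ 2 * Real.exp (-c * (θ - α) ^ 2)) := setLIntegral_le_lintegral _ _
    _ = ∫⁻ θ, ENNReal.ofReal (τ⁻¹ ^ 2 * Real.exp (-c * θ ^ 2)) :=
        lintegral_sub_right_eq_self (fun θ : ℝ =>
          ENNReal.ofReal (τ⁻¹ ^ 2 * Real.exp (-c * θ ^ 2))) α
    _ = ENNReal.ofReal (τ⁻¹ ^ 2 * √(Real.pi / c)) := by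
        rw [← ofReal_integral_eq_lintegral_ofReal ((integrable_exp_neg_mul_sq hc0).const_mul _)
          (ae_of_all _ fun θ => by positivity), integral_const_mul, integral_gaussian]
    _ = ENNReal.ofReal (Real.pi / (2 * R * τ)) := by
        congr 1
        have : Real.pi / c = (Real.pi * τ / (2 * R)) ^ 2 := by rw [hc]; field_simp; ring
        rw [this, Real.sqrt_sq (by positivity)]
        field_simp

/-- The bound by the maximum of the kernel, which is the better one for τ ≫ R. -/
theorem lintegral_gaussHat_angle_le' {τ : ℝ} (hτ : 0 < τ) (ρ : ℝ) (ξ : Plane) :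
    ∫⁻ θ in Set.Ioo 0 (2 * Real.pi), ENNReal.ofReal (gaussHat 2 τ ‖ξ - polar ρ θ‖) ≤
      ENNReal.ofReal (2 * Real.pi / τ ^ 2) := by
  calc _ ≤ ∫⁻ θ in Set.Ioo 0 (2 * Real.pi), ENNReal.ofReal (τ⁻¹ ^ 2) := by
        refine lintegral_mono fun θ => ENNReal.ofReal_le_ofReal ?_
        rw [gaussHat]
        refine mul_le_of_le_one_right (by positivity) (Real.exp_le_one_iff.2 ?_)
        rw [neg_mul, neg_nonpos]; positivity
    _ = _ := by
        rw [setLIntegral_const, Real.volume_Ioo, ← ENNReal.ofReal_mul (by positivity)]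
        congr 1; field_simp; ring

/-- In polar coordinates the Gaussian in |ξ| - |η| has radial mass at most one whatever ε is, the
Jacobian is at most 2R, and the angular integral is bounded uniformly in the radius. -/
theorem lintegral_annulus_gaussHat_le {R τ ε : ℝ} (hR : 0 < R) (hτ : 0 < τ) (hε : 0 < ε)
    {ξ : Plane} (hξ : ξ ∈ annulus R) :
    ∫⁻ η in annulus R, ENNReal.ofReal (gaussHat 1 ε (‖ξ‖ - ‖η‖)) *
      ENNReal.ofReal (gaussHat 2 τ ‖ξ - η‖) ≤
        ENNReal.ofReal (min (Real.pi / τ) (4 * Real.pi * R / τ ^ 2)) := by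
  have h1m := measurable_gaussHat 1 ε
  have h2m := measurable_gaussHat 2 τ
  have hm : Measurable fun η : Plane => ENNReal.ofReal (gaussHat 1 ε (‖ξ‖ - ‖η‖)) *
      ENNReal.ofReal (gaussHat 2 τ ‖ξ - η‖) := by fun_prop
  set J : ℝ := min (Real.pi / (2 * R * τ)) (2 * Real.pi / τ ^ 2) with hJ
  have hJle : ∀ ρ, R ≤ ρ → ∫⁻ θ in Set.Ioo 0 (2 * Real.pi),
      ENNReal.ofReal (gaussHat 2 τ ‖ξ - polar ρ θ‖) ≤ ENNReal.ofReal J := by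
    intro ρ hρ
    rw [hJ, ENNReal.ofReal_min]
    exact le_min (lintegral_gaussHat_angle_le hR hτ hρ hξ.1) (lintegral_gaussHat_angle_le' hτ ρ ξ)
  have hpol : ∀ ρ, Measurable (polar ρ) := fun ρ =>
    (continuous_polar.comp (Continuous.prodMk_right ρ)).measurable
  rw [← lintegral_indicator (measurableSet_annulus R),
    lintegral_polar (hm.indicator (measurableSet_annulus R))]
  calc _ ≤ ∫⁻ ρ in Set.Ioi (0 : ℝ), ENNReal.ofReal (2 * R) * ENNReal.ofReal J *
          ENNReal.ofReal (gaussHat 1 ε ‖‖ξ‖ - ρ‖) := by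
        refine setLIntegral_mono' measurableSet_Ioi fun ρ (hρ : 0 < ρ) => ?_
        by_cases hmem : R ≤ ρ ∧ ρ < 2 * R
        · calc _ ≤ ∫⁻ θ in Set.Ioo 0 (2 * Real.pi), ENNReal.ofReal (2 * R) *
                ENNReal.ofReal (gaussHat 1 ε ‖‖ξ‖ - ρ‖) *
                  ENNReal.ofReal (gaussHat 2 τ ‖ξ - polar ρ θ‖) := by
                refine lintegral_mono fun θ => ?_
                rw [mul_assoc]
                refine mul_le_mul' (ENNReal.ofReal_le_ofReal hmem.2.le) ?_
                refine (Set.indicator_le_self _ _ _).trans ?_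
                rw [norm_polar hρ.le, Real.norm_eq_abs, gaussHat_abs]
            _ = ENNReal.ofReal (2 * R) * ENNReal.ofReal (gaussHat 1 ε ‖‖ξ‖ - ρ‖) *
                  ∫⁻ θ in Set.Ioo 0 (2 * Real.pi),
                    ENNReal.ofReal (gaussHat 2 τ ‖ξ - polar ρ θ‖) := by
                have := hpol ρ
                rw [lintegral_const_mul _ (by fun_prop)]
            _ ≤ _ := by
                rw [mul_right_comm]
                gcongr
                exact hJle ρ hmem.1
        · have : ∀ θ, polar ρ θ ∉ annulus R := by
            intro θ h
            rw [annulus, Set.mem_ofPred_eq, norm_polar hρ.le] at h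
            exact hmem h
          simp [this]
    _ ≤ ∫⁻ ρ : ℝ, ENNReal.ofReal (2 * R) * ENNReal.ofReal J *
          ENNReal.ofReal (gaussHat 1 ε ‖‖ξ‖ - ρ‖) := setLIntegral_le_lintegral _ _
    _ = ENNReal.ofReal (2 * R) * ENNReal.ofReal J := by
        have h := lintegral_gaussHat hε ‖ξ‖
        rw [Module.finrank_self] at h
        rw [lintegral_const_mul _ (by fun_prop), h, mul_one]
    _ = _ := by
        rw [← ENNReal.ofReal_mul (by positivity)]
        congr 1
        rw [hJ, mul_min_of_nonneg _ _ (by positivity)]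
        congr 1 <;> field_simp
        ring

/-! ### Half-waves with integrable Fourier transform -/

/-- The phase `2π(x·ξ - t|ξ|)`. -/
noncomputable def phase (t : ℝ) (x ξ : Plane) : ℝ := 2 * Real.pi * (inner ℝ x ξ - t * ‖ξ‖)

/-- The half-wave `∫_A exp (2πi(x·ξ - t|ξ|)) f(ξ) dξ` with frequencies in `A`. -/
noncomputable def blockWave (A : Set Plane) (f : Plane → ℂ) (t : ℝ) (x : Plane) : ℂ :=
  ∫ ξ in A, Complex.exp (phase t x ξ * Complex.I) * f ξ

theorem continuous_phase : Continuous fun p : (ℝ × Plane) × Plane => phase p.1.1 p.1.2 p.2 := by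
  unfold phase; fun_prop

theorem measurable_phase (t : ℝ) (x : Plane) : Measurable (phase t x) :=
  (continuous_phase.comp (Continuous.prodMk_right (t, x))).measurable

theorem continuous_blockWave {A : Set Plane} {f : Plane → ℂ} (hf : IntegrableOn f A) :
    Continuous fun p : ℝ × Plane => blockWave A f p.1 p.2 := by
  refine continuous_of_dominated (bound := fun ξ => ‖f ξ‖) (fun p => ?_) (fun p => ?_) hf.norm ?_
  · exact (integrable_cexp_mul hf (measurable_phase p.1 p.2)).1
  · exact ae_of_all _ fun ξ => by rw [norm_mul, norm_cexp_real_mul_I, one_mul]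
  · refine ae_of_all _ fun ξ => ?_
    have : Continuous fun p : ℝ × Plane => phase p.1 p.2 ξ :=
      continuous_phase.comp (Continuous.prodMk_left ξ)
    fun_prop

theorem continuous_blockWave_right {A : Set Plane} {f : Plane → ℂ} (hf : IntegrableOn f A)
    (t : ℝ) : Continuous (blockWave A f t) :=
  Continuous.comp (g := fun p : ℝ × Plane => blockWave A f p.1 p.2) (f := fun x => (t, x))
    (continuous_blockWave hf) (Continuous.prodMk_right t)

theorem enorm_blockWave_le (A : Set Plane) (f : Plane → ℂ) (t : ℝ) (x : Plane) :
    ‖blockWave A f t x‖ₑ ≤ ∫⁻ ξ in A, ‖f ξ‖ₑ := by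
  refine (enorm_integral_le_lintegral_enorm _).trans (le_of_eq (lintegral_congr fun ξ => ?_))
  rw [enorm_mul, ← ofReal_norm, norm_cexp_real_mul_I, ENNReal.ofReal_one, one_mul]

theorem rpow_half_sq (x : ℝ≥0∞) : (x ^ (1 / 2 : ℝ)) ^ 2 = x := by
  rw [← ENNReal.rpow_natCast, ← ENNReal.rpow_mul]; norm_num

theorem sq_lintegral_enorm_le {X : Type*} [MeasurableSpace X] {μ : Measure X} {f : X → ℂ}
    (hf : AEStronglyMeasurable f μ) :
    (∫⁻ ξ, ‖f ξ‖ₑ ∂μ) ^ 2 ≤ μ Set.univ * ∫⁻ ξ, ‖f ξ‖ₑ ^ 2 ∂μ := by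
  have h := ENNReal.lintegral_mul_le_Lp_mul_Lq μ Real.HolderConjugate.two_two
    (f := fun _ => 1) (g := fun ξ => ‖f ξ‖ₑ) aemeasurable_const hf.enorm
  simp only [Pi.mul_apply, one_mul, ENNReal.one_rpow, lintegral_const] at h
  refine (pow_le_pow_left' h 2).trans (le_of_eq ?_)
  simp only [ENNReal.rpow_two]
  rw [mul_pow, rpow_half_sq, rpow_half_sq]

/-- Plancherel up to the factor 2. The time phase is absorbed into f, and the T T* kernel with a
Gaussian cutoff is an approximate identity with marginals at most 1. -/
theorem lintegral_blockWave_sq_le {A : Set Plane} {f : Plane → ℂ} (hf : IntegrableOn f A) (t : ℝ) :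
    ∫⁻ x, ‖blockWave A f t x‖ₑ ^ 2 ≤ 2 * ∫⁻ ξ in A, ‖f ξ‖ₑ ^ 2 := by
  refine lintegral_le_of_gaussMeasure ((continuous_blockWave_right hf t).measurable.enorm.pow_const 2) fun ε hε => ?_
  have := isFiniteMeasure_gaussMeasure (V := Plane) hε
  set g : Plane → ℂ := fun ξ => Complex.exp (((-(2 * Real.pi * (t * ‖ξ‖)) : ℝ) : ℂ) * Complex.I) * f ξ
    with hg
  have hgi : IntegrableOn g A := integrable_cexp_mul hf (by fun_prop)
  have hgn : ∀ ξ, ‖g ξ‖ₑ = ‖f ξ‖ₑ := fun ξ => by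
    rw [hg, enorm_mul, ← ofReal_norm, norm_cexp_real_mul_I, ENNReal.ofReal_one, one_mul]
  have hug : ∀ x, blockWave A f t x =
      ∫ ξ in A, Complex.exp (((2 * Real.pi * inner ℝ x ξ : ℝ) : ℂ) * Complex.I) * g ξ := by
    intro x
    refine integral_congr_ae (ae_of_all _ fun ξ => ?_)
    simp only [hg, phase]
    rw [← mul_assoc, ← Complex.exp_add]
    congr 2
    push_cast; ring
  simp only [hug]
  have hH := measurable_gaussHat 2 ε
  have key := lintegral_oscillatory_sq_le (volume.restrict A) (gaussMeasure Plane ε)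
    (Φ := fun x ξ => 2 * Real.pi * inner ℝ x ξ) (by unfold Function.uncurry; fun_prop) hgi
    (k := fun ξ η => ENNReal.ofReal (gaussHat 2 ε ‖ξ - η‖))
    (by unfold Function.uncurry; fun_prop) (fun ξ η => by rw [norm_sub_rev]) (B := 1) ?_ ?_
  · simpa only [hgn, mul_one] using key
  · intro ξ η
    have h := enorm_integral_gaussMeasure_eq hε (ξ - η)
    rw [finrank_euclideanSpace_fin] at h
    rw [← h]
    simp only [inner_sub_right, mul_sub]
    exact le_rfl
  · refine ae_of_all _ fun ξ => (setLIntegral_le_lintegral _ _).trans (le_of_eq ?_)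
    have h := lintegral_gaussHat hε ξ
    rwa [finrank_euclideanSpace_fin] at h

/-- Local energy decay, with a Gaussian weight in space. -/
theorem lintegral_blockWave_gauss_le {R : ℝ} (hR : 0 < R) {f : Plane → ℂ}
    (hf : IntegrableOn f (annulus R)) {τ : ℝ} (hτ : 0 < τ) :
    ∫⁻ t, ∫⁻ x, ‖blockWave (annulus R) f t x‖ₑ ^ 2 ∂(gaussMeasure Plane τ) ≤
      2 * ENNReal.ofReal (min (Real.pi / τ) (4 * Real.pi * R / τ ^ 2)) *
        ∫⁻ ξ in annulus R, ‖f ξ‖ₑ ^ 2 := by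
  have := isFiniteMeasure_gaussMeasure (V := Plane) hτ
  have hmeas : Measurable fun p : ℝ × Plane => ‖blockWave (annulus R) f p.1 p.2‖ₑ ^ 2 :=
    (continuous_blockWave hf).measurable.enorm.pow_const 2
  refine lintegral_le_of_gaussMeasure hmeas.lintegral_prod_right' fun ε hε => ?_
  have := isFiniteMeasure_gaussMeasure (V := ℝ) hε
  rw [← lintegral_prod _ hmeas.aemeasurable]
  have hH := measurable_gaussHat 2 τ
  have hH1 := measurable_gaussHat 1 ε
  -- The phase difference separates: time sees only |ξ| - |η| and space only ξ - η, so the kernel is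
  -- a product of two Gaussian transforms.
  refine lintegral_oscillatory_sq_le (volume.restrict (annulus R))
    ((gaussMeasure ℝ ε).prod (gaussMeasure Plane τ))
    (Φ := fun p ξ => phase p.1 p.2 ξ) continuous_phase.measurable hf
    (k := fun ξ η => ENNReal.ofReal (gaussHat 1 ε (‖ξ‖ - ‖η‖)) *
      ENNReal.ofReal (gaussHat 2 τ ‖ξ - η‖))
    (by unfold Function.uncurry; fun_prop) (fun ξ η => ?_) (fun ξ η => ?_) ?_
  · rw [norm_sub_rev, ← gaussHat_abs, abs_sub_comm, gaussHat_abs]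
  · have h1 := enorm_integral_gaussMeasure_eq hε (‖η‖ - ‖ξ‖)
    have h2 := enorm_integral_gaussMeasure_eq hτ (ξ - η)
    rw [finrank_euclideanSpace_fin] at h2
    rw [Module.finrank_self, Real.norm_eq_abs, abs_sub_comm, gaussHat_abs] at h1
    rw [← h1, ← h2, ← enorm_mul, ← integral_prod_mul]
    refine le_of_eq (congrArg _ (integral_congr_ae (ae_of_all _ fun p => ?_)))
    simp only [phase]
    rw [← Complex.exp_add]
    congr 1
    have hin : ∀ a b : ℝ, inner ℝ a b = a * b := fun a b => by simp [mul_comm]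
    simp only [inner_sub_right, hin]
    push_cast; ring
  · refine (ae_restrict_iff' (measurableSet_annulus R)).2 (ae_of_all _ fun ξ hξ => ?_)
    exact lintegral_annulus_gaussHat_le hR hτ hε hξ

/-! ### Derivatives of half-waves along rays -/

/-- The Fourier multiplier `2πiξ_j` of the partial derivative `∂_j`. -/
noncomputable def gradMul (j : Fin 2) (f : Plane → ℂ) (ξ : Plane) : ℂ :=
  ((2 * Real.pi * ξ j : ℝ) : ℂ) * Complex.I * f ξ

theorem abs_coord_le_norm (ξ : Plane) (j : Fin 2) : |ξ j| ≤ ‖ξ‖ := by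
  simpa using PiLp.norm_apply_le ξ j

theorem norm_gradMul_le (j : Fin 2) (f : Plane → ℂ) (ξ : Plane) :
    ‖gradMul j f ξ‖ ≤ 2 * Real.pi * ‖ξ‖ * ‖f ξ‖ := by
  rw [gradMul, norm_mul, norm_mul, Complex.norm_I, mul_one, Complex.norm_real, Real.norm_eq_abs,
    abs_mul, abs_of_pos Real.two_pi_pos]
  gcongr
  exact abs_coord_le_norm ξ j

theorem integrableOn_gradMul {A : Set Plane} (hA : MeasurableSet A) {L : ℝ}
    (hL : ∀ ξ ∈ A, ‖ξ‖ ≤ L) {f : Plane → ℂ} (hf : IntegrableOn f A) (j : Fin 2) :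
    IntegrableOn (gradMul j f) A := by
  refine Integrable.mono' (g := fun ξ => 2 * Real.pi * L * ‖f ξ‖) (hf.norm.const_mul _) ?_ ?_
  · have hm : Measurable fun ξ : Plane => ((2 * Real.pi * ξ j : ℝ) : ℂ) * Complex.I := by fun_prop
    exact hm.aestronglyMeasurable.mul hf.1
  · refine (ae_restrict_iff' hA).2 (ae_of_all _ fun ξ hξ => (norm_gradMul_le j f ξ).trans ?_)
    have := hL ξ hξ
    have := Real.pi_pos
    gcongr

theorem phase_polar (t s θ : ℝ) (ξ : Plane) :
    phase t (polar s θ) ξ =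
      s * (2 * Real.pi * (Real.cos θ * ξ 0 + Real.sin θ * ξ 1)) - 2 * Real.pi * (t * ‖ξ‖) := by
  rw [phase, polar, PiLp.inner_apply]
  simp [Fin.sum_univ_two]
  ring

/-- Bounded frequencies justify differentiation under the integral. The radial derivative is cos θ
∂₀ + sin θ ∂₁, and each partial derivative is again a block wave, so the L² bounds apply to it. -/
theorem hasDerivAt_blockWave_polar {A : Set Plane} (hA : MeasurableSet A) {L : ℝ}
    (hL : ∀ ξ ∈ A, ‖ξ‖ ≤ L) {f : Plane → ℂ} (hf : IntegrableOn f A) (t s θ : ℝ) :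
    HasDerivAt (fun s => blockWave A f t (polar s θ))
      (Real.cos θ * blockWave A (gradMul 0 f) t (polar s θ) +
        Real.sin θ * blockWave A (gradMul 1 f) t (polar s θ)) s := by
  have h0 := integrableOn_gradMul hA hL hf 0
  have h1 := integrableOn_gradMul hA hL hf 1
  set F' : ℝ → Plane → ℂ := fun s ξ => Real.cos θ *
    (Complex.exp (phase t (polar s θ) ξ * Complex.I) * gradMul 0 f ξ) + Real.sin θ *
    (Complex.exp (phase t (polar s θ) ξ * Complex.I) * gradMul 1 f ξ) with hF'
  have hint : ∀ s, Integrable (F' s) (volume.restrict A) := fun s =>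
    ((integrable_cexp_mul h0 (measurable_phase _ _)).const_mul _).add
      ((integrable_cexp_mul h1 (measurable_phase _ _)).const_mul _)
  have key := hasDerivAt_integral_of_dominated_loc_of_deriv_le (μ := volume.restrict A)
    (F := fun s ξ => Complex.exp (phase t (polar s θ) ξ * Complex.I) * f ξ) (F' := F') (x₀ := s)
    (bound := fun ξ => ‖gradMul 0 f ξ‖ + ‖gradMul 1 f ξ‖) Filter.univ_mem
    (Filter.Eventually.of_forall fun s => (integrable_cexp_mul hf (measurable_phase _ _)).1)
    (integrable_cexp_mul hf (measurable_phase _ _)) (hint s).1 ?_ (h0.norm.add h1.norm) ?_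
  · have h2 := key.2
    have e : ∫ ξ in A, F' s ξ = Real.cos θ * blockWave A (gradMul 0 f) t (polar s θ) +
        Real.sin θ * blockWave A (gradMul 1 f) t (polar s θ) := by
      simp only [hF']
      rw [integral_add ((integrable_cexp_mul h0 (measurable_phase _ _)).const_mul _)
        ((integrable_cexp_mul h1 (measurable_phase _ _)).const_mul _), integral_const_mul,
        integral_const_mul]
      rfl
    rw [e] at h2
    exact h2
  · refine ae_of_all _ fun ξ s _ => ?_
    simp only [hF']
    refine (norm_add_le _ _).trans (add_le_add ?_ ?_)
    · rw [norm_mul, norm_mul, norm_cexp_real_mul_I, one_mul, Complex.norm_real]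
      exact mul_le_of_le_one_left (norm_nonneg _) (Real.abs_cos_le_one θ)
    · rw [norm_mul, norm_mul, norm_cexp_real_mul_I, one_mul, Complex.norm_real]
      exact mul_le_of_le_one_left (norm_nonneg _) (Real.abs_sin_le_one θ)
  · refine ae_of_all _ fun ξ s _ => ?_
    have e : ∀ s, ((phase t (polar s θ) ξ : ℝ) : ℂ) * Complex.I =
        (s : ℂ) * (((2 * Real.pi * (Real.cos θ * ξ 0 + Real.sin θ * ξ 1) : ℝ) : ℂ) * Complex.I) -
          ((2 * Real.pi * (t * ‖ξ‖) : ℝ) : ℂ) * Complex.I := by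
      intro s
      rw [phase_polar]
      push_cast; ring
    have hd : HasDerivAt (fun s : ℝ => ((phase t (polar s θ) ξ : ℝ) : ℂ) * Complex.I)
        (((2 * Real.pi * (Real.cos θ * ξ 0 + Real.sin θ * ξ 1) : ℝ) : ℂ) * Complex.I) s := by
      simp only [e]
      have := ((hasDerivAt_id s).ofReal_comp.mul_const
        (((2 * Real.pi * (Real.cos θ * ξ 0 + Real.sin θ * ξ 1) : ℝ) : ℂ) * Complex.I)).sub_const
          (((2 * Real.pi * (t * ‖ξ‖) : ℝ) : ℂ) * Complex.I)
      simpa using this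
    have := hd.cexp.mul_const (f ξ)
    refine this.congr_deriv ?_
    simp only [hF', gradMul]
    push_cast; ring

theorem add_sq_le_three (x y : ℝ≥0∞) : (x + y) ^ 2 ≤ 3 * x ^ 2 + 3 * y ^ 2 := by
  calc (x + y) ^ 2 = x ^ 2 + y ^ 2 + 2 * (x * y) := by ring
    _ ≤ x ^ 2 + y ^ 2 + 2 * (x ^ 2 + y ^ 2) := by gcongr; exact mul_le_sq_add_sq x y
    _ = _ := by ring

/-- A one-dimensional Sobolev inequality at scale `ℓ`. -/
theorem enorm_sq_le_lintegral_Ioo {φ φ' : ℝ → ℂ} (hφ : ∀ s, HasDerivAt φ (φ' s) s)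
    (hφ' : Continuous φ') (a : ℝ) {ℓ : ℝ} (hℓ : 0 < ℓ) :
    ‖φ a‖ₑ ^ 2 ≤ ∫⁻ s in Set.Ioo a (a + ℓ),
      (ENNReal.ofReal (3 / ℓ) * ‖φ s‖ₑ ^ 2 + ENNReal.ofReal (3 * ℓ) * ‖φ' s‖ₑ ^ 2) := by
  have hφc : Continuous φ := continuous_iff_continuousAt.2 fun s => (hφ s).continuousAt
  set μ := volume.restrict (Set.Ioo a (a + ℓ)) with hμ
  have hμu : μ Set.univ = ENNReal.ofReal ℓ := by simp [hμ]
  set I := ∫⁻ s, ‖φ' s‖ₑ ∂μ with hI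
  have hI2 : I ^ 2 ≤ ENNReal.ofReal ℓ * ∫⁻ s, ‖φ' s‖ₑ ^ 2 ∂μ := by
    rw [← hμu]; exact sq_lintegral_enorm_le hφ'.aestronglyMeasurable
  -- The value at a is compared with the value at every s of the interval by the fundamental theorem
  -- of calculus; averaging in s and Cauchy–Schwarz for I finish the proof.
  have hpt : ∀ s ∈ Set.Ioo a (a + ℓ), ‖φ a‖ₑ ^ 2 ≤ 3 * ‖φ s‖ₑ ^ 2 + 3 * I ^ 2 := by
    intro s hs
    have h1 : ∫ x in a..s, φ' x = φ s - φ a :=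
      intervalIntegral.integral_eq_sub_of_hasDerivAt (fun x _ => hφ x)
        (hφ'.intervalIntegrable _ _)
    have h2 : ‖φ a‖ₑ ≤ ‖φ s‖ₑ + I := by
      have e : φ a = φ s - ∫ x in a..s, φ' x := by rw [h1]; ring
      rw [e]
      refine (enorm_sub_le).trans (add_le_add le_rfl ?_)
      rw [intervalIntegral.integral_of_le hs.1.le]
      refine (enorm_integral_le_lintegral_enorm _).trans ?_
      exact lintegral_mono_set fun x hx => ⟨hx.1, hx.2.trans_lt hs.2⟩
    exact (pow_le_pow_left' h2 2).trans (add_sq_le_three _ _)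
  have h3 : ENNReal.ofReal ℓ * ‖φ a‖ₑ ^ 2 ≤
      3 * (∫⁻ s, ‖φ s‖ₑ ^ 2 ∂μ) + ENNReal.ofReal ℓ * (3 * I ^ 2) := by
    calc _ = ∫⁻ _, ‖φ a‖ₑ ^ 2 ∂μ := by rw [lintegral_const, hμu, mul_comm]
      _ ≤ ∫⁻ s, (3 * ‖φ s‖ₑ ^ 2 + 3 * I ^ 2) ∂μ := setLIntegral_mono' measurableSet_Ioo hpt
      _ = _ := by
        rw [lintegral_add_right _ measurable_const, lintegral_const, hμu,
          lintegral_const_mul _ (by fun_prop)]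
        ring
  have hℓ1 : ENNReal.ofReal (1 / ℓ) * ENNReal.ofReal ℓ = 1 := by
    rw [← ENNReal.ofReal_mul (by positivity), one_div_mul_cancel hℓ.ne', ENNReal.ofReal_one]
  have h3' : ENNReal.ofReal (3 / ℓ) = ENNReal.ofReal (1 / ℓ) * 3 := by
    rw [show (3 : ℝ≥0∞) = ENNReal.ofReal 3 by simp, ← ENNReal.ofReal_mul (by positivity)]
    congr 1; ring
  have h3'' : ENNReal.ofReal (3 * ℓ) = 3 * ENNReal.ofReal ℓ := by
    rw [ENNReal.ofReal_mul (by norm_num)]; simp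
  calc ‖φ a‖ₑ ^ 2 = ENNReal.ofReal (1 / ℓ) * (ENNReal.ofReal ℓ * ‖φ a‖ₑ ^ 2) := by
        rw [← mul_assoc, hℓ1, one_mul]
    _ ≤ ENNReal.ofReal (1 / ℓ) *
        (3 * (∫⁻ s, ‖φ s‖ₑ ^ 2 ∂μ) + ENNReal.ofReal ℓ * (3 * I ^ 2)) := by gcongr
    _ = ENNReal.ofReal (3 / ℓ) * (∫⁻ s, ‖φ s‖ₑ ^ 2 ∂μ) + 3 * I ^ 2 := by
        rw [mul_add, ← mul_assoc, ← mul_assoc, hℓ1, one_mul, h3']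
    _ ≤ ENNReal.ofReal (3 / ℓ) * (∫⁻ s, ‖φ s‖ₑ ^ 2 ∂μ) +
        ENNReal.ofReal (3 * ℓ) * ∫⁻ s, ‖φ' s‖ₑ ^ 2 ∂μ := by
        rw [h3'', mul_assoc]; gcongr
    _ = _ := by
        rw [lintegral_add_left (by fun_prop), lintegral_const_mul _ (by fun_prop),
          lintegral_const_mul _ (by fun_prop)]

/-! ### The energy density of a half-wave with frequencies in an annulus -/

/-- `R|u|² + R⁻¹|∇u|²`, up to numerical factors. -/
noncomputable def energyDensity (R : ℝ) (f : Plane → ℂ) (t : ℝ) (x : Plane) : ℝ≥0∞ :=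
  ENNReal.ofReal (3 * R) * ‖blockWave (annulus R) f t x‖ₑ ^ 2 +
    ENNReal.ofReal (9 / R) * (‖blockWave (annulus R) (gradMul 0 f) t x‖ₑ ^ 2 +
      ‖blockWave (annulus R) (gradMul 1 f) t x‖ₑ ^ 2)

/-- The square of the `L²` norm of the part of `f` in the annulus. -/
noncomputable def annulusMass (R : ℝ) (f : Plane → ℂ) : ℝ≥0∞ := ∫⁻ ξ in annulus R, ‖f ξ‖ₑ ^ 2

/-- A numerical constant. -/
noncomputable def energyConst : ℝ := 3 + 288 * Real.pi ^ 2

theorem energyConst_pos : 0 < energyConst := by unfold energyConst; positivity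

theorem norm_le_of_mem_annulus {R : ℝ} {ξ : Plane} (h : ξ ∈ annulus R) : ‖ξ‖ ≤ 2 * R := h.2.le

section

variable {R : ℝ} {f : Plane → ℂ}

theorem integrableOn_gradMul_annulus (hf : IntegrableOn f (annulus R)) (j : Fin 2) :
    IntegrableOn (gradMul j f) (annulus R) :=
  integrableOn_gradMul (measurableSet_annulus R) (fun _ => norm_le_of_mem_annulus) hf j

theorem measurable_energyDensity (hf : IntegrableOn f (annulus R)) :
    Measurable fun p : ℝ × Plane => energyDensity R f p.1 p.2 := by
  have h := (continuous_blockWave hf).measurable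
  have h0 := (continuous_blockWave (integrableOn_gradMul_annulus hf 0)).measurable
  have h1 := (continuous_blockWave (integrableOn_gradMul_annulus hf 1)).measurable
  unfold energyDensity
  fun_prop

theorem annulusMass_gradMul_le (hR : 0 < R) (j : Fin 2) :
    annulusMass R (gradMul j f) ≤ ENNReal.ofReal ((4 * Real.pi * R) ^ 2) * annulusMass R f := by
  unfold annulusMass
  rw [← lintegral_const_mul' _ _ ENNReal.ofReal_ne_top]
  refine setLIntegral_mono' (measurableSet_annulus R) fun ξ hξ => ?_
  rw [ENNReal.ofReal_pow (by positivity), ← mul_pow, ← ofReal_norm, ← ofReal_norm,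
    ← ENNReal.ofReal_mul (by positivity)]
  refine pow_le_pow_left' (ENNReal.ofReal_le_ofReal ((norm_gradMul_le j f ξ).trans ?_)) 2
  have := norm_le_of_mem_annulus hξ
  have := Real.pi_pos
  calc 2 * Real.pi * ‖ξ‖ * ‖f ξ‖ ≤ 2 * Real.pi * (2 * R) * ‖f ξ‖ := by gcongr
    _ = _ := by ring

theorem energy_mass_le (hR : 0 < R) :
    ENNReal.ofReal (3 * R) * annulusMass R f + ENNReal.ofReal (9 / R) *
      (annulusMass R (gradMul 0 f) + annulusMass R (gradMul 1 f)) ≤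
        ENNReal.ofReal (energyConst * R) * annulusMass R f := by
  calc _ ≤ ENNReal.ofReal (3 * R) * annulusMass R f + ENNReal.ofReal (9 / R) *
        (ENNReal.ofReal ((4 * Real.pi * R) ^ 2) * annulusMass R f +
          ENNReal.ofReal ((4 * Real.pi * R) ^ 2) * annulusMass R f) := by
        gcongr <;> exact annulusMass_gradMul_le hR _
    _ = _ := by
        rw [← add_mul, ← ENNReal.ofReal_add (by positivity) (by positivity), ← mul_assoc,
          ← ENNReal.ofReal_mul (by positivity), ← add_mul,
          ← ENNReal.ofReal_add (by positivity) (by positivity)]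
        congr 2
        -- Here 288π² = 9 · 2 · (4π)²: two partial derivatives, each costing at most 4πR on the
        -- annulus.
        rw [energyConst]; field_simp; ring

theorem lintegral_mul_add_mul_add {X : Type*} [MeasurableSpace X] {μ : Measure X}
    {F G H : X → ℝ≥0∞} (hF : Measurable F) (hG : Measurable G) (hH : Measurable H) (a b : ℝ≥0∞) :
    ∫⁻ x, (a * F x + b * (G x + H x)) ∂μ =
      a * (∫⁻ x, F x ∂μ) + b * ((∫⁻ x, G x ∂μ) + ∫⁻ x, H x ∂μ) := by
  rw [lintegral_add_left (by fun_prop), lintegral_const_mul _ hF,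
    lintegral_const_mul _ (by fun_prop), lintegral_add_left hG]

theorem lintegral_energyDensity_le (hR : 0 < R) (hf : IntegrableOn f (annulus R)) (t : ℝ) :
    ∫⁻ x, energyDensity R f t x ≤ 2 * ENNReal.ofReal (energyConst * R) * annulusMass R f := by
  have hf0 := integrableOn_gradMul_annulus hf 0
  have hf1 := integrableOn_gradMul_annulus hf 1
  have h := (continuous_blockWave_right hf t).measurable
  have h0 := (continuous_blockWave_right hf0 t).measurable
  have h1 := (continuous_blockWave_right hf1 t).measurable
  calc ∫⁻ x, energyDensity R f t x
      = ENNReal.ofReal (3 * R) * (∫⁻ x, ‖blockWave (annulus R) f t x‖ₑ ^ 2) +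
          ENNReal.ofReal (9 / R) * ((∫⁻ x, ‖blockWave (annulus R) (gradMul 0 f) t x‖ₑ ^ 2) +
            ∫⁻ x, ‖blockWave (annulus R) (gradMul 1 f) t x‖ₑ ^ 2) :=
        lintegral_mul_add_mul_add (by fun_prop) (by fun_prop) (by fun_prop) _ _
    _ ≤ ENNReal.ofReal (3 * R) * (2 * annulusMass R f) + ENNReal.ofReal (9 / R) *
          (2 * annulusMass R (gradMul 0 f) + 2 * annulusMass R (gradMul 1 f)) := by
        gcongr
        · exact lintegral_blockWave_sq_le hf t
        · exact lintegral_blockWave_sq_le hf0 t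
        · exact lintegral_blockWave_sq_le hf1 t
    _ = 2 * (ENNReal.ofReal (3 * R) * annulusMass R f + ENNReal.ofReal (9 / R) *
          (annulusMass R (gradMul 0 f) + annulusMass R (gradMul 1 f))) := by ring
    _ ≤ _ := by
        rw [mul_assoc]; gcongr; exact energy_mass_le hR

theorem lintegral_energyDensity_gauss_le (hR : 0 < R) (hf : IntegrableOn f (annulus R)) {τ : ℝ}
    (hτ : 0 < τ) :
    ∫⁻ t, ∫⁻ x, energyDensity R f t x ∂(gaussMeasure Plane τ) ≤
      2 * ENNReal.ofReal (min (Real.pi / τ) (4 * Real.pi * R / τ ^ 2)) *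
        (ENNReal.ofReal (energyConst * R) * annulusMass R f) := by
  have hf0 := integrableOn_gradMul_annulus hf 0
  have hf1 := integrableOn_gradMul_annulus hf 1
  have hfin := isFiniteMeasure_gaussMeasure (V := Plane) hτ
  set ν := gaussMeasure Plane τ
  set D := 2 * ENNReal.ofReal (min (Real.pi / τ) (4 * Real.pi * R / τ ^ 2))
  have hm : ∀ {g : Plane → ℂ}, IntegrableOn g (annulus R) →
      Measurable fun p : ℝ × Plane => ‖blockWave (annulus R) g p.1 p.2‖ₑ ^ 2 := fun hg =>
    (continuous_blockWave hg).measurable.enorm.pow_const 2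
  have hm' : ∀ {g : Plane → ℂ}, IntegrableOn g (annulus R) → ∀ t,
      Measurable fun x => ‖blockWave (annulus R) g t x‖ₑ ^ 2 := fun hg t =>
    (continuous_blockWave_right hg t).measurable.enorm.pow_const 2
  have hmi : ∀ {g : Plane → ℂ}, IntegrableOn g (annulus R) →
      Measurable fun t => ∫⁻ x, ‖blockWave (annulus R) g t x‖ₑ ^ 2 ∂ν := fun hg =>
    (hm hg).lintegral_prod_right'
  have e : ∀ t, ∫⁻ x, energyDensity R f t x ∂ν =
      ENNReal.ofReal (3 * R) * (∫⁻ x, ‖blockWave (annulus R) f t x‖ₑ ^ 2 ∂ν) +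
        ENNReal.ofReal (9 / R) * ((∫⁻ x, ‖blockWave (annulus R) (gradMul 0 f) t x‖ₑ ^ 2 ∂ν) +
          ∫⁻ x, ‖blockWave (annulus R) (gradMul 1 f) t x‖ₑ ^ 2 ∂ν) := by
    exact fun t => lintegral_mul_add_mul_add (hm' hf t) (hm' hf0 t) (hm' hf1 t) _ _
  simp only [e]
  rw [lintegral_mul_add_mul_add (hmi hf) (hmi hf0) (hmi hf1)]
  calc _ ≤ ENNReal.ofReal (3 * R) * (D * annulusMass R f) + ENNReal.ofReal (9 / R) *
        (D * annulusMass R (gradMul 0 f) + D * annulusMass R (gradMul 1 f)) := by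
        gcongr
        · exact lintegral_blockWave_gauss_le hR hf hτ
        · exact lintegral_blockWave_gauss_le hR hf0 hτ
        · exact lintegral_blockWave_gauss_le hR hf1 hτ
    _ = D * (ENNReal.ofReal (3 * R) * annulusMass R f + ENNReal.ofReal (9 / R) *
          (annulusMass R (gradMul 0 f) + annulusMass R (gradMul 1 f))) := by ring
    _ ≤ _ := by gcongr; exact energy_mass_le hR

/-- The square of the angular norm on the circle of radius `ρ`. -/
noncomputable def circleMass (u : Plane → ℂ) (ρ : ℝ) : ℝ≥0∞ :=
  ∫⁻ θ in Set.Ioo 0 (2 * Real.pi), ‖u (polar ρ θ)‖ₑ ^ 2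

theorem measurable_energyDensity_polar (hf : IntegrableOn f (annulus R)) (t : ℝ) :
    Measurable fun p : ℝ × ℝ => energyDensity R f t (polar p.1 p.2) :=
  Measurable.comp (g := fun p : ℝ × Plane => energyDensity R f p.1 p.2)
    (f := fun p : ℝ × ℝ => (t, polar p.1 p.2)) (measurable_energyDensity hf)
    (measurable_const.prodMk continuous_polar.measurable)

/-- The Sobolev inequality is applied on each ray over the length 1/R, the scale at which |u|² and
R⁻²|∇u|² balance, and is then integrated over the angle. -/
theorem circleMass_le_energy (hR : 0 < R) (hf : IntegrableOn f (annulus R)) (t ρ : ℝ) :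
    circleMass (blockWave (annulus R) f t) ρ ≤ ∫⁻ s in Set.Ioo ρ (ρ + 1 / R),
      ∫⁻ θ in Set.Ioo 0 (2 * Real.pi), energyDensity R f t (polar s θ) := by
  rw [lintegral_lintegral_swap (measurable_energyDensity_polar hf t).aemeasurable]
  refine lintegral_mono fun θ => ?_
  have hray : ∀ {g : Plane → ℂ}, IntegrableOn g (annulus R) →
      Continuous fun s => blockWave (annulus R) g t (polar s θ) := fun hg =>
    (continuous_blockWave_right hg t).comp (continuous_polar.comp (Continuous.prodMk_left θ))
  have hc0 := hray (integrableOn_gradMul_annulus hf 0)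
  have hc1 := hray (integrableOn_gradMul_annulus hf 1)
  refine (enorm_sq_le_lintegral_Ioo (fun s => hasDerivAt_blockWave_polar (measurableSet_annulus R)
    (fun _ => norm_le_of_mem_annulus) hf t s θ) (by fun_prop) ρ (one_div_pos.2 hR)).trans ?_
  refine lintegral_mono fun s => ?_
  -- The coefficient 9/R is 3/R from the Sobolev inequality times 3 from splitting the radial
  -- derivative into two partial derivatives.
  rw [energyDensity, show 3 / (1 / R) = 3 * R by field_simp, show 3 * (1 / R) = 3 / R by ring,
    show ENNReal.ofReal (9 / R) = ENNReal.ofReal (3 / R) * 3 by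
      rw [show (3 : ℝ≥0∞) = ENNReal.ofReal 3 by simp, ← ENNReal.ofReal_mul (by positivity)]
      congr 1; ring, mul_assoc]
  gcongr
  have hle : ∀ (c : ℝ) (z : ℂ), |c| ≤ 1 → ‖(c : ℂ) * z‖ₑ ≤ ‖z‖ₑ := by
    intro c z hc
    rw [← ofReal_norm, ← ofReal_norm, norm_mul, Complex.norm_real]
    exact ENNReal.ofReal_le_ofReal (mul_le_of_le_one_left (norm_nonneg _) hc)
  calc _ ≤ (‖blockWave (annulus R) (gradMul 0 f) t (polar s θ)‖ₑ +
        ‖blockWave (annulus R) (gradMul 1 f) t (polar s θ)‖ₑ) ^ 2 :=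
        pow_le_pow_left' ((enorm_add_le _ _).trans (add_le_add
          (hle _ _ (Real.abs_cos_le_one θ)) (hle _ _ (Real.abs_sin_le_one θ)))) 2
    _ ≤ _ := by rw [mul_add]; exact add_sq_le_three _ _

end

/-! ### Angular norms -/

theorem angularNorm_eq (u : Plane → ℂ) (ρ : ℝ) :
    angularNorm u ρ = circleMass u ρ ^ (1 / 2 : ℝ) := by
  rw [angularNorm, eLpNorm_eq_lintegral_rpow_enorm_toReal (by norm_num) (by norm_num), circleMass]
  simp [polar]

theorem measurable_circleMass {u : Plane → ℂ} (hu : Measurable u) :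
    Measurable (circleMass u) := by
  have h : Measurable fun q : ℝ × ℝ => ‖u (polar q.1 q.2)‖ₑ ^ 2 :=
    (hu.comp continuous_polar.measurable).enorm.pow_const 2
  exact h.lintegral_prod_right'

theorem measurable_angularNorm {u : Plane → ℂ} (hu : Measurable u) :
    Measurable (angularNorm u) := by
  have : angularNorm u = fun ρ => circleMass u ρ ^ (1 / 2 : ℝ) := funext (angularNorm_eq u)
  rw [this]
  exact (measurable_circleMass hu).pow_const _

theorem lintegral_radialMeasure {g : ℝ → ℝ≥0∞} (hg : Measurable g) :
    ∫⁻ ρ, g ρ ∂radialMeasure = ∫⁻ ρ in Set.Ioi (0 : ℝ), ENNReal.ofReal ρ * g ρ := by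
  rw [radialMeasure, lintegral_withDensity_eq_lintegral_mul _ (by fun_prop) hg]
  rfl

theorem ae_radialMeasure_pos : ∀ᵐ ρ ∂radialMeasure, 0 < ρ :=
  (withDensity_absolutelyContinuous _ _).ae_le (ae_restrict_mem measurableSet_Ioi)

theorem lintegral_angularNorm_sq {u : Plane → ℂ} (hu : Measurable u) :
    ∫⁻ ρ, angularNorm u ρ ^ 2 ∂radialMeasure = ∫⁻ x, ‖u x‖ₑ ^ 2 := by
  rw [lintegral_radialMeasure ((measurable_angularNorm hu).pow_const 2),
    lintegral_polar (hu.enorm.pow_const 2)]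
  refine lintegral_congr fun ρ => ?_
  have hpol : Measurable (polar ρ) :=
    (continuous_polar.comp (Continuous.prodMk_right ρ)).measurable
  have hm : Measurable fun θ => ‖u (polar ρ θ)‖ₑ ^ 2 := (hu.comp hpol).enorm.pow_const 2
  rw [lintegral_const_mul _ hm, angularNorm_eq, rpow_half_sq]
  rfl

theorem circleMass_le_of_bound {u : Plane → ℂ} {B : ℝ≥0∞} (h : ∀ x, ‖u x‖ₑ ^ 2 ≤ B) (ρ : ℝ) :
    circleMass u ρ ≤ ENNReal.ofReal (2 * Real.pi) * B := by
  calc _ ≤ ∫⁻ _ in Set.Ioo 0 (2 * Real.pi), B := lintegral_mono fun θ => h _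
    _ = _ := by rw [setLIntegral_const, Real.volume_Ioo, sub_zero, mul_comm]

/-- Interpolation between L² and L^∞ through h^r ≤ h² H^(r-2). -/
theorem eLpNorm_le_rpow_mul_rpow {X : Type*} [MeasurableSpace X] {μ : Measure X} {h : X → ℝ≥0∞}
    (hm : AEMeasurable h μ) {H : ℝ≥0∞} (hH : ∀ᵐ x ∂μ, h x ≤ H) {r : ℝ≥0∞} (hr : 2 ≤ r) :
    eLpNorm h r μ ≤ H ^ (1 - 2 * (r⁻¹).toReal) * (∫⁻ x, h x ^ 2 ∂μ) ^ (r⁻¹).toReal := by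
  rcases eq_or_ne r ∞ with rfl | hrt
  · simp only [ENNReal.inv_top, ENNReal.toReal_zero, mul_zero, sub_zero, ENNReal.rpow_one,
      ENNReal.rpow_zero, mul_one, eLpNorm_exponent_top]
    exact eLpNormEssSup_le_of_ae_enorm_bound hH
  · have hr0 : r ≠ 0 := (zero_lt_two.trans_le hr).ne'
    have h2 : 2 ≤ r.toReal := by
      simpa using ENNReal.toReal_mono hrt hr
    have hpos : 0 < r.toReal := by linarith
    rw [eLpNorm_eq_lintegral_rpow_enorm_toReal hr0 hrt]
    simp only [enorm_eq_self, ENNReal.toReal_inv]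
    calc (∫⁻ x, h x ^ r.toReal ∂μ) ^ (1 / r.toReal)
        ≤ (∫⁻ x, h x ^ 2 * H ^ (r.toReal - 2) ∂μ) ^ (1 / r.toReal) := by
          gcongr ?_ ^ _
          refine lintegral_mono_ae ?_
          filter_upwards [hH] with x hx
          have := ENNReal_rpow_mul_rpow_le_rpow hx zero_le_two h2
          rwa [ENNReal.rpow_two] at this
      _ = ((∫⁻ x, h x ^ 2 ∂μ) * H ^ (r.toReal - 2)) ^ (1 / r.toReal) := by
          rw [lintegral_mul_const'' _ (hm.pow_const 2)]
      _ = _ := by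
          rw [ENNReal.mul_rpow_of_nonneg _ _ (by positivity), ← ENNReal.rpow_mul, mul_comm,
            one_div]
          congr 2
          field_simp

/-! ### The half-wave with frequencies in an annulus -/

theorem volume_annulus_le {R : ℝ} (hR : 0 < R) :
    volume (annulus R) ≤ ENNReal.ofReal (4 * Real.pi * R ^ 2) := by
  calc volume (annulus R) ≤ volume (Metric.ball (0 : Plane) (2 * R)) :=
        measure_mono fun ξ hξ => by simpa using hξ.2
    _ = _ := by
        rw [EuclideanSpace.volume_ball_fin_two, ← ENNReal.ofReal_pow (by positivity),
          ← NNReal.coe_real_pi, ← ENNReal.ofReal_mul (by positivity)]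
        congr 1; ring

section

variable {R : ℝ} {f : Plane → ℂ}

/-- Bernstein's inequality: Cauchy–Schwarz in frequency on a set of area at most 4πR². -/
theorem enorm_blockWave_annulus_sq_le (hR : 0 < R) (hf : IntegrableOn f (annulus R)) (t : ℝ)
    (x : Plane) :
    ‖blockWave (annulus R) f t x‖ₑ ^ 2 ≤ ENNReal.ofReal (4 * Real.pi * R ^ 2) * annulusMass R f := by
  refine (pow_le_pow_left' (enorm_blockWave_le _ _ _ _) 2).trans
    ((sq_lintegral_enorm_le hf.1).trans ?_)
  rw [Measure.restrict_apply_univ]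
  exact mul_le_mul' (volume_annulus_le hR) le_rfl

theorem circleMass_annulus_le (hR : 0 < R) (hf : IntegrableOn f (annulus R)) (t ρ : ℝ) :
    circleMass (blockWave (annulus R) f t) ρ ≤
      ENNReal.ofReal (8 * Real.pi ^ 2 * R ^ 2) * annulusMass R f := by
  refine (circleMass_le_of_bound (enorm_blockWave_annulus_sq_le hR hf t) ρ).trans (le_of_eq ?_)
  rw [← mul_assoc, ← ENNReal.ofReal_mul (by positivity)]
  congr 2; ring

theorem angularNorm_annulus_le (hR : 0 < R) (hf : IntegrableOn f (annulus R)) (t ρ : ℝ) :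
    angularNorm (blockWave (annulus R) f t) ρ ≤
      ENNReal.ofReal (3 * Real.pi) * ENNReal.ofReal R * annulusMass R f ^ (1 / 2 : ℝ) := by
  rw [angularNorm_eq]
  refine (ENNReal.rpow_le_rpow (circleMass_annulus_le hR hf t ρ) (by norm_num)).trans ?_
  rw [ENNReal.mul_rpow_of_nonneg _ _ (by norm_num), ← ENNReal.ofReal_mul (by positivity)]
  gcongr
  rw [ENNReal.ofReal_rpow_of_nonneg (by positivity) (by norm_num), ← Real.sqrt_eq_rpow]
  refine ENNReal.ofReal_le_ofReal (Real.sqrt_le_iff.2 ⟨by positivity, ?_⟩)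
  nlinarith [sq_nonneg (Real.pi * R)]

/-! ### Bounds on circles by weighted energies, and the time integral of the weighted energy. -/

theorem measurable_energyDensity_right (hf : IntegrableOn f (annulus R)) (t : ℝ) :
    Measurable (energyDensity R f t) :=
  Measurable.comp (g := fun p : ℝ × Plane => energyDensity R f p.1 p.2)
    (f := fun x : Plane => (t, x)) (measurable_energyDensity hf) measurable_prodMk_left

/-- The space integral of the energy density with the weight `|x|^{-1-δ}`. -/
noncomputable def weightedEnergy (δ R : ℝ) (f : Plane → ℂ) (t : ℝ) : ℝ≥0∞ :=
  ∫⁻ x, ENNReal.ofReal (‖x‖ ^ (-(1 + δ))) * energyDensity R f t x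

theorem measurable_weightedEnergy (δ : ℝ) (hf : IntegrableOn f (annulus R)) :
    Measurable (weightedEnergy δ R f) := by
  have h : Measurable fun p : ℝ × Plane => ENNReal.ofReal (‖p.2‖ ^ (-(1 + δ))) *
      energyDensity R f p.1 p.2 :=
    (by fun_prop : Measurable fun p : ℝ × Plane => ENNReal.ofReal (‖p.2‖ ^ (-(1 + δ)))).mul
      (measurable_energyDensity hf)
  exact h.lintegral_prod_right'

/-- The left side lacks the Jacobian s of polar coordinates; c is the price for inserting both it
and the weight. -/
theorem lintegral_shell_le {e : Plane → ℝ≥0∞} (he : Measurable e) {w : ℝ → ℝ≥0∞}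
    (hw : Measurable w) {a b : ℝ} (ha : 0 ≤ a) {c : ℝ≥0∞}
    (h : ∀ s ∈ Set.Ioo a b, 1 ≤ c * (ENNReal.ofReal s * w s)) :
    ∫⁻ s in Set.Ioo a b, ∫⁻ θ in Set.Ioo 0 (2 * Real.pi), e (polar s θ) ≤
      c * ∫⁻ x, w ‖x‖ * e x := by
  have hpol := continuous_polar.measurable
  have hm : Measurable fun p : ℝ × ℝ =>
      ENNReal.ofReal p.1 * (w ‖polar p.1 p.2‖ * e (polar p.1 p.2)) := by fun_prop
  rw [lintegral_polar (by fun_prop), ← lintegral_const_mul _ hm.lintegral_prod_right']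
  calc _ ≤ ∫⁻ s in Set.Ioo a b, c * ∫⁻ θ in Set.Ioo 0 (2 * Real.pi),
        ENNReal.ofReal s * (w ‖polar s θ‖ * e (polar s θ)) := by
        refine setLIntegral_mono' measurableSet_Ioo fun s hs => ?_
        have hms : Measurable fun θ => ENNReal.ofReal s * (w ‖polar s θ‖ * e (polar s θ)) :=
          hm.comp measurable_prodMk_left
        rw [← lintegral_const_mul _ hms]
        refine lintegral_mono fun θ => ?_
        rw [norm_polar (ha.trans hs.1.le), ← mul_assoc (ENNReal.ofReal s), ← mul_assoc c]
        exact le_mul_of_one_le_left' (h s hs)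
    _ ≤ _ := lintegral_mono_set fun s hs => lt_of_le_of_lt ha hs.1

theorem circleMass_le_weightedEnergy (hR : 0 < R) (hf : IntegrableOn f (annulus R)) {δ : ℝ}
    (hδ : 0 < δ) (t : ℝ) {ρ : ℝ} (hρ : 0 < ρ) :
    circleMass (blockWave (annulus R) f t) ρ ≤
      ENNReal.ofReal (ρ + 1 / R) ^ δ * weightedEnergy δ R f t := by
  have hX : 0 < ρ + 1 / R := by positivity
  refine (circleMass_le_energy hR hf t ρ).trans ?_
  refine lintegral_shell_le (e := energyDensity R f t)
    (w := fun s => ENNReal.ofReal (s ^ (-(1 + δ))))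
    (measurable_energyDensity_right hf t) (by fun_prop) hρ.le fun s hs => ?_
  have hs0 : 0 < s := hρ.trans hs.1
  rw [ENNReal.ofReal_rpow_of_pos hX, ← ENNReal.ofReal_mul hs0.le,
    ← ENNReal.ofReal_mul (by positivity), ENNReal.one_le_ofReal]
  have e1 : s * s ^ (-(1 + δ)) = (s ^ δ)⁻¹ := by
    rw [neg_add, Real.rpow_add hs0, Real.rpow_neg hs0.le, Real.rpow_neg hs0.le, Real.rpow_one]
    field_simp
  rw [e1, ← div_eq_mul_inv, one_le_div (by positivity)]
  exact Real.rpow_le_rpow hs0.le hs.2.le hδ.le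

/-- The decay constant in `F(ρ)(ρ + 1/R) ≤ C R ‖f‖²`. -/
theorem circleMass_mul_le (hR : 0 < R) (hf : IntegrableOn f (annulus R)) (t : ℝ) {ρ : ℝ}
    (hρ : 0 < ρ) :
    circleMass (blockWave (annulus R) f t) ρ * ENNReal.ofReal (ρ + 1 / R) ≤
      ENNReal.ofReal (4 * energyConst * R) * annulusMass R f := by
  have hX : 0 < ρ + 1 / R := by positivity
  have hE := energyConst_pos
  rcases le_total (1 / R) ρ with h | h
  -- Far from the origin ρ is at least half of ρ + 1/R, so restoring the Jacobian costs 2/(ρ + 1/R),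
  -- and the unweighted energy is bounded at each time.
  · have h1 := (circleMass_le_energy hR hf t ρ).trans
      (lintegral_shell_le (e := energyDensity R f t) (w := fun _ => 1)
        (c := ENNReal.ofReal (2 / (ρ + 1 / R)))
        (measurable_energyDensity_right hf t) measurable_const hρ.le
        fun s hs => by
          rw [mul_one, ← ENNReal.ofReal_mul (by positivity), ENNReal.one_le_ofReal, div_mul_eq_mul_div,
            one_le_div hX]
          linarith [hs.1])
    simp only [one_mul] at h1
    calc _ ≤ ENNReal.ofReal (2 / (ρ + 1 / R)) * (2 * ENNReal.ofReal (energyConst * R) *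
            annulusMass R f) * ENNReal.ofReal (ρ + 1 / R) := by
          gcongr
          exact h1.trans (mul_le_mul' le_rfl (lintegral_energyDensity_le hR hf t))
      _ = (ENNReal.ofReal (2 / (ρ + 1 / R)) * ENNReal.ofReal (ρ + 1 / R)) *
            (2 * ENNReal.ofReal (energyConst * R)) * annulusMass R f := by ring
      _ = _ := by
          rw [show (2 : ℝ≥0∞) = ENNReal.ofReal 2 by simp, ← ENNReal.ofReal_mul (by positivity),
            ← ENNReal.ofReal_mul (by positivity), ← ENNReal.ofReal_mul (by positivity)]
          congr 2; field_simp; ring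
  -- Within one wavelength of the origin Bernstein's inequality suffices, as ρ + 1/R ≤ 2/R.
  · calc _ ≤ ENNReal.ofReal (8 * Real.pi ^ 2 * R ^ 2) * annulusMass R f *
            ENNReal.ofReal (2 / R) := by
          refine mul_le_mul' (circleMass_annulus_le hR hf t ρ) (ENNReal.ofReal_le_ofReal ?_)
          rw [show 2 / R = 1 / R + 1 / R by ring]; linarith
      _ = ENNReal.ofReal (16 * Real.pi ^ 2 * R) * annulusMass R f := by
          rw [mul_right_comm, ← ENNReal.ofReal_mul (by positivity)]
          congr 2; field_simp; ring
      _ ≤ _ := by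
          gcongr ENNReal.ofReal (?_ * R) * _
          rw [energyConst]; nlinarith [sq_nonneg Real.pi]

/-- One factor F is bounded through the weighted energy and F^δ through the decay in ρ. The powers
of ρ + 1/R cancel, so the bound is uniform in ρ and depends on time only through an integrable
function. -/
theorem circleMass_rpow_le (hR : 0 < R) (hf : IntegrableOn f (annulus R)) {δ : ℝ}
    (hδ : 0 < δ) (t : ℝ) {ρ : ℝ} (hρ : 0 < ρ) :
    circleMass (blockWave (annulus R) f t) ρ ^ (1 + δ) ≤
      weightedEnergy δ R f t * (ENNReal.ofReal (4 * energyConst * R) * annulusMass R f) ^ δ := by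
  have hX : 0 < ρ + 1 / R := by positivity
  have h1 := circleMass_le_weightedEnergy hR hf hδ t hρ
  have h2 := circleMass_mul_le hR hf t hρ
  set F := circleMass (blockWave (annulus R) f t) ρ
  set M := ENNReal.ofReal (4 * energyConst * R) * annulusMass R f
  set X := ENNReal.ofReal (ρ + 1 / R) with hXdef
  have hX0 : X ≠ 0 := by rw [hXdef]; simpa using hX
  have hXt : X ≠ ∞ := ENNReal.ofReal_ne_top
  clear_value F M X
  have h3 : F ≤ M * X⁻¹ := by
    rw [← div_eq_mul_inv]
    exact (ENNReal.le_div_iff_mul_le (Or.inl hX0) (Or.inl hXt)).2 h2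
  calc F ^ (1 + δ) = F * F ^ δ := by
        rw [ENNReal.rpow_add_of_nonneg _ _ zero_le_one hδ.le, ENNReal.rpow_one]
    _ ≤ (X ^ δ * weightedEnergy δ R f t) * (M * X⁻¹) ^ δ := by gcongr
    _ = (X * X⁻¹) ^ δ * (weightedEnergy δ R f t * M ^ δ) := by
        rw [ENNReal.mul_rpow_of_nonneg _ _ hδ.le, ENNReal.mul_rpow_of_nonneg _ _ hδ.le]; ring
    _ = _ := by rw [ENNReal.mul_inv_cancel hX0 hXt, ENNReal.one_rpow, one_mul]

/-- The integral is split at τ = R. Convergence at 0 needs δ > 0 and convergence at infinity needs δ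
< 1. -/
theorem lintegral_min_rpow_le (hR : 0 < R) {δ : ℝ} (hδ : 0 < δ) (hδ1 : δ < 1) :
    ∫⁻ τ in Set.Ioi (0 : ℝ), ENNReal.ofReal (τ ^ δ) *
      ENNReal.ofReal (min (Real.pi / τ) (4 * Real.pi * R / τ ^ 2)) ≤
        ENNReal.ofReal ((Real.pi / δ + 4 * Real.pi / (1 - δ)) * R ^ δ) := by
  have h1δ : 0 < 1 - δ := by linarith
  have hlow : ∫⁻ τ in Set.Ioc 0 R, ENNReal.ofReal (Real.pi * τ ^ (δ - 1)) =
      ENNReal.ofReal (Real.pi / δ * R ^ δ) := by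
    have hi : IntegrableOn (fun τ : ℝ => Real.pi * τ ^ (δ - 1)) (Set.Ioc 0 R) :=
      ((intervalIntegrable_iff_integrableOn_Ioc_of_le hR.le).1
        (intervalIntegral.intervalIntegrable_rpow' (by linarith))).const_mul _
    rw [← ofReal_integral_eq_lintegral_ofReal hi
      ((ae_restrict_iff' measurableSet_Ioc).2 (ae_of_all _ fun τ hτ => by
        have := hτ.1; simp only [Pi.zero_apply]; positivity)),
      ← intervalIntegral.integral_of_le hR.le, intervalIntegral.integral_const_mul,
      integral_rpow (Or.inl (by linarith))]
    congr 1
    rw [sub_add_cancel, Real.zero_rpow hδ.ne']; ring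
  have hhigh : ∫⁻ τ in Set.Ioi R, ENNReal.ofReal (4 * Real.pi * R * τ ^ (δ - 2)) =
      ENNReal.ofReal (4 * Real.pi / (1 - δ) * R ^ δ) := by
    have hi : IntegrableOn (fun τ : ℝ => 4 * Real.pi * R * τ ^ (δ - 2)) (Set.Ioi R) :=
      (integrableOn_Ioi_rpow_of_lt (by linarith) hR).const_mul _
    rw [← ofReal_integral_eq_lintegral_ofReal hi
      ((ae_restrict_iff' measurableSet_Ioi).2 (ae_of_all _ fun τ hτ => by
        have : 0 < τ := hR.trans hτ
        simp only [Pi.zero_apply]; positivity)),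
      integral_const_mul, integral_Ioi_rpow_of_lt (by linarith) hR]
    congr 1
    have : R ^ δ = R * R ^ (δ - 2 + 1) := by
      rw [show δ - 2 + 1 = δ - 1 by ring, Real.rpow_sub_one hR.ne']; field_simp
    rw [this]
    have h3 : δ - 2 + 1 ≠ 0 := by linarith
    have h4 : 1 - δ ≠ 0 := h1δ.ne'
    rw [show δ - 2 + 1 = -(1 - δ) by ring] at h3 ⊢
    field_simp
  rw [← Set.Ioc_union_Ioi_eq_Ioi hR.le, lintegral_union measurableSet_Ioi
    (Set.disjoint_left.2 fun x hx hx' => not_lt.2 hx.2 hx')]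
  have hsum : ENNReal.ofReal ((Real.pi / δ + 4 * Real.pi / (1 - δ)) * R ^ δ) =
      ENNReal.ofReal (Real.pi / δ * R ^ δ) + ENNReal.ofReal (4 * Real.pi / (1 - δ) * R ^ δ) := by
    rw [← ENNReal.ofReal_add (by positivity) (by positivity), add_mul]
  rw [hsum, ← hlow, ← hhigh]
  refine add_le_add (setLIntegral_mono' measurableSet_Ioc fun τ hτ => ?_)
    (setLIntegral_mono' measurableSet_Ioi fun τ hτ => ?_)
  · have h0 := hτ.1
    rw [← ENNReal.ofReal_mul (by positivity), Real.rpow_sub_one h0.ne']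
    refine ENNReal.ofReal_le_ofReal ?_
    calc τ ^ δ * min (Real.pi / τ) (4 * Real.pi * R / τ ^ 2) ≤ τ ^ δ * (Real.pi / τ) := by
          gcongr; exact min_le_left _ _
      _ = _ := by ring
  · have h0 : 0 < τ := hR.trans hτ
    rw [← ENNReal.ofReal_mul (by positivity), Real.rpow_sub h0, Real.rpow_two]
    refine ENNReal.ofReal_le_ofReal ?_
    calc τ ^ δ * min (Real.pi / τ) (4 * Real.pi * R / τ ^ 2)
        ≤ τ ^ δ * (4 * Real.pi * R / τ ^ 2) := by
          gcongr; exact min_le_right _ _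
      _ = _ := by ring

/-- `|x|^{-1-δ}` is dominated by a superposition of Gaussians. -/
theorem rpow_neg_le_lintegral_gauss {δ : ℝ} (hδ : 0 < δ) (hδ1 : δ < 1) {r : ℝ} (hr : 0 < r) :
    ENNReal.ofReal (r ^ (-(1 + δ))) ≤ ENNReal.ofReal (4 * Real.exp Real.pi) *
      ∫⁻ τ in Set.Ioi (0 : ℝ), ENNReal.ofReal (τ ^ δ) *
        ENNReal.ofReal (Real.exp (-(Real.pi * τ ^ 2) * r ^ 2)) := by
  -- Only τ comparable to 1/r is kept: there the Gaussian is at least e^(-π), and the interval has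
  -- length 1/(2r).
  have hsub : ∫⁻ _ in Set.Ioo (1 / (2 * r)) (1 / r),
      ENNReal.ofReal ((1 / (2 * r)) ^ δ * Real.exp (-Real.pi)) ≤
      ∫⁻ τ in Set.Ioi (0 : ℝ), ENNReal.ofReal (τ ^ δ) *
        ENNReal.ofReal (Real.exp (-(Real.pi * τ ^ 2) * r ^ 2)) := by
    refine (setLIntegral_mono' measurableSet_Ioo fun τ hτ => ?_).trans
      (lintegral_mono_set fun τ hτ => lt_trans (by positivity : 0 < 1 / (2 * r)) hτ.1)
    have h0 : 0 < τ := lt_trans (by positivity : 0 < 1 / (2 * r)) hτ.1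
    rw [← ENNReal.ofReal_mul (by positivity)]
    refine ENNReal.ofReal_le_ofReal (mul_le_mul ?_ (Real.exp_le_exp.2 ?_) (Real.exp_pos _).le
      (by positivity))
    · exact Real.rpow_le_rpow (by positivity) hτ.1.le hδ.le
    · have h1 : τ * r ≤ 1 := ((lt_div_iff₀ hr).1 hτ.2).le
      have h2 : (τ * r) ^ 2 ≤ 1 := pow_le_one₀ (by positivity) h1
      have := Real.pi_pos
      nlinarith
  refine le_trans ?_ (mul_le_mul' le_rfl hsub)
  rw [setLIntegral_const, Real.volume_Ioo, ← ENNReal.ofReal_mul (by positivity),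
    ← ENNReal.ofReal_mul (by positivity)]
  refine ENNReal.ofReal_le_ofReal ?_
  have e1 : (1 / (2 * r)) ^ δ = 2 ^ (-δ) * r ^ (-δ) := by
    rw [one_div, Real.inv_rpow (by positivity), ← Real.rpow_neg (by positivity),
      Real.mul_rpow (by norm_num) hr.le]
  have e2 : r ^ (-(1 + δ)) = r⁻¹ * r ^ (-δ) := by
    rw [neg_add, Real.rpow_add hr, Real.rpow_neg_one]
  have e3 : (2 : ℝ)⁻¹ ≤ 2 ^ (-δ) := by
    rw [← Real.rpow_neg_one]
    exact Real.rpow_le_rpow_of_exponent_le (by norm_num) (by linarith)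
  rw [e1, e2, Real.exp_neg]
  have e4 : 1 / r - 1 / (2 * r) = r⁻¹ / 2 := by field_simp; ring
  rw [e4]
  have hexp := Real.exp_pos Real.pi
  have hrr : 0 < r ^ (-δ) := by positivity
  have e5 : 4 * Real.exp Real.pi * (2 ^ (-δ) * r ^ (-δ) * (Real.exp Real.pi)⁻¹ * (r⁻¹ / 2)) =
      2 * 2 ^ (-δ) * (r⁻¹ * r ^ (-δ)) := by field_simp; ring
  rw [e5]
  exact le_mul_of_one_le_left (by positivity) (by linarith)

/-- The singular weight is replaced by Gaussians; Tonelli moves the integral over τ outside, and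
local energy decay is applied for each τ. -/
theorem lintegral_weightedEnergy_le {δ : ℝ} (hδ : 0 < δ) (hδ1 : δ < 1) :
    ∃ C : ℝ≥0, ∀ {R : ℝ} {f : Plane → ℂ}, 0 < R → IntegrableOn f (annulus R) →
      ∫⁻ t, weightedEnergy δ R f t ≤ C * ENNReal.ofReal R ^ (1 + δ) * annulusMass R f := by
  have h1δ : 0 < 1 - δ := by linarith
  have hE := energyConst_pos
  have hpi := Real.pi_pos
  set c₁ := 4 * Real.exp Real.pi with hc1
  set c₂ := Real.pi / δ + 4 * Real.pi / (1 - δ) with hc2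
  refine ⟨(c₁ * (c₂ * 2 * energyConst)).toNNReal, fun {R f} hR hf => ?_⟩
  have he := measurable_energyDensity hf
  have het : ∀ t, Measurable (energyDensity R f t) := measurable_energyDensity_right hf
  set G : ℝ → Plane → ℝ → ℝ≥0∞ := fun t x τ => ENNReal.ofReal (τ ^ δ) *
    (ENNReal.ofReal (Real.exp (-(Real.pi * τ ^ 2) * ‖x‖ ^ 2)) * energyDensity R f t x) with hG
  have hGm : Measurable fun p : (ℝ × ℝ) × Plane => G p.1.1 p.2 p.1.2 := by
    have h1 : Measurable fun p : (ℝ × ℝ) × Plane => energyDensity R f p.1.1 p.2 :=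
      Measurable.comp (g := fun q : ℝ × Plane => energyDensity R f q.1 q.2)
        (f := fun p : (ℝ × ℝ) × Plane => (p.1.1, p.2)) he
        ((measurable_fst.comp measurable_fst).prodMk measurable_snd)
    simp only [hG]
    fun_prop
  have hpt : ∀ t, weightedEnergy δ R f t ≤ ENNReal.ofReal c₁ *
      ∫⁻ τ in Set.Ioi (0 : ℝ), ∫⁻ x, G t x τ := by
    intro t
    have hGt : Measurable (Function.uncurry (G t)) :=
      Measurable.comp (g := fun p : (ℝ × ℝ) × Plane => G p.1.1 p.2 p.1.2)
        (f := fun q : Plane × ℝ => ((t, q.2), q.1)) hGm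
        ((measurable_const.prodMk measurable_snd).prodMk measurable_fst)
    have hGi : Measurable fun x => ∫⁻ τ in Set.Ioi (0 : ℝ), G t x τ := hGt.lintegral_prod_right'
    rw [← lintegral_lintegral_swap hGt.aemeasurable, ← lintegral_const_mul _ hGi]
    refine lintegral_mono_ae ?_
    have h0 : ∀ᵐ x : Plane, x ≠ 0 := by simp [ae_iff]
    filter_upwards [h0] with x hx
    simp only [hG, ← mul_assoc]
    rw [lintegral_mul_const _ (by fun_prop), ← mul_assoc]
    gcongr
    exact rpow_neg_le_lintegral_gauss hδ hδ1 (norm_pos_iff.2 hx)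
  calc ∫⁻ t, weightedEnergy δ R f t
      ≤ ∫⁻ t, ENNReal.ofReal c₁ * ∫⁻ τ in Set.Ioi (0 : ℝ), ∫⁻ x, G t x τ := lintegral_mono hpt
    _ = ENNReal.ofReal c₁ * ∫⁻ τ in Set.Ioi (0 : ℝ), ∫⁻ t, ∫⁻ x, G t x τ := by
        have h2 : Measurable fun p : ℝ × ℝ => ∫⁻ x, G p.1 x p.2 := hGm.lintegral_prod_right'
        rw [lintegral_const_mul _ h2.lintegral_prod_right',
          lintegral_lintegral_swap h2.aemeasurable]
    _ ≤ ENNReal.ofReal c₁ * ∫⁻ τ in Set.Ioi (0 : ℝ), ENNReal.ofReal (τ ^ δ) *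
          ENNReal.ofReal (min (Real.pi / τ) (4 * Real.pi * R / τ ^ 2)) *
            (2 * (ENNReal.ofReal (energyConst * R) * annulusMass R f)) := by
        gcongr ENNReal.ofReal c₁ * ?_
        refine setLIntegral_mono' measurableSet_Ioi fun τ (hτ : 0 < τ) => ?_
        have e1 : ∀ t, ∫⁻ x, G t x τ =
            ENNReal.ofReal (τ ^ δ) * ∫⁻ x, energyDensity R f t x ∂(gaussMeasure Plane τ) := by
          intro t
          simp only [hG]
          rw [lintegral_const_mul' _ _ ENNReal.ofReal_ne_top, lintegral_gaussMeasure (het t)]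
        simp only [e1]
        rw [lintegral_const_mul' _ _ ENNReal.ofReal_ne_top]
        refine (mul_le_mul' le_rfl (lintegral_energyDensity_gauss_le hR hf hτ)).trans (le_of_eq ?_)
        ring
    _ ≤ ENNReal.ofReal c₁ * (ENNReal.ofReal (c₂ * R ^ δ) *
          (2 * (ENNReal.ofReal (energyConst * R) * annulusMass R f))) := by
        rw [lintegral_mul_const _ (by fun_prop)]
        gcongr
        exact lintegral_min_rpow_le hR hδ hδ1
    _ = _ := by
        rw [← ENNReal.ofReal.eq_1, ENNReal.ofReal_rpow_of_pos hR,
          show (2 : ℝ≥0∞) = ENNReal.ofReal 2 by simp]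
        simp only [← mul_assoc]
        rw [← ENNReal.ofReal_mul (by positivity), ← ENNReal.ofReal_mul (by positivity),
          ← ENNReal.ofReal_mul (by positivity), ← ENNReal.ofReal_mul (by positivity)]
        congr 2
        rw [Real.rpow_add hR, Real.rpow_one]
        ring

end

/-! ### Strichartz estimates for frequencies in an annulus -/

theorem measurable_blockWave {A : Set Plane} {f : Plane → ℂ} (hf : IntegrableOn f A) (t : ℝ) :
    Measurable (blockWave A f t) :=
  (continuous_blockWave_right hf t).measurable

theorem inv_toReal_lt_half {r : ℝ≥0∞} (hr : 2 < r) : (r⁻¹).toReal < 1 / 2 := by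
  have h : r⁻¹ < 2⁻¹ := ENNReal.inv_lt_inv.2 hr
  have := (ENNReal.toReal_lt_toReal (by simpa using (zero_lt_two.trans hr).ne') (by simp)).2 h
  simpa using this

/-- The half-wave at frequency `R`, with one time exponent `s` for which the estimate is not
trivial. The majorant `a` only serves measurability in time. -/
theorem exists_majorant_radialAngularNorm {r : ℝ≥0∞} (hr : 2 < r) {s : ℝ}
    (hs : 2 < s * (1 - 2 * (r⁻¹).toReal)) (hs' : s * (1 - 2 * (r⁻¹).toReal) < 4) :
    ∃ C : ℝ≥0, 1 ≤ C ∧ ∀ {R : ℝ} {f : Plane → ℂ}, 0 < R → IntegrableOn f (annulus R) →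
      ∃ a : ℝ → ℝ≥0∞, Measurable a ∧
        (∀ t, radialAngularNorm r (blockWave (annulus R) f t) ≤ a t) ∧
        (∀ t, a t ≤ C * ENNReal.ofReal R ^ (1 - 2 * (r⁻¹).toReal) *
          annulusMass R f ^ (1 / 2 : ℝ)) ∧
        ∫⁻ t, a t ^ s ≤ C * ENNReal.ofReal R ^ (s * (1 - 2 * (r⁻¹).toReal) - 1) *
          annulusMass R f ^ (s / 2) := by
  set i := (r⁻¹).toReal with hi
  have hi0 : 0 ≤ i := ENNReal.toReal_nonneg
  have hi2 : i < 1 / 2 := inv_toReal_lt_half hr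
  set κ := 1 - 2 * i with hκ
  have hκ0 : 0 < κ := by linarith
  have hs0 : 0 < s := by
    by_contra h
    nlinarith [not_lt.1 h]
  -- This makes the angular norm to the power sκ equal to F^(1+δ); the hypotheses on sκ say exactly
  -- that 0 < δ < 1.
  set δ := s * κ / 2 - 1 with hδ
  have hδ0 : 0 < δ := by linarith
  have hδ1 : δ < 1 := by linarith
  set σ := s * κ with hσ
  have hσ0 : 0 < σ := by linarith
  obtain ⟨C₀, hC₀⟩ := lintegral_weightedEnergy_le hδ0 hδ1
  have hE := energyConst_pos
  set A : ℝ≥0∞ := ENNReal.ofReal (3 * Real.pi) ^ κ * 2 ^ i with hA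
  set B : ℝ≥0∞ := C₀ * ENNReal.ofReal (4 * energyConst) ^ δ * 2 ^ (i * s) with hB
  have hAt : A ≠ ∞ := ENNReal.mul_ne_top
    (ENNReal.rpow_ne_top_of_nonneg hκ0.le ENNReal.ofReal_ne_top)
    (ENNReal.rpow_ne_top_of_nonneg hi0 ENNReal.ofNat_ne_top)
  have hBt : B ≠ ∞ := ENNReal.mul_ne_top (ENNReal.mul_ne_top ENNReal.coe_ne_top
    (ENNReal.rpow_ne_top_of_nonneg hδ0.le ENNReal.ofReal_ne_top))
    (ENNReal.rpow_ne_top_of_nonneg (by positivity) ENNReal.ofNat_ne_top)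
  refine ⟨A.toNNReal + B.toNNReal + 1, le_add_self, fun {R f} hR hf => ?_⟩
  have hcoe : ((A.toNNReal + B.toNNReal + 1 : ℝ≥0) : ℝ≥0∞) = A + B + 1 := by
    push_cast
    rw [ENNReal.coe_toNNReal hAt, ENNReal.coe_toNNReal hBt]
  set N := annulusMass R f with hN
  set M : ℝ≥0∞ := ENNReal.ofReal (4 * energyConst * R) * N with hM
  set Ψ := weightedEnergy δ R f with hΨ
  have hΨm : Measurable Ψ := measurable_weightedEnergy δ hf
  -- A bound for the angular norm on almost all circles. The first entry is used for the integral in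
  -- time, the second for the bound at each time.
  set H : ℝ → ℝ≥0∞ := fun t => min ((Ψ t * M ^ δ) ^ σ⁻¹)
    (ENNReal.ofReal (3 * Real.pi) * ENNReal.ofReal R * N ^ (1 / 2 : ℝ)) with hH
  have hHm : Measurable H := ((hΨm.mul_const _).pow_const _).min measurable_const
  have hle : ∀ t, ∀ᵐ ρ ∂radialMeasure, angularNorm (blockWave (annulus R) f t) ρ ≤ H t := by
    intro t
    filter_upwards [ae_radialMeasure_pos] with ρ hρ
    refine le_min ?_ (angularNorm_annulus_le hR hf t ρ)
    rw [ENNReal.le_rpow_inv_iff hσ0, angularNorm_eq, ← ENNReal.rpow_mul,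
      show 1 / 2 * σ = 1 + δ by rw [hδ]; ring]
    exact circleMass_rpow_le hR hf hδ0 t hρ
  refine ⟨fun t => H t ^ κ * (2 * N) ^ i, (hHm.pow_const _).mul_const _, fun t => ?_, fun t => ?_,
    ?_⟩
  · refine (eLpNorm_le_rpow_mul_rpow (measurable_angularNorm (measurable_blockWave hf t)).aemeasurable
      (hle t) hr.le).trans (mul_le_mul' le_rfl (ENNReal.rpow_le_rpow ?_ hi0))
    rw [lintegral_angularNorm_sq (measurable_blockWave hf t)]
    exact lintegral_blockWave_sq_le hf t
  · calc H t ^ κ * (2 * N) ^ i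
        ≤ (ENNReal.ofReal (3 * Real.pi) * ENNReal.ofReal R * N ^ (1 / 2 : ℝ)) ^ κ *
            (2 * N) ^ i := by
          gcongr; exact min_le_right _ _
      _ = A * ENNReal.ofReal R ^ κ * (N ^ (1 / 2 * κ) * N ^ i) := by
          rw [ENNReal.mul_rpow_of_nonneg _ _ hκ0.le, ENNReal.mul_rpow_of_nonneg _ _ hκ0.le,
            ENNReal.mul_rpow_of_nonneg _ _ hi0, ← ENNReal.rpow_mul, hA]
          ring
      _ = A * ENNReal.ofReal R ^ κ * N ^ (1 / 2 : ℝ) := by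
          rw [← ENNReal.rpow_add_of_nonneg _ _ (by positivity) hi0]
          congr 2; rw [hκ]; ring
      _ ≤ _ := by
          rw [hcoe]
          gcongr
          rw [add_assoc]; exact le_self_add
  · calc ∫⁻ t, (H t ^ κ * (2 * N) ^ i) ^ s
        ≤ ∫⁻ t, Ψ t * (M ^ δ * (2 * N) ^ (i * s)) := by
          refine lintegral_mono fun t => ?_
          rw [ENNReal.mul_rpow_of_nonneg _ _ hs0.le, ← ENNReal.rpow_mul, ← ENNReal.rpow_mul,
            ← mul_assoc]
          gcongr
          calc H t ^ (κ * s) ≤ ((Ψ t * M ^ δ) ^ σ⁻¹) ^ (κ * s) := by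
                gcongr; exact min_le_left _ _
            _ = Ψ t * M ^ δ := by
                rw [← ENNReal.rpow_mul, hσ, mul_comm κ s, inv_mul_cancel₀ hσ0.ne', ENNReal.rpow_one]
      _ = (∫⁻ t, Ψ t) * (M ^ δ * (2 * N) ^ (i * s)) := lintegral_mul_const _ hΨm
      _ ≤ (C₀ * ENNReal.ofReal R ^ (1 + δ) * N) * (M ^ δ * (2 * N) ^ (i * s)) := by
          gcongr
          exact hC₀ hR hf
      _ = B * (ENNReal.ofReal R ^ (1 + δ) * ENNReal.ofReal R ^ δ) *
            (N ^ (1 : ℝ) * N ^ δ * N ^ (i * s)) := by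
          rw [hM, ENNReal.ofReal_mul (by positivity), ENNReal.mul_rpow_of_nonneg _ _ hδ0.le,
            ENNReal.mul_rpow_of_nonneg _ _ hδ0.le,
            ENNReal.mul_rpow_of_nonneg _ _ (by positivity : 0 ≤ i * s), hB, ENNReal.rpow_one]
          ring
      _ = B * ENNReal.ofReal R ^ (s * κ - 1) * N ^ (s / 2) := by
          rw [← ENNReal.rpow_add_of_nonneg _ _ (by positivity) hδ0.le,
            ← ENNReal.rpow_add_of_nonneg _ _ zero_le_one hδ0.le,
            ← ENNReal.rpow_add_of_nonneg _ _ (by positivity) (by positivity)]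
          congr 2
          · congr 1; rw [hδ]; ring
          · rw [hδ, hσ, hκ]; ring
      _ ≤ _ := by
          rw [hcoe]
          gcongr
          rw [add_right_comm]; exact le_add_self

/-! ### Summation over dyadic frequencies -/

/-- The dyadic annulus `2^k ≤ |ξ| < 2^{k+1}`. -/
def dyadic (k : ℤ) : Set Plane := annulus ((2 : ℝ) ^ k)

/-- The square of the homogeneous Sobolev norm, up to constants. -/
noncomputable def dyadicMass (γ : ℝ) (f : Plane → ℂ) : ℝ≥0∞ :=
  ∑' k : ℤ, (2 : ℝ≥0∞) ^ ((k : ℝ) * (2 * γ)) * annulusMass ((2 : ℝ) ^ k) f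

theorem ofReal_two_zpow_rpow (k : ℤ) (x : ℝ) :
    ENNReal.ofReal ((2 : ℝ) ^ k) ^ x = (2 : ℝ≥0∞) ^ ((k : ℝ) * x) := by
  rw [← Real.rpow_intCast, ← ENNReal.ofReal_rpow_of_pos (by norm_num), ENNReal.rpow_mul]
  simp

theorem two_rpow_mul_two_rpow (x y : ℝ) : (2 : ℝ≥0∞) ^ x * 2 ^ y = 2 ^ (x + y) :=
  (ENNReal.rpow_add x y two_ne_zero ENNReal.ofNat_ne_top).symm

theorem tsum_sq_const_mul_dyadic (c : ℝ≥0∞) (γ : ℝ) (f : Plane → ℂ) :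
    (∑' k : ℤ, (c * (2 : ℝ≥0∞) ^ ((k : ℝ) * γ) * annulusMass ((2 : ℝ) ^ k) f ^ (1 / 2 : ℝ)) ^ 2) ^
      (1 / 2 : ℝ) = c * dyadicMass γ f ^ (1 / 2 : ℝ) := by
  have h : ∀ k : ℤ,
      (c * (2 : ℝ≥0∞) ^ ((k : ℝ) * γ) * annulusMass ((2 : ℝ) ^ k) f ^ (1 / 2 : ℝ)) ^ 2 =
        c ^ 2 * ((2 : ℝ≥0∞) ^ ((k : ℝ) * (2 * γ)) * annulusMass ((2 : ℝ) ^ k) f) := by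
    intro k
    rw [mul_pow, mul_pow, rpow_half_sq, mul_assoc, ← ENNReal.rpow_two, ← ENNReal.rpow_two,
      ← ENNReal.rpow_mul]
    congr 3; ring
  simp only [h]
  rw [ENNReal.tsum_mul_left, ENNReal.mul_rpow_of_nonneg _ _ (by norm_num), ← ENNReal.rpow_two,
    ← ENNReal.rpow_mul]
  norm_num [dyadicMass]

/-- Summation over frequencies in the time variable. -/
theorem eLpNorm_tsum_radialAngularNorm_le {q : ℝ} (hq : 2 < q) {r : ℝ≥0∞} (hr : 2 < r)
    (hqr : 1 / q < 1 / 2 - (r⁻¹).toReal) :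
    ∃ C : ℝ≥0, ∀ f : Plane → ℂ, (∀ k, IntegrableOn f (dyadic k)) →
      eLpNorm (fun t => ∑' k, radialAngularNorm r (blockWave (dyadic k) f t)) (ENNReal.ofReal q)
        volume ≤ C * dyadicMass (1 - 2 * (r⁻¹).toReal - 1 / q) f ^ (1 / 2 : ℝ) := by
  have hi0 : 0 ≤ (r⁻¹).toReal := ENNReal.toReal_nonneg
  have hi2 := inv_toReal_lt_half hr
  set κ := 1 - 2 * (r⁻¹).toReal with hκ
  have hκ0 : 0 < κ := by linarith
  have hκ1 : κ ≤ 1 := by linarith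
  have hq0 : 0 < q := by linarith
  -- Room for s: the block estimate needs 2 < sκ < 4 and the summation lemma needs s < q. The
  -- hypothesis on (q, r) says that 2/κ < q.
  have h1 : 2 / κ < min q (4 / κ) := by
    refine lt_min ?_ (by gcongr; norm_num)
    rw [div_lt_iff₀ hκ0]
    have : 1 / q < κ / 2 := by linarith
    rw [div_lt_iff₀ hq0] at this
    linarith
  obtain ⟨s, hs1, hs2⟩ := exists_between h1
  have hsq : s < q := hs2.trans_le (min_le_left _ _)
  have hs4 : s * κ < 4 := (lt_div_iff₀ hκ0).1 (hs2.trans_le (min_le_right _ _))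
  have hs2' : 2 < s * κ := (div_lt_iff₀ hκ0).1 hs1
  have hs1' : 1 < s := by nlinarith
  have hs0 : 0 < s := by linarith
  obtain ⟨C, hC1, hC⟩ := exists_majorant_radialAngularNorm hr hs2' hs4
  obtain ⟨D, hD⟩ := eLpNorm_tsum_le_l2 hs1' hsq hq.le (Λ := 2) (by norm_num) (by norm_num)
  refine ⟨D * C, fun f hf => ?_⟩
  choose a ham hale hasup haint using fun k : ℤ => hC (R := (2 : ℝ) ^ k) (by positivity) (hf k)
  set b : ℤ → ℝ≥0∞ := fun k => C * (2 : ℝ≥0∞) ^ ((k : ℝ) * (κ - 1 / q)) *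
    annulusMass ((2 : ℝ) ^ k) f ^ (1 / 2 : ℝ) with hb
  have key := hD volume a b (fun k => (ham k).aemeasurable) (fun k t => ?_) (fun k => ?_)
  · rw [tsum_sq_const_mul_dyadic] at key
    rw [ENNReal.coe_mul, mul_assoc]
    refine le_trans (eLpNorm_mono_enorm fun t => ?_) key
    simp only [enorm_eq_self]
    exact ENNReal.tsum_le_tsum fun k => hale k t
  · refine (hasup k t).trans (le_of_eq ?_)
    rw [ofReal_two_zpow_rpow, hb]
    simp only
    rw [← mul_assoc, mul_left_comm, two_rpow_mul_two_rpow]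
    congr 3; ring
  · refine (haint k).trans ?_
    rw [ofReal_two_zpow_rpow, hb]
    simp only
    rw [ENNReal.mul_rpow_of_nonneg _ _ hs0.le, ENNReal.mul_rpow_of_nonneg _ _ hs0.le,
      ← ENNReal.rpow_mul, ← ENNReal.rpow_mul, ← mul_assoc, mul_left_comm, two_rpow_mul_two_rpow,
      show (k : ℝ) * (s / q - 1) + (k : ℝ) * (κ - 1 / q) * s = (k : ℝ) * (s * κ - 1) by ring,
      show 1 / 2 * s = s / 2 by ring]
    gcongr
    refine (ENNReal.rpow_one _).symm.le.trans
      (ENNReal.rpow_le_rpow_of_exponent_le (by exact_mod_cast hC1) hs1'.le)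

/-- Summation over frequencies in the radial variable. -/
theorem eLpNorm_tsum_angularNorm_le {r : ℝ} (hr : 2 < r) :
    ∃ C : ℝ≥0, ∀ f : Plane → ℂ, (∀ k, IntegrableOn f (dyadic k)) → ∀ t,
      eLpNorm (fun ρ => ∑' k, angularNorm (blockWave (dyadic k) f t) ρ) (ENNReal.ofReal r)
        radialMeasure ≤ C * dyadicMass (1 - 2 * (1 / r)) f ^ (1 / 2 : ℝ) := by
  -- The measure ρ dρ scales like area, so frequency 2^k corresponds to the factor 4^k. The exponent
  -- s = 2 is the L² bound and the pointwise bound is Bernstein's.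
  obtain ⟨D, hD⟩ := eLpNorm_tsum_le_l2 (s := 2) (q := r) (by norm_num) hr hr.le (Λ := 4)
    (by norm_num) (by norm_num)
  have h4 : ∀ x : ℝ, (4 : ℝ≥0∞) ^ x = 2 ^ (2 * x) := by
    intro x
    rw [ENNReal.rpow_mul, ENNReal.rpow_two]; norm_num
  have hr0 : 0 < r := by linarith
  have hpi := Real.pi_gt_three
  set c : ℝ≥0∞ := ENNReal.ofReal (3 * Real.pi) with hc
  refine ⟨D * c.toNNReal, fun f hf t => ?_⟩
  set b : ℤ → ℝ≥0∞ := fun k => c * (2 : ℝ≥0∞) ^ ((k : ℝ) * (1 - 2 * (1 / r))) *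
    annulusMass ((2 : ℝ) ^ k) f ^ (1 / 2 : ℝ) with hb
  have hm : ∀ k, Measurable (blockWave (dyadic k) f t) := fun k => measurable_blockWave (hf k) t
  have key := hD radialMeasure (fun k => angularNorm (blockWave (dyadic k) f t)) b
    (fun k => (measurable_angularNorm (hm k)).aemeasurable) (fun k ρ => ?_) (fun k => ?_)
  · rw [tsum_sq_const_mul_dyadic] at key
    rwa [ENNReal.coe_mul, mul_assoc, ENNReal.coe_toNNReal ENNReal.ofReal_ne_top]
  · refine (angularNorm_annulus_le (by positivity) (hf k) t ρ).trans (le_of_eq ?_)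
    rw [← ENNReal.rpow_one (ENNReal.ofReal ((2 : ℝ) ^ k)), ofReal_two_zpow_rpow, hb, h4]
    simp only
    rw [← mul_assoc, mul_left_comm, two_rpow_mul_two_rpow]
    congr 3; field_simp; ring
  · simp only [ENNReal.rpow_two]
    rw [lintegral_angularNorm_sq (hm k)]
    refine (lintegral_blockWave_sq_le (hf k) t).trans ?_
    have e : (4 : ℝ≥0∞) ^ ((k : ℝ) * (2 / r - 1)) * b k ^ 2 =
        c ^ 2 * annulusMass ((2 : ℝ) ^ k) f := by
      rw [hb, h4]
      simp only
      rw [mul_pow, mul_pow, rpow_half_sq, ← ENNReal.rpow_two ((2 : ℝ≥0∞) ^ _), ← ENNReal.rpow_mul,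
        ← mul_assoc, mul_left_comm, two_rpow_mul_two_rpow,
        show 2 * ((k : ℝ) * (2 / r - 1)) + (k : ℝ) * (1 - 2 * (1 / r)) * 2 = 0 by
          field_simp; ring, ENNReal.rpow_zero, mul_one]
    rw [e]
    refine mul_le_mul' ?_ le_rfl
    rw [hc, ← ENNReal.ofReal_pow (by positivity), show (2 : ℝ≥0∞) = ENNReal.ofReal 2 by simp]
    exact ENNReal.ofReal_le_ofReal (by nlinarith)

/-! ### Densities of tempered distributions -/

theorem Represents.add {f g : Plane → ℂ} {S T : 𝓢'(Plane, ℂ)} (hf : Represents f S)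
    (hg : Represents g T) : Represents (fun x => f x + g x) (S + T) := by
  intro φ
  have hfi := (hf φ).1
  have hgi := (hg φ).1
  simp only [mul_add]
  refine ⟨hfi.add hgi, ?_⟩
  rw [integral_add hfi hgi, ← (hf φ).2, ← (hg φ).2]
  rfl

theorem exists_represents_of_memLp {f : Plane → ℂ} {p p' : ℝ≥0∞} [Fact (1 ≤ p)]
    [p'.HolderTriple p 1] (hf : MemLp f p volume) : ∃ T, Represents f T := by
  refine ⟨Lp.toTemperedDistribution hf.toLp, fun φ => ⟨?_, ?_⟩⟩
  · exact (φ.memLp p').integrable_mul hf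
  · rw [Lp.toTemperedDistribution_apply]
    refine integral_congr_ae ?_
    filter_upwards [hf.coeFn_toLp] with x hx
    rw [hx, smul_eq_mul]

theorem exists_represents {f : Plane → ℂ} {A : Set Plane} (hA : MeasurableSet A)
    (h1 : IntegrableOn f A) (h2 : MemLp f 2 (volume.restrict Aᶜ)) : ∃ T, Represents f T := by
  obtain ⟨T₁, hT₁⟩ := exists_represents_of_memLp (p := 1) (p' := ∞)
    (memLp_one_iff_integrable.2 (h1.integrable_indicator hA))
  obtain ⟨T₂, hT₂⟩ := exists_represents_of_memLp (p := 2) (p' := 2)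
    ((memLp_indicator_iff_restrict hA.compl).2 h2)
  have := hT₁.add hT₂
  simp only [Set.indicator_self_add_compl_apply] at this
  exact ⟨_, this⟩

theorem represents_ofDensity {f : Plane → ℂ} (h : ∃ T, Represents f T) :
    Represents f (ofDensity f) := by
  rw [ofDensity, dif_pos h]
  exact h.choose_spec

theorem represents_fourierDensity {g : 𝓢'(Plane, ℂ)} (h : ∃ f, Represents f (𝓕 g)) :
    Represents (fourierDensity g) (𝓕 g) := by
  rw [fourierDensity, dif_pos h]
  exact h.choose_spec

/-! ### Half-waves as sums of blocks -/

/-- The Fourier multiplier of the half-wave operator. -/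
noncomputable def waveMul (t : ℝ) (f : Plane → ℂ) (ξ : Plane) : ℂ :=
  Complex.exp (-(Complex.I * (t : ℂ) * (symbolP ξ : ℂ))) * f ξ

theorem waveMul_eq (t : ℝ) (f : Plane → ℂ) :
    waveMul t f = fun ξ =>
      Complex.exp (((-(2 * Real.pi * (t * ‖ξ‖)) : ℝ) : ℂ) * Complex.I) * f ξ := by
  funext ξ
  rw [waveMul, symbolP]
  congr 2
  push_cast; ring

theorem norm_waveMul (t : ℝ) (f : Plane → ℂ) (ξ : Plane) : ‖waveMul t f ξ‖ = ‖f ξ‖ := by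
  simp only [waveMul_eq]
  rw [norm_mul, norm_cexp_real_mul_I, one_mul]

theorem aestronglyMeasurable_waveMul {μ : Measure Plane} {f : Plane → ℂ}
    (hf : AEStronglyMeasurable f μ) (t : ℝ) : AEStronglyMeasurable (waveMul t f) μ := by
  rw [waveMul_eq]
  have : Measurable fun ξ : Plane =>
    Complex.exp (((-(2 * Real.pi * (t * ‖ξ‖)) : ℝ) : ℂ) * Complex.I) := by fun_prop
  exact this.aestronglyMeasurable.mul hf

theorem integrableOn_waveMul {A : Set Plane} {f : Plane → ℂ} (hf : IntegrableOn f A) (t : ℝ) :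
    IntegrableOn (waveMul t f) A :=
  hf.congr' (aestronglyMeasurable_waveMul hf.1 t) (ae_of_all _ fun ξ => (norm_waveMul t f ξ).symm)

/-- Fubini: integrability of f on A makes the double integral in (x, ξ) absolutely convergent. -/
theorem integral_fourierInv_mul_waveMul {A : Set Plane} {f : Plane → ℂ} (hf : IntegrableOn f A)
    (t : ℝ) (φ : 𝓢(Plane, ℂ)) :
    ∫ ξ in A, 𝓕⁻ φ ξ * waveMul t f ξ = ∫ x, φ x * blockWave A f t x := by
  have hint : Integrable (Function.uncurry fun (x ξ : Plane) =>
      Complex.exp (phase t x ξ * Complex.I) * (φ x * f ξ)) (volume.prod (volume.restrict A)) := by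
    have hm : Measurable fun p : Plane × Plane => phase t p.1 p.2 := by
      unfold phase; fun_prop
    exact integrable_cexp_mul (φ.integrable.mul_prod hf) hm
  calc ∫ ξ in A, 𝓕⁻ φ ξ * waveMul t f ξ
      = ∫ ξ in A, ∫ x, Complex.exp (phase t x ξ * Complex.I) * (φ x * f ξ) := by
        refine integral_congr_ae (ae_of_all _ fun ξ => ?_)
        simp only [waveMul_eq]
        rw [SchwartzMap.fourierInv_coe, Real.fourierInv_eq', ← integral_mul_const]
        refine integral_congr_ae (ae_of_all _ fun x => ?_)
        simp only [phase, smul_eq_mul]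
        rw [mul_mul_mul_comm, ← Complex.exp_add]
        congr 2
        push_cast; ring
    _ = ∫ x, ∫ ξ in A, Complex.exp (phase t x ξ * Complex.I) * (φ x * f ξ) :=
        (integral_integral_swap hint).symm
    _ = _ := by
        refine integral_congr_ae (ae_of_all _ fun x => ?_)
        simp only [mul_left_comm _ (φ x)]
        rw [integral_const_mul]
        rfl

/-- The pairing on the Fourier side splits over the partition and each piece is transferred by
Fubini. Summability against Schwartz functions permits summing under the integral. The partition is
left free since the endpoint (∞, 2) needs one that is not dyadic. -/
theorem represents_halfWave {ι : Type*} [Countable ι] {g : 𝓢'(Plane, ℂ)} {B : ι → Set Plane}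
    (hBm : ∀ i, MeasurableSet (B i)) (hBd : Pairwise (Function.onFun Disjoint B))
    (hBu : ∀ᵐ ξ : Plane, ξ ∈ ⋃ i, B i) (hB : ∀ i, IntegrableOn (fourierDensity g) (B i)) {t : ℝ}
    (hT : ∃ T, Represents (waveMul t (fourierDensity g)) T)
    (hφ : ∀ φ : 𝓢(Plane, ℂ),
      ∑' i, ∫⁻ x, ‖φ x‖ₑ * ‖blockWave (B i) (fourierDensity g) t x‖ₑ ≠ ∞) :
    Represents (fun x => ∑' i, blockWave (B i) (fourierDensity g) t x) (halfWave t g) := by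
  intro φ
  set f := fourierDensity g
  have hm : ∀ i, AEStronglyMeasurable (fun x => φ x * blockWave (B i) f t x) volume := fun i =>
    (φ.continuous.mul (continuous_blockWave_right (hB i) t)).aestronglyMeasurable
  have hsum : ∑' i, ∫⁻ x, ‖φ x * blockWave (B i) f t x‖ₑ ≠ ∞ := by
    simpa only [enorm_mul] using hφ φ
  have hae : ∀ᵐ x, ∑' i, ‖φ x * blockWave (B i) f t x‖ₑ < ∞ := by
    refine ae_lt_top' (AEMeasurable.tsum fun i => (hm i).enorm) ?_
    rwa [lintegral_tsum fun i => (hm i).enorm]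
  simp only [← tsum_mul_left]
  constructor
  · have hmt : AEStronglyMeasurable (fun x => ∑' i, φ x * blockWave (B i) f t x) volume := by
      refine aestronglyMeasurable_of_tendsto_ae (Filter.atTop : Filter (Finset ι))
        (f := fun s x => ∑ i ∈ s, φ x * blockWave (B i) f t x)
        (fun s => Finset.aestronglyMeasurable_fun_sum s fun i _ => hm i) ?_
      filter_upwards [hae] with x hx
      exact (Summable.of_enorm hx.ne).hasSum
    refine ⟨hmt, lt_of_le_of_lt (lintegral_mono fun x => enorm_tsum_le_tsum_enorm) ?_⟩
    rw [lintegral_tsum fun i => (hm i).enorm]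
    exact hsum.lt_top
  · have hrep := represents_ofDensity hT (𝓕⁻ φ)
    rw [integral_tsum hm hsum]
    have e1 : halfWave t g φ = ofDensity (waveMul t f) (𝓕⁻ φ) := by
      rw [halfWave, TemperedDistribution.fourierInv_apply]
      rfl
    rw [e1, hrep.2]
    have e2 : ∫ ξ, 𝓕⁻ φ ξ * waveMul t f ξ = ∫ ξ in ⋃ i, B i, 𝓕⁻ φ ξ * waveMul t f ξ := by
      rw [Measure.restrict_eq_self_of_ae_mem hBu]
    rw [e2, integral_iUnion hBm hBd hrep.1.integrableOn]
    exact tsum_congr fun i => integral_fourierInv_mul_waveMul (hB i) t φ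

/-- Off the measurable set of absolute convergence the sum takes its default value 0, so cutting the
partial sums off to that set makes them converge everywhere. -/
theorem measurable_tsum_complex {X ι : Type*} [MeasurableSpace X] [Countable ι] {F : ι → X → ℂ}
    (hF : ∀ i, Measurable (F i)) : Measurable fun x => ∑' i, F i x := by
  set S : Set X := {x | ∑' i, ‖F i x‖ₑ < ∞} with hS
  have hSm : MeasurableSet S :=
    measurableSet_lt (Measurable.tsum fun i => (hF i).enorm) measurable_const
  refine measurable_of_tendsto_metrizable' (Filter.atTop : Filter (Finset ι))
    (f := fun s => S.indicator fun x => ∑ i ∈ s, F i x)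
    (fun s => (Finset.measurable_fun_sum s fun i _ => hF i).indicator hSm) ?_
  rw [tendsto_pi_nhds]
  intro x
  by_cases hx : x ∈ S
  · simp only [Set.indicator_of_mem hx]
    exact (Summable.of_enorm (lt_top_iff_ne_top.1 hx)).hasSum
  · simp only [Set.indicator_of_notMem hx]
    have : ¬ Summable fun i => F i x := by
      intro h
      refine hx ?_
      have := h.norm
      rw [hS, Set.mem_ofPred_eq]
      have e : ∀ i, ‖F i x‖ₑ = ENNReal.ofReal ‖F i x‖ := fun i => (ofReal_norm _).symm
      simp only [e]
      rw [← ENNReal.ofReal_tsum_of_nonneg (fun i => norm_nonneg _) this]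
      exact ENNReal.ofReal_lt_top
    rw [tsum_eq_zero_of_not_summable this]
    exact tendsto_const_nhds

theorem stronglyMeasurable_tsum_blockWave {ι : Type*} [Countable ι] {f : Plane → ℂ}
    {B : ι → Set Plane} (hB : ∀ i, IntegrableOn f (B i)) :
    StronglyMeasurable (Function.uncurry fun t x => ∑' i, blockWave (B i) f t x) :=
  (measurable_tsum_complex fun i => (continuous_blockWave (hB i)).measurable).stronglyMeasurable

/-! ### Angular norms of sums and of almost everywhere equal functions -/

theorem angularNorm_tsum_le {ι : Type*} [Countable ι] {v : ι → Plane → ℂ}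
    (hv : ∀ i, Measurable (v i)) (ρ : ℝ) :
    angularNorm (fun x => ∑' i, v i x) ρ ≤ ∑' i, angularNorm (v i) ρ := by
  have hpol : Measurable (polar ρ) :=
    (continuous_polar.comp (Continuous.prodMk_right ρ)).measurable
  have hm : ∀ i, Measurable fun θ => ‖v i (polar ρ θ)‖ₑ := fun i => ((hv i).comp hpol).enorm
  unfold angularNorm
  calc _ ≤ eLpNorm (fun θ => ∑' i, ‖v i (polar ρ θ)‖ₑ) 2
        (volume.restrict (Set.Ioo 0 (2 * Real.pi))) := by
        refine eLpNorm_mono_enorm fun θ => ?_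
        rw [enorm_eq_self]
        exact enorm_tsum_le_tsum_enorm
    _ ≤ ∑' i, eLpNorm (fun θ => ‖v i (polar ρ θ)‖ₑ) 2
        (volume.restrict (Set.Ioo 0 (2 * Real.pi))) :=
        eLpNorm_tsum_le one_le_two fun i => (hm i).aemeasurable
    _ = _ := by
        refine tsum_congr fun i => ?_
        rw [eLpNorm_enorm (fun θ => v i (polar ρ θ))]
        rfl

theorem radialAngularNorm_tsum_le' {ι : Type*} [Countable ι] {v : ι → Plane → ℂ}
    (hv : ∀ i, Measurable (v i)) (r : ℝ≥0∞) :
    radialAngularNorm r (fun x => ∑' i, v i x) ≤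
      eLpNorm (fun ρ => ∑' i, angularNorm (v i) ρ) r radialMeasure :=
  eLpNorm_mono_enorm fun ρ => by
    simp only [enorm_eq_self]
    exact angularNorm_tsum_le hv ρ

theorem radialAngularNorm_tsum_le {ι : Type*} [Countable ι] {v : ι → Plane → ℂ}
    (hv : ∀ i, Measurable (v i)) {r : ℝ≥0∞} (hr : 1 ≤ r) :
    radialAngularNorm r (fun x => ∑' i, v i x) ≤ ∑' i, radialAngularNorm r (v i) :=
  (radialAngularNorm_tsum_le' hv r).trans
    (eLpNorm_tsum_le hr fun i => (measurable_angularNorm (hv i)).aemeasurable)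

/-- By Tonelli in polar coordinates, a null set of the plane meets almost every circle in a null set
of angles. -/
theorem radialAngularNorm_congr_ae {u v : Plane → ℂ} (h : u =ᵐ[volume] v) (r : ℝ≥0∞) :
    radialAngularNorm r u = radialAngularNorm r v := by
  refine eLpNorm_congr_ae ?_
  set N := toMeasurable volume {x | u x ≠ v x} with hN
  have hNm : MeasurableSet N := measurableSet_toMeasurable _ _
  have hN0 : volume N = 0 := by rw [hN, measure_toMeasurable]; exact h
  have hone : Measurable (N.indicator fun _ => (1 : ℝ≥0∞)) := measurable_const.indicator hNm
  have h0 : ∫⁻ x, N.indicator (fun _ => (1 : ℝ≥0∞)) x = 0 := by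
    rw [lintegral_indicator hNm]; simp [hN0]
  rw [lintegral_polar hone] at h0
  have hpm : Measurable fun p : ℝ × ℝ =>
      ENNReal.ofReal p.1 * N.indicator (fun _ => (1 : ℝ≥0∞)) (polar p.1 p.2) :=
    (by fun_prop : Measurable fun p : ℝ × ℝ => ENNReal.ofReal p.1).mul
      (hone.comp continuous_polar.measurable)
  rw [lintegral_eq_zero_iff hpm.lintegral_prod_right'] at h0
  have h1 : ∀ᵐ ρ ∂radialMeasure, ∫⁻ θ in Set.Ioo 0 (2 * Real.pi),
      ENNReal.ofReal ρ * N.indicator (fun _ => (1 : ℝ≥0∞)) (polar ρ θ) = 0 :=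
    (withDensity_absolutelyContinuous _ _).ae_le h0
  filter_upwards [h1, ae_radialMeasure_pos] with ρ hρ hρ0
  have hpmρ : Measurable fun θ =>
      ENNReal.ofReal ρ * N.indicator (fun _ => (1 : ℝ≥0∞)) (polar ρ θ) :=
    hpm.comp measurable_prodMk_left
  rw [lintegral_eq_zero_iff hpmρ] at hρ
  refine eLpNorm_congr_ae ?_
  filter_upwards [hρ] with θ hθ
  by_contra hne
  have hmem : polar ρ θ ∈ N := subset_toMeasurable _ _ hne
  simp [Set.indicator_of_mem hmem, not_le.2 hρ0] at hθ

/-! ### Dyadic blocks -/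

theorem measurableSet_dyadic (k : ℤ) : MeasurableSet (dyadic k) := measurableSet_annulus _

theorem dyadic_eq (k : ℤ) :
    dyadic k = (fun ξ : Plane => ‖ξ‖) ⁻¹' Set.Ico ((2 : ℝ) ^ k) ((2 : ℝ) ^ (k + 1)) := by
  ext ξ
  rw [dyadic, annulus, zpow_add_one₀ (by norm_num), mul_comm _ (2 : ℝ)]
  rfl

theorem pairwise_disjoint_dyadic : Pairwise (Function.onFun Disjoint dyadic) := by
  intro i j hij
  have hmono : Monotone fun k : ℤ => (2 : ℝ) ^ k := fun a b h => zpow_le_zpow_right₀ (by norm_num) h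
  have := hmono.pairwise_disjoint_on_Ico_succ hij
  rw [Function.onFun, dyadic_eq, dyadic_eq]
  exact Disjoint.preimage _ this

theorem ae_mem_iUnion_dyadic : ∀ᵐ ξ : Plane, ξ ∈ ⋃ k, dyadic k := by
  have h0 : ∀ᵐ ξ : Plane, ξ ≠ 0 := by simp [ae_iff]
  filter_upwards [h0] with ξ hξ
  obtain ⟨k, hk⟩ := exists_mem_Ico_zpow (norm_pos_iff.2 hξ) (one_lt_two (α := ℝ))
  exact Set.mem_iUnion.2 ⟨k, by rw [dyadic_eq]; exact hk⟩

theorem rpow_mul_enorm_le_symbol {γ : ℝ} (hγ : 0 ≤ γ) {R : ℝ} (hR : 0 < R) {ξ : Plane}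
    (hξ : R ≤ ‖ξ‖) (z : ℂ) :
    ENNReal.ofReal R ^ γ * ‖z‖ₑ ≤ ‖((symbolP ξ ^ γ : ℝ) : ℂ) * z‖ₑ := by
  have hle : R ≤ symbolP ξ := by
    rw [symbolP]
    have := Real.pi_gt_three
    nlinarith
  rw [enorm_mul, ENNReal.ofReal_rpow_of_pos hR]
  gcongr
  rw [← ofReal_norm, Complex.norm_real]
  exact ENNReal.ofReal_le_ofReal ((Real.rpow_le_rpow hR.le hle hγ).trans (le_abs_self _))

/-! ### Half-waves of data in the homogeneous Sobolev space. -/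

section

variable {γ : ℝ} {g : 𝓢'(Plane, ℂ)}

theorem MemHomSobolev.exists_represents (h : MemHomSobolev γ g) : ∃ f, Represents f (𝓕 g) := by
  by_contra hn
  rw [MemHomSobolev, homSobolevNorm, if_neg hn] at h
  exact lt_irrefl _ h

theorem MemHomSobolev.locallyIntegrable (h : MemHomSobolev γ g) :
    LocallyIntegrable (fourierDensity g) :=
  (represents_fourierDensity h.exists_represents).locallyIntegrable

theorem MemHomSobolev.norm_eq (h : MemHomSobolev γ g) : homSobolevNorm γ g =
    (∫⁻ ξ, ‖((symbolP ξ ^ γ : ℝ) : ℂ) * fourierDensity g ξ‖ₑ ^ 2) ^ (1 / 2 : ℝ) := by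
  rw [homSobolevNorm, if_pos h.exists_represents,
    eLpNorm_eq_lintegral_rpow_enorm_toReal (by norm_num) (by norm_num)]
  simp

theorem MemHomSobolev.integrableOn_of_bounded (h : MemHomSobolev γ g) {A : Set Plane} {L : ℝ}
    (hA : ∀ ξ ∈ A, ‖ξ‖ ≤ L) : IntegrableOn (fourierDensity g) A :=
  (h.locallyIntegrable.integrableOn_isCompact (isCompact_closedBall 0 L)).mono_set
    fun ξ hξ => by simpa using hA ξ hξ

theorem MemHomSobolev.integrableOn_dyadic (h : MemHomSobolev γ g) (k : ℤ) :
    IntegrableOn (fourierDensity g) (dyadic k) :=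
  h.integrableOn_of_bounded (A := annulus ((2 : ℝ) ^ k)) fun _ => norm_le_of_mem_annulus

theorem MemHomSobolev.dyadicMass_le (h : MemHomSobolev γ g) (hγ : 0 ≤ γ) :
    dyadicMass γ (fourierDensity g) ^ (1 / 2 : ℝ) ≤ homSobolevNorm γ g := by
  rw [h.norm_eq]
  refine ENNReal.rpow_le_rpow ?_ (by norm_num)
  calc dyadicMass γ (fourierDensity g)
      ≤ ∑' k, ∫⁻ ξ in dyadic k, ‖((symbolP ξ ^ γ : ℝ) : ℂ) * fourierDensity g ξ‖ₑ ^ 2 := by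
        refine ENNReal.tsum_le_tsum fun k => ?_
        rw [annulusMass, ← lintegral_const_mul' _ _ (ENNReal.rpow_ne_top_of_ne_zero two_ne_zero
          ENNReal.ofNat_ne_top)]
        refine setLIntegral_mono' (measurableSet_dyadic k) fun ξ hξ => ?_
        have := rpow_mul_enorm_le_symbol hγ (by positivity : 0 < (2 : ℝ) ^ k) hξ.1
          (fourierDensity g ξ)
        refine le_trans (le_of_eq ?_) (pow_le_pow_left' this 2)
        rw [mul_pow, ofReal_two_zpow_rpow, ← ENNReal.rpow_two (_ ^ _), ← ENNReal.rpow_mul]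
        congr 2; ring
    _ = ∫⁻ ξ in ⋃ k, dyadic k, ‖((symbolP ξ ^ γ : ℝ) : ℂ) * fourierDensity g ξ‖ₑ ^ 2 :=
        (lintegral_iUnion measurableSet_dyadic pairwise_disjoint_dyadic _).symm
    _ ≤ _ := setLIntegral_le_lintegral _ _

/-- The multiplier has modulus one, so the density stays integrable on the unit ball. Outside it the
weight is at least 1, as γ ≥ 0, and the density is in L². -/
theorem MemHomSobolev.exists_represents_waveMul (h : MemHomSobolev γ g) (hγ : 0 ≤ γ) (t : ℝ) :
    ∃ T, Represents (waveMul t (fourierDensity g)) T := by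
  have hfm := h.locallyIntegrable.aestronglyMeasurable
  refine AngularStrichartz.exists_represents (A := Metric.ball 0 1) measurableSet_ball
    (integrableOn_waveMul (h.integrableOn_of_bounded (L := 1) fun ξ hξ => ?_) t)
    ⟨aestronglyMeasurable_waveMul hfm.restrict t, ?_⟩
  · exact (mem_ball_zero_iff.1 hξ).le
  · refine lt_of_le_of_lt ?_ h
    rw [homSobolevNorm, if_pos h.exists_represents]
    refine le_trans (eLpNorm_mono_enorm_ae ?_) (eLpNorm_restrict_le _ _ _ _)
    filter_upwards [ae_restrict_mem measurableSet_ball.compl] with ξ hξ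
    have h1 : 1 ≤ ‖ξ‖ := by simpa using hξ
    have := rpow_mul_enorm_le_symbol hγ one_pos h1 (fourierDensity g ξ)
    rw [ENNReal.ofReal_one, ENNReal.one_rpow, one_mul] at this
    rwa [← ofReal_norm, norm_waveMul, ofReal_norm]

theorem lintegral_schwartz_mul_blockWave_le {A : Set Plane} {f : Plane → ℂ}
    (hf : IntegrableOn f A) (t : ℝ) (φ : 𝓢(Plane, ℂ)) :
    ∫⁻ x, ‖φ x‖ₑ * ‖blockWave A f t x‖ₑ ≤ (∫⁻ x, ‖φ x‖ₑ ^ 2) ^ (1 / 2 : ℝ) *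
      (2 * ∫⁻ ξ in A, ‖f ξ‖ₑ ^ 2) ^ (1 / 2 : ℝ) := by
  have hm := measurable_blockWave hf t
  have h := ENNReal.lintegral_mul_le_Lp_mul_Lq volume Real.HolderConjugate.two_two
    (f := fun x => ‖φ x‖ₑ) (g := fun x => ‖blockWave A f t x‖ₑ)
    φ.continuous.measurable.enorm.aemeasurable hm.enorm.aemeasurable
  simp only [Pi.mul_apply, ENNReal.rpow_two] at h
  refine h.trans ?_
  gcongr
  exact lintegral_blockWave_sq_le hf t

theorem schwartz_lintegral_sq_lt_top (φ : 𝓢(Plane, ℂ)) :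
    (∫⁻ x, ‖φ x‖ₑ ^ 2) ^ (1 / 2 : ℝ) < ∞ := by
  have h := (φ.memLp 2 volume).2
  rw [eLpNorm_eq_lintegral_rpow_enorm_toReal (by norm_num) (by norm_num)] at h
  simpa using h

/-- Blocks with k < 0 are summed through the L¹ norm of the density on the unit ball. For k ≥ 0 the
L² norms of the blocks decay like 2^(-kγ); this is where γ > 0 is needed. -/
theorem MemHomSobolev.tsum_schwartz_dyadic_ne_top (h : MemHomSobolev γ g) (hγ : 0 < γ) (t : ℝ)
    (φ : 𝓢(Plane, ℂ)) :
    ∑' k, ∫⁻ x, ‖φ x‖ₑ * ‖blockWave (dyadic k) (fourierDensity g) t x‖ₑ ≠ ∞ := by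
  set f := fourierDensity g
  set D := dyadicMass γ f ^ (1 / 2 : ℝ)
  set P := (∫⁻ x, ‖φ x‖ₑ ^ 2) ^ (1 / 2 : ℝ)
  have hD : D < ∞ := (h.dyadicMass_le hγ.le).trans_lt h
  have hP : P < ∞ := schwartz_lintegral_sq_lt_top φ
  have hφ1 : ∫⁻ x, ‖φ x‖ₑ < ∞ := φ.integrable.2
  have hball : ∫⁻ ξ in Metric.ball 0 1, ‖f ξ‖ₑ < ∞ :=
    (h.integrableOn_of_bounded (L := 1) fun ξ hξ => (mem_ball_zero_iff.1 hξ).le).2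
  have hterm : ∀ k, ∫⁻ x, ‖φ x‖ₑ * ‖blockWave (dyadic k) f t x‖ₑ ≤
      (∫⁻ x, ‖φ x‖ₑ) * (∫⁻ ξ in dyadic k ∩ Metric.ball 0 1, ‖f ξ‖ₑ) +
        P * 2 ^ (1 / 2 : ℝ) * D * geomKernel 2 γ k := by
    intro k
    rcases lt_or_ge k 0 with hk | hk
    · refine le_trans ?_ le_self_add
      have hsub : dyadic k ∩ Metric.ball 0 1 = dyadic k := by
        refine Set.inter_eq_left.2 fun ξ hξ => mem_ball_zero_iff.2 ?_
        rw [dyadic_eq] at hξ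
        exact hξ.2.trans_le (zpow_le_one_of_nonpos₀ (by norm_num) (by linarith))
      rw [hsub, ← lintegral_mul_const _ φ.continuous.measurable.enorm]
      exact lintegral_mono fun x => mul_le_mul' le_rfl (enorm_blockWave_le _ _ _ _)
    · refine le_trans ?_ le_add_self
      refine (lintegral_schwartz_mul_blockWave_le (h.integrableOn_dyadic k) t φ).trans ?_
      rw [ENNReal.mul_rpow_of_nonneg _ _ (by norm_num), mul_assoc, mul_assoc]
      refine mul_le_mul' le_rfl (mul_le_mul' le_rfl ?_)
      rw [geomKernel, if_pos hk]
      have h1 : (2 : ℝ≥0∞) ^ ((k : ℝ) * (2 * γ)) * (∫⁻ ξ in dyadic k, ‖f ξ‖ₑ ^ 2) ≤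
          dyadicMass γ f := ENNReal.le_tsum (f := fun k : ℤ =>
            (2 : ℝ≥0∞) ^ ((k : ℝ) * (2 * γ)) * annulusMass ((2 : ℝ) ^ k) f) k
      have h2 := ENNReal.rpow_le_rpow h1 (show (0 : ℝ) ≤ 1 / 2 by norm_num)
      rw [ENNReal.mul_rpow_of_nonneg _ _ (by norm_num), ← ENNReal.rpow_mul,
        show (k : ℝ) * (2 * γ) * (1 / 2) = (k : ℝ) * γ by ring] at h2
      calc (∫⁻ ξ in dyadic k, ‖f ξ‖ₑ ^ 2) ^ (1 / 2 : ℝ)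
          = ((2 : ℝ≥0∞) ^ ((k : ℝ) * γ) * (∫⁻ ξ in dyadic k, ‖f ξ‖ₑ ^ 2) ^ (1 / 2 : ℝ)) *
              2 ^ (-((k : ℝ) * γ)) := by
            rw [mul_right_comm, two_rpow_mul_two_rpow, add_neg_cancel, ENNReal.rpow_zero, one_mul]
        _ ≤ _ := by gcongr
  refine ne_top_of_le_ne_top ?_ (ENNReal.tsum_le_tsum hterm)
  rw [ENNReal.tsum_add, ENNReal.tsum_mul_left, ENNReal.tsum_mul_left]
  refine ENNReal.add_ne_top.2 ⟨ENNReal.mul_ne_top hφ1.ne ?_, ENNReal.mul_ne_top ?_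
    (tsum_geomKernel_lt_top (by norm_num) hγ).ne⟩
  · rw [← lintegral_iUnion (fun k => (measurableSet_dyadic k).inter measurableSet_ball)
      (fun i j hij => (pairwise_disjoint_dyadic hij).mono Set.inter_subset_left
        Set.inter_subset_left)]
    refine ne_top_of_le_ne_top hball.ne (lintegral_mono_set ?_)
    exact Set.iUnion_subset fun k => Set.inter_subset_right
  · exact ENNReal.mul_ne_top (ENNReal.mul_ne_top hP.ne
      (ENNReal.rpow_ne_top_of_nonneg (by norm_num) ENNReal.ofNat_ne_top)) hD.ne

theorem MemHomSobolev.represents_tsum_dyadic (h : MemHomSobolev γ g) (hγ : 0 < γ) (t : ℝ) :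
    Represents (fun x => ∑' k, blockWave (dyadic k) (fourierDensity g) t x) (halfWave t g) :=
  represents_halfWave measurableSet_dyadic pairwise_disjoint_dyadic ae_mem_iUnion_dyadic
    h.integrableOn_dyadic (h.exists_represents_waveMul hγ.le t)
    (h.tsum_schwartz_dyadic_ne_top hγ t)

/-! ### Finite energy -/

/-- A partition of frequency space into shells carrying geometrically decreasing parts of `f`. -/
theorem exists_shells {f : Plane → ℂ} (hf : ∫⁻ ξ, ‖f ξ‖ₑ ^ 2 < ∞) :
    ∃ B : ℕ → Set Plane, (∀ n, MeasurableSet (B n)) ∧ Pairwise (Function.onFun Disjoint B) ∧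
      (⋃ n, B n = Set.univ) ∧ (∀ n, ∃ L : ℝ, ∀ ξ ∈ B n, ‖ξ‖ ≤ L) ∧
      ∑' n, (∫⁻ ξ in B n, ‖f ξ‖ₑ ^ 2) ^ (1 / 2 : ℝ) ≤
        3 * (∫⁻ ξ, ‖f ξ‖ₑ ^ 2) ^ (1 / 2 : ℝ) := by
  set S := ∫⁻ ξ, ‖f ξ‖ₑ ^ 2 with hS
  set E : ℕ → Set Plane := fun n => {ξ | (n : ℝ) ≤ ‖ξ‖} with hE
  have hEm : ∀ n, MeasurableSet (E n) := fun n => measurableSet_le measurable_const measurable_norm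
  have htail : Filter.Tendsto (fun n => ∫⁻ ξ in E n, ‖f ξ‖ₑ ^ 2) Filter.atTop (nhds 0) := by
    set μ := volume.withDensity fun ξ => ‖f ξ‖ₑ ^ 2 with hμ
    have hfin : IsFiniteMeasure μ := isFiniteMeasure_withDensity hf.ne
    have h1 := tendsto_measure_iInter_atTop (μ := μ) (s := E)
      (fun n => (hEm n).nullMeasurableSet)
      (fun m n hmn ξ (hξ : (n : ℝ) ≤ ‖ξ‖) => le_trans (by exact_mod_cast hmn) hξ)
      ⟨0, measure_ne_top _ _⟩
    have h2 : ⋂ n, E n = ∅ := by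
      refine Set.eq_empty_of_forall_notMem fun ξ hξ => ?_
      obtain ⟨n, hn⟩ := exists_nat_gt ‖ξ‖
      exact absurd (Set.mem_iInter.1 hξ n) (not_le.2 hn)
    rw [h2, measure_empty] at h1
    refine h1.congr fun n => ?_
    rw [Function.comp_apply, hμ, withDensity_apply _ (hEm n)]
  have hev : ∀ n : ℕ, ∃ N, ∀ k ≥ N, ∫⁻ ξ in E k, ‖f ξ‖ₑ ^ 2 ≤ (4⁻¹ : ℝ≥0∞) ^ n * S := by
    intro n
    rcases eq_or_ne S 0 with h0 | h0
    · exact ⟨0, fun k _ => by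
        rw [h0, mul_zero, ← h0]; exact setLIntegral_le_lintegral _ _⟩
    · have hpos : 0 < (4⁻¹ : ℝ≥0∞) ^ n * S :=
        ENNReal.mul_pos (pow_ne_zero _ (by simp)) h0
      obtain ⟨N, hN⟩ := Filter.eventually_atTop.1 (htail.eventually_le_const hpos)
      exact ⟨N, hN⟩
  obtain ⟨φ, hφ, hφS⟩ := Filter.extraction_forall_of_eventually' hev
  -- The radii are shifted by one: the value 0 at n = 0 makes the shells cover the origin, and shell
  -- n + 1 lies in the tail |ξ| ≥ φ n, whose mass is at most 4^(-n) of the total.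
  set r : ℕ → ℝ := fun n => Nat.casesOn n 0 fun m => (φ m : ℝ) with hr
  have hrs : ∀ n, r (n + 1) = φ n := fun n => rfl
  have hr0 : r 0 = 0 := rfl
  have hmono : Monotone r := by
    refine monotone_nat_of_le_succ fun n => ?_
    cases n with
    | zero => rw [hrs, hr0]; positivity
    | succ m => rw [hrs, hrs]; exact_mod_cast (hφ (Nat.lt_succ_self m)).le
  set B : ℕ → Set Plane := fun n => (fun ξ => ‖ξ‖) ⁻¹' Set.Ico (r n) (r (n + 1)) with hB
  refine ⟨B, fun n => measurable_norm measurableSet_Ico, ?_, ?_, ?_, ?_⟩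
  · intro i j hij
    exact Disjoint.preimage _ (hmono.pairwise_disjoint_on_Ico_succ hij)
  · have hunb : ¬ BddAbove (Set.range r) := by
      rintro ⟨b, hb⟩
      obtain ⟨n, hn⟩ := exists_nat_gt b
      have h1 : r (n + 1) ≤ b := hb ⟨n + 1, rfl⟩
      have h2 : (n : ℝ) ≤ φ n := by exact_mod_cast hφ.le_apply
      rw [hrs] at h1
      linarith
    have h := iUnion_Ico_map_succ_eq_Ici (f := r) (fun n => hmono bot_le) hunb
    rw [hB, ← Set.preimage_iUnion]
    refine Set.eq_univ_of_forall fun ξ => ?_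
    have h3 : ‖ξ‖ ∈ Set.Ici (r ⊥) := norm_nonneg ξ
    rw [← h] at h3
    exact h3
  · exact fun n => ⟨r (n + 1), fun ξ hξ => hξ.2.le⟩
  · have hB0 : ∫⁻ ξ in B 0, ‖f ξ‖ₑ ^ 2 ≤ S := setLIntegral_le_lintegral _ _
    have hBs : ∀ n, (∫⁻ ξ in B (n + 1), ‖f ξ‖ₑ ^ 2) ^ (1 / 2 : ℝ) ≤
        2⁻¹ ^ n * S ^ (1 / 2 : ℝ) := by
      intro n
      have h1 : ∫⁻ ξ in B (n + 1), ‖f ξ‖ₑ ^ 2 ≤ (4⁻¹ : ℝ≥0∞) ^ n * S :=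
        (lintegral_mono_set fun ξ hξ => hξ.1).trans (hφS n)
      refine (ENNReal.rpow_le_rpow h1 (by norm_num)).trans (le_of_eq ?_)
      have h4 : (4⁻¹ : ℝ≥0∞) = 2⁻¹ ^ 2 := by
        rw [← ENNReal.inv_pow]; norm_num
      rw [ENNReal.mul_rpow_of_nonneg _ _ (by norm_num), h4, ← pow_mul, ← ENNReal.rpow_natCast,
        ← ENNReal.rpow_natCast, ← ENNReal.rpow_mul]
      congr 2
      push_cast; ring
    rw [tsum_eq_zero_add' ENNReal.summable]
    calc _ ≤ S ^ (1 / 2 : ℝ) + ∑' n : ℕ, 2⁻¹ ^ n * S ^ (1 / 2 : ℝ) := by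
          gcongr
          exact hBs _
      _ = _ := by
          rw [ENNReal.tsum_mul_right, ENNReal.tsum_geometric, ENNReal.one_sub_inv_two, inv_inv]
          ring

/-- For γ = 0 the dyadic blocks are only square-summable in L² and their series need not converge
absolutely. Shells adapted to g have summable L² norms, at the cost of a factor 3; the other factor
2 bounds the √2 of the L² estimate. -/
theorem MemHomSobolev.exists_finiteEnergy_solution (h : MemHomSobolev 0 g) :
    ∃ u : ℝ → Plane → ℂ, StronglyMeasurable (Function.uncurry u) ∧
      (∀ t, Represents (u t) (halfWave t g)) ∧
      ∀ t, radialAngularNorm 2 (u t) ≤ 6 * homSobolevNorm 0 g := by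
  set f := fourierDensity g with hf
  have hnorm : homSobolevNorm 0 g = (∫⁻ ξ, ‖f ξ‖ₑ ^ 2) ^ (1 / 2 : ℝ) := by
    rw [h.norm_eq]; simp [hf]
  have hfin : ∫⁻ ξ, ‖f ξ‖ₑ ^ 2 < ∞ := by
    have h1 : homSobolevNorm 0 g < ∞ := h
    rw [hnorm] at h1
    exact (ENNReal.rpow_lt_top_iff_of_pos (by norm_num)).1 h1
  obtain ⟨B, hBm, hBd, hBu, hBb, hBs⟩ := exists_shells hfin
  have hBi : ∀ n, IntegrableOn f (B n) := fun n => by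
    obtain ⟨L, hL⟩ := hBb n
    exact h.integrableOn_of_bounded hL
  have hsum : ∑' n, (2 * ∫⁻ ξ in B n, ‖f ξ‖ₑ ^ 2) ^ (1 / 2 : ℝ) ≤ 6 * homSobolevNorm 0 g := by
    simp only [ENNReal.mul_rpow_of_nonneg _ _ (show (0 : ℝ) ≤ 1 / 2 by norm_num)]
    rw [ENNReal.tsum_mul_left, hnorm]
    have h2 : (2 : ℝ≥0∞) ^ (1 / 2 : ℝ) ≤ 2 := by
      calc (2 : ℝ≥0∞) ^ (1 / 2 : ℝ) ≤ 2 ^ (1 : ℝ) :=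
            ENNReal.rpow_le_rpow_of_exponent_le one_le_two (by norm_num)
        _ = 2 := ENNReal.rpow_one _
    calc _ ≤ 2 * (3 * (∫⁻ ξ, ‖f ξ‖ₑ ^ 2) ^ (1 / 2 : ℝ)) := by gcongr
      _ = _ := by rw [← mul_assoc]; norm_num
  refine ⟨fun t x => ∑' n, blockWave (B n) f t x, stronglyMeasurable_tsum_blockWave hBi,
    fun t => ?_, fun t => ?_⟩
  · refine represents_halfWave hBm hBd (ae_of_all _ fun ξ => hBu ▸ Set.mem_univ ξ) hBi
      (h.exists_represents_waveMul le_rfl t) fun φ => ?_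
    refine ne_top_of_le_ne_top ?_ (ENNReal.tsum_le_tsum fun n =>
      lintegral_schwartz_mul_blockWave_le (hBi n) t φ)
    rw [ENNReal.tsum_mul_left]
    exact ENNReal.mul_ne_top (schwartz_lintegral_sq_lt_top φ).ne
      (ne_top_of_le_ne_top (ENNReal.mul_ne_top (by norm_num) h.ne) hsum)
  · refine (radialAngularNorm_tsum_le (fun n => measurable_blockWave (hBi n) t)
      one_le_two).trans (le_trans (ENNReal.tsum_le_tsum fun n => ?_) hsum)
    rw [radialAngularNorm, eLpNorm_eq_lintegral_rpow_enorm_toReal (by norm_num) (by norm_num)]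
    simp only [enorm_eq_self, ENNReal.toReal_ofNat, ENNReal.rpow_two]
    rw [lintegral_angularNorm_sq (measurable_blockWave (hBi n) t)]
    exact ENNReal.rpow_le_rpow (lintegral_blockWave_sq_le (hBi n) t) (by norm_num)

/-- Densities of the same distribution agree almost everywhere, so a bound for one constructed
representative holds for all. -/
theorem mixedNorm_congr_of_represents {u v : ℝ → Plane → ℂ}
    (hu : ∀ᵐ t : ℝ, Represents (u t) (halfWave t g)) (hv : ∀ t, Represents (v t) (halfWave t g))
    (q r : ℝ≥0∞) : mixedNorm q r u = mixedNorm q r v := by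
  refine eLpNorm_congr_ae ?_
  filter_upwards [hu] with t ht
  exact radialAngularNorm_congr_ae (ht.ae_eq (hv t)) r

theorem mixedNorm_top_le {u : ℝ → Plane → ℂ} {r B : ℝ≥0∞} (h : ∀ t, radialAngularNorm r (u t) ≤ B) :
    mixedNorm ∞ r u ≤ B := by
  rw [mixedNorm, eLpNorm_exponent_top]
  exact eLpNormEssSup_le_of_ae_enorm_bound (ae_of_all _ h)

end

/-- The estimates for the dyadic sum. -/
theorem exists_mixedNorm_tsum_dyadic_le {q r : ℝ≥0∞} (hq : 2 < q) (hr : 2 < r)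
    (hqr : (q⁻¹).toReal < 1 / 2 - (r⁻¹).toReal) (hne : (q, r) ≠ (∞, ∞)) :
    ∃ C : ℝ≥0, ∀ f : Plane → ℂ, (∀ k, IntegrableOn f (dyadic k)) →
      mixedNorm q r (fun t x => ∑' k, blockWave (dyadic k) f t x) ≤
        C * dyadicMass (scalingExponent q r) f ^ (1 / 2 : ℝ) := by
  rcases eq_or_ne q ∞ with rfl | hqt
  -- With q = ∞ no exponent in time is left to sum in, so the blocks are summed in the radial
  -- variable at each fixed time; this needs r < ∞.
  · have hrt : r ≠ ∞ := fun h => hne (by rw [h])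
    have hr2 : 2 < r.toReal := by
      simpa using (ENNReal.toReal_lt_toReal ENNReal.ofNat_ne_top hrt).2 hr
    obtain ⟨C, hC⟩ := eLpNorm_tsum_angularNorm_le hr2
    refine ⟨C, fun f hf => mixedNorm_top_le fun t => ?_⟩
    refine (radialAngularNorm_tsum_le' (fun k => measurable_blockWave (hf k) t) r).trans ?_
    have := hC f hf t
    rw [ENNReal.ofReal_toReal hrt] at this
    have e : scalingExponent ∞ r = 1 - 2 * (1 / r.toReal) := by
      rw [scalingExponent, ENNReal.toReal_inv]; simp; ring
    rwa [e]
  · have hq2 : 2 < q.toReal := by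
      simpa using (ENNReal.toReal_lt_toReal ENNReal.ofNat_ne_top hqt).2 hq
    obtain ⟨C, hC⟩ := eLpNorm_tsum_radialAngularNorm_le hq2 hr
      (by rwa [ENNReal.toReal_inv, ← one_div] at hqr)
    refine ⟨C, fun f hf => ?_⟩
    have h := hC f hf
    rw [ENNReal.ofReal_toReal hqt] at h
    have e : scalingExponent q r = 1 - 2 * (r⁻¹).toReal - 1 / q.toReal := by
      rw [scalingExponent, ENNReal.toReal_inv q]; ring
    rw [e]
    refine le_trans (eLpNorm_mono_enorm fun t => ?_) h
    simp only [enorm_eq_self]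
    exact radialAngularNorm_tsum_le (fun k => measurable_blockWave (hf k) t)
      (one_le_two.trans hr.le)

end AngularStrichartz

theorem proposition1p2 (q r : ℝ≥0∞)
    (hqr : (2 < q ∧ 2 < r ∧ (q⁻¹).toReal < 1 / 2 - (r⁻¹).toReal ∧ (q, r) ≠ (∞, ∞)) ∨
      (q, r) = (∞, 2)) :
    ∃ C : ℝ≥0, ∀ g : 𝓢'(Plane, ℂ), MemHomSobolev (scalingExponent q r) g →
      -- the half-wave evolution of `g` is a jointly measurable function on `ℝ × ℝ²`
      (∃ u : ℝ → Plane → ℂ, StronglyMeasurable (Function.uncurry u) ∧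
        ∀ t : ℝ, Represents (u t) (halfWave t g)) ∧
      -- and every function that represents it satisfies the estimate
      ∀ u : ℝ → Plane → ℂ, (∀ᵐ t : ℝ, Represents (u t) (halfWave t g)) →
        mixedNorm q r u ≤ (C : ℝ≥0∞) * homSobolevNorm (scalingExponent q r) g := by
  rcases hqr with ⟨hq, hr, hlt, hne⟩ | h
  · have hγ : 0 < scalingExponent q r := by
      have := inv_toReal_lt_half hr
      rw [scalingExponent]
      linarith
    obtain ⟨C, hC⟩ := exists_mixedNorm_tsum_dyadic_le hq hr hlt hne
    refine ⟨C, fun g hg => ⟨⟨fun t x => ∑' k, blockWave (dyadic k) (fourierDensity g) t x,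
      stronglyMeasurable_tsum_blockWave hg.integrableOn_dyadic,
      hg.represents_tsum_dyadic hγ⟩, fun u hu => ?_⟩⟩
    rw [mixedNorm_congr_of_represents hu (hg.represents_tsum_dyadic hγ) q r]
    exact (hC _ hg.integrableOn_dyadic).trans (mul_le_mul_right (hg.dyadicMass_le hγ.le) _)
  · obtain ⟨rfl, rfl⟩ := Prod.mk.inj h
    have hγ : scalingExponent ∞ 2 = 0 := by
      norm_num [scalingExponent]
    rw [hγ]
    refine ⟨6, fun g hg => ?_⟩
    obtain ⟨v, hvm, hv, hv6⟩ := hg.exists_finiteEnergy_solution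
    refine ⟨⟨v, hvm, hv⟩, fun u hu => ?_⟩
    rw [mixedNorm_congr_of_represents hu hv]
    exact mixedNorm_top_le (by simpa using hv6)
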